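/- **Theorem 3.6.** Let $\Omega\subset\mathbb R^3$ be a bounded domain with smooth boundary, let $\Gamma\subset\partial\Omega$ be non-empty and relatively open, and let $d\in C^2(\overline\Omega)$ satisfy $$d>0\ \text{ in }\Omega,\qquad |\nabla d|>0\ \text{ on }\overline\Omega,\qquad d=0\ \text{ on }\partial\Omega\setminus\Gamma .$$ Let $T>0$, $t_0\in(0,T)$, $\beta>0$, $c_0:=\max\{\beta t_0^2,\beta(T-t_0)^2\}$ and, for $\lambda>0$, $$\varphi(x,t):=e^{\lambda\psi(x,t)},\qquad \psi(x,t):=d(x)-\beta(t-t_0)^2+c_0 .$$ Let $A=(A_{kj})\in W^{1,\infty}(\Omega)^{3\times3}$ and $b\in W^{2,\infty}(\Omega)^3$, identified with their representatives that are continuous on $\overline\Omega$, and put $$Pf:=\operatorname{div}(fA),\quad [Pf]_k=\sum_{j=1}^3\partial_j(fA_{kj}),\qquad Qg:=\operatorname{rot}(gb).$$ Let $O\subset\Omega$ be an open subset such that $$\det A(x)\neq0\quad\text{and}\quad |\nabla d(x)\times b(x)|\neq0\qquad\text{for all }x\in\overline O .$$ Then there exist constants $\lambda_0\ge1$, $s_0\ge1$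 and $C>0$ such that for all $\lambda\ge\lambda_0$, all $s\ge s_0$, all $f\in H^1(\Omega)$ and all $g\in H^2(\Omega)$, $$\int_O\big(|\nabla f|^2+s^2\lambda^2\varphi^2(x,t_0)|f|^2\big)e^{2s\varphi(x,t_0)}\,dx\le C\int_O|Pf|^2e^{2s\varphi(x,t_0)}\,dx+C\int_{\partial O}s\lambda\,\varphi(x,t_0)|f|^2e^{2s\varphi(x,t_0)}\,d\sigma$$ and $$\int_O\big(|\nabla g|^2+s^2\lambda^2\varphi^2(x,t_0)|g|^2\big)e^{2s\varphi(x,t_0)}\,dx\le C\int_O\Big(\frac{1}{s^2\lambda^2\varphi^2(x,t_0)}|\nabla(Qg)|^2+|Qg|^2\Big)e^{2s\varphi(x,t_0)}\,dx$$ $$\qquad\qquad+\,C\int_{\partial O}\Big(\frac{1}{s\lambda\varphi(x,t_0)}|\nabla g|^2+s\lambda\varphi(x,t_0)|g|^2\Big)e^{2s\varphi(x,t_0)}\,d\sigma .$$ In particular $C$ does not depend on $\lambda$, $s$, $f$, $g$. Here $\sigma$ is surface measure on $\partial O$ (two-dimensional Hausdorff measure), and $f$, $g$, $\nabla g$ on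 $\partial O$ are understood as traces: a trace on $\partial O$ of $u\in H^1(\Omega)$ is an $L^2(\partial O,\sigma)$-limit of the restrictions to $\partial O$ of smooth functions that converge to $u$ in $H^1(\Omega)$, and each inequality is asserted whenever the traces it involves exist. -/

import Mathlib

open MeasureTheory Set Filter Topology
open scoped ContDiff ENNReal

noncomputable section

namespace CarlemanReg

/-- Three-dimensional Euclidean space. -/
abbrev E3 : Type := EuclideanSpace ℝ (Fin 3)

/-- The `j`-th standard basis vector. -/
def basisVec (j : Fin 3) : E3 := EuclideanSpace.single j (1 : ℝ)

/-- The boundary of `Ω` is smooth: near each boundary point `Ω` is the sublevel set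
`{ρ < 0}` of a smooth function with non-vanishing differential. -/
def HasSmoothBoundary (Ω : Set E3) : Prop :=
  ∀ x ∈ frontier Ω, ∃ (U : Set E3) (ρ : E3 → ℝ), IsOpen U ∧ x ∈ U ∧
    ContDiffOn ℝ ∞ ρ U ∧ (∀ y ∈ U, fderiv ℝ ρ y ≠ 0) ∧
    Ω ∩ U = {y | y ∈ U ∧ ρ y < 0}

/-- A bounded domain (open, connected, non-empty) with smooth boundary. -/
structure IsSmoothBoundedDomain (Ω : Set E3) : Prop where
  isOpen : IsOpen Ω
  isConnected : IsConnected Ω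
  isBounded : Bornology.IsBounded Ω
  smooth : HasSmoothBoundary Ω

/-! ### Weak derivatives and Sobolev spaces -/

/-- `v` is the weak partial derivative `∂_j u` on the open set `Ω`. -/
def HasWeakPartial (Ω : Set E3) (j : Fin 3) (u v : E3 → ℝ) : Prop :=
  LocallyIntegrableOn u Ω ∧ LocallyIntegrableOn v Ω ∧
    ∀ η : E3 → ℝ, ContDiff ℝ ∞ η → HasCompactSupport η → tsupport η ⊆ Ω →
      ∫ x in Ω, u x * fderiv ℝ η x (basisVec j) = -∫ x in Ω, v x * η x

open Classical in
/-- The weak partial derivative `∂_j u` on `Ω` (determined almost everywhere in `Ω`);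
it is zero by convention when `u` has none. -/
def weakPartial (Ω : Set E3) (j : Fin 3) (u : E3 → ℝ) : E3 → ℝ :=
  if h : ∃ v, HasWeakPartial Ω j u v then h.choose else 0

/-- Membership in the Sobolev space `W^{k,p}(Ω)`; `H^k(Ω)` is the case `p = 2`. -/
def MemSobolev (Ω : Set E3) (p : ℝ≥0∞) : ℕ → (E3 → ℝ) → Prop
  | 0, u => MemLp u p (volume.restrict Ω)
  | k + 1, u => MemLp u p (volume.restrict Ω) ∧
      ∀ j, (∃ v, HasWeakPartial Ω j u v) ∧ MemSobolev Ω p k (weakPartial Ω j u)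

/-! ### The two first-order operators -/

/-- `P f = div (f A)`, where `[div M]_k = ∑_j ∂_j M_{kj}`. -/
def opP (Ω : Set E3) (A : E3 → Matrix (Fin 3) (Fin 3) ℝ) (f : E3 → ℝ) (x : E3) :
    Fin 3 → ℝ :=
  fun k => ∑ j, weakPartial Ω j (fun y => f y * A y k j) x

/-- The rotation (curl) of a vector field. -/
def rot (Ω : Set E3) (v : E3 → Fin 3 → ℝ) (x : E3) : Fin 3 → ℝ :=
  ![weakPartial Ω 1 (fun y => v y 2) x - weakPartial Ω 2 (fun y => v y 1) x,
    weakPartial Ω 2 (fun y => v y 0) x - weakPartial Ω 0 (fun y => v y 2) x,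
    weakPartial Ω 0 (fun y => v y 1) x - weakPartial Ω 1 (fun y => v y 0) x]

/-- `Q g = rot (g b)`. -/
def opQ (Ω : Set E3) (b : E3 → Fin 3 → ℝ) (g : E3 → ℝ) (x : E3) : Fin 3 → ℝ :=
  rot Ω (fun y i => g y * b y i) x

/-! ### Surface measure and traces -/

/-- Surface measure in three-dimensional space: the two-dimensional Hausdorff measure,
normalised by `π / 4` so that it agrees with area on planes and smooth surfaces
(the unnormalised measure `μH[2]` gives a disc of diameter `δ` the mass `δ ^ 2`). -/
def surfaceMeasure : Measure E3 := ENNReal.ofReal (Real.pi / 4) • Measure.hausdorffMeasure 2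

/-- `τ` is the trace on `S` (a subset of the closure of `Ω`) of `f ∈ H^1(Ω)`: the restrictions
to `S` of some smooth functions converging to `f` in `H^1(Ω)` converge to `τ` in `L^2(S)`. -/
def IsTrace (Ω S : Set E3) (f τ : E3 → ℝ) : Prop :=
  AEStronglyMeasurable τ (surfaceMeasure.restrict S) ∧
  ∃ F : ℕ → E3 → ℝ, (∀ n, ContDiff ℝ ∞ (F n)) ∧
    Tendsto (fun n => eLpNorm (fun x => F n x - f x) 2 (volume.restrict Ω)) atTop (𝓝 0) ∧
    (∀ j, Tendsto (fun n => eLpNorm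
        (fun x => fderiv ℝ (F n) x (basisVec j) - weakPartial Ω j f x) 2 (volume.restrict Ω))
      atTop (𝓝 0)) ∧
    Tendsto (fun n => eLpNorm (fun x => F n x - τ x) 2 (surfaceMeasure.restrict S))
      atTop (𝓝 0)

/-! ### The weight -/

/-- The gradient on the closure of `Ω` of a function that is `C^1` up to the boundary. -/
def gradBar (Ω : Set E3) (d : E3 → ℝ) (x : E3) : Fin 3 → ℝ :=
  fun j => fderivWithin ℝ d (closure Ω) x (basisVec j)

/-- `d ∈ C^2(closure Ω)`, `d > 0` in `Ω`, `|∇d| > 0` on `closure Ω`, and `d = 0` on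
`∂Ω \ Γ`. -/
structure IsWeightBase (Ω Γ : Set E3) (d : E3 → ℝ) : Prop where
  contDiffOn : ContDiffOn ℝ 2 d (closure Ω)
  pos : ∀ x ∈ Ω, 0 < d x
  grad_ne_zero : ∀ x ∈ closure Ω, gradBar Ω d x ≠ 0
  eq_zero : ∀ x ∈ frontier Ω \ Γ, d x = 0

/-- `c₀ = max {β t₀², β (T - t₀)²}`. -/
def c0 (β t₀ T : ℝ) : ℝ := max (β * t₀ ^ 2) (β * (T - t₀) ^ 2)

/-- `ψ(x,t) = d(x) - β (t - t₀)² + c₀`. -/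
def psi (d : E3 → ℝ) (β t₀ T : ℝ) (x : E3) (t : ℝ) : ℝ :=
  d x - β * (t - t₀) ^ 2 + c0 β t₀ T

/-- The regular weight `φ(x,t) = exp (lam ψ(x,t))`. -/
def phi (d : E3 → ℝ) (β t₀ T lam : ℝ) (x : E3) (t : ℝ) : ℝ :=
  Real.exp (lam * psi d β t₀ T x t)

end CarlemanReg

end

/-! Weighted first-order estimates on open sets with arbitrary boundary, and the Carleman
estimates for `div (f A)` and `rot (g b)`. -/

noncomputable section

namespace CarlemanReg


/-! ### The closure of a smooth domain and the gradient of the weight base -/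

/-! Both estimates come from one weighted inequality for a transport operator `X · ∇`, where `X` is
bounded on `O`, has bounded weak divergence `D`, and satisfies `X · ∇d ≥ c > 0`. Write `φ = exp (λ
(d + c₀))` for the weight at `t₀`, `σ = s λ φ` and `W = K φ^κ exp (2 s φ)` with `|κ| ≤ 1`. Then `X ·
∇W ≥ c σ W`. Integrating the divergence of `F² W X`, completing a square and using `σ ≥ s` to
swallow `D` bounds `∫ W σ F²` by a constant times `∫ (W / σ) (X · ∇F)² + ∫_{∂O} W F²`
(`transport_estimate_smooth`). The choices `κ = 1`, `K = s λ` and `κ = -1`, `K = 1 / (s λ)` give the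
two halves of `IsTransversalField.carleman`, which differ by the factor `s² λ² φ²`.

For `P`, take `X` to be a smooth approximation of `∇d`. Since `P f = A ∇f + f div A` and `A` is
invertible, all of `∇f` is controlled pointwise by `P f` and `f`. For `Q`, one has `Q g = ∇g × b + g
rot b`, which misses the derivative of `g` along `b`. With `w` a smooth approximation of `∇d × b`
and `X = b × w`, the scalar triple product gives `X · ∇g = w · (∇g × b)`, so `X · ∇g` is controlled
by `Q g` and `g`, and likewise `X · ∇(∂_j g)` by `∂_j Q g` and lower-order terms. The estimate with
`κ = 1` is applied to `g`, the one with `κ = -1` to each `∂_j g`. The lower-order terms gain a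
factor `1 / s²` and are absorbed for large `s` (`absorb_lower_order`).

The boundary of `O` is an arbitrary closed set, so the divergence theorem is replaced by cut-offs.
For smooth `F`, the square `F²` is truncated to `((|F| - ε)⁺)²`, which vanishes near the frontier
points with `|F| < ε`. The remaining frontier points form a compact set, which is covered by small
balls with `∑ F² W r²` comparable to the integral of `F² W` against the two-dimensional Hausdorff
measure. A cut-off across a ball of radius `r` has gradient of size `1 / r` on a volume of size
`r³`, so its cost is exactly of that order (`exists_hausdorff_cutoff`). Then `ε → 0` by Fatou's
lemma, and the smooth functions defining the trace carry the estimate over to Sobolev functions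
(`transport_estimate`). -/

theorem HasSmoothBoundary.uniqueDiffOn_closure {Ω : Set E3} (hO : IsOpen Ω)
    (h : HasSmoothBoundary Ω) : UniqueDiffOn ℝ (closure Ω) := by
  intro x hx
  by_cases hxΩ : x ∈ Ω
  · exact uniqueDiffWithinAt_of_mem_nhds (mem_of_superset (hO.mem_nhds hxΩ) subset_closure)
  have hxf : x ∈ frontier Ω := by rw [hO.frontier_eq]; exact ⟨hx, hxΩ⟩
  obtain ⟨U, ρ, hU, hxU, hρ, hρ', hΩU⟩ := h x hxf
  have hdiff : ContDiffAt ℝ ∞ ρ x := hρ.contDiffAt (hU.mem_nhds hxU)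
  have hd : HasFDerivAt ρ (fderiv ℝ ρ x) x := (hdiff.differentiableAt (by simp)).hasFDerivAt
  have hρx : ρ x = 0 := by
    apply le_antisymm
    · have h1 : x ∈ closure (Ω ∩ U) := by
        rw [inter_comm]; exact hU.inter_closure ⟨hxU, hx⟩
      have := mem_closure_iff_nhdsWithin_neBot.1 h1
      refine le_of_tendsto (f := ρ) (x := 𝓝[Ω ∩ U] x) (b := 0) ?_ ?_ (a := ρ x)
      · exact hd.continuousAt.continuousWithinAt
      · filter_upwards [self_mem_nhdsWithin] with y hy
        rw [hΩU] at hy; exact hy.2.le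
    · by_contra! hlt
      have : x ∈ Ω ∩ U := by rw [hΩU]; exact ⟨hxU, hlt⟩
      exact hxΩ this.1
  -- Moving from a boundary point in a direction along which `ρ` strictly decreases enters `Ω`, so
  -- the tangent cone contains an open half-space.
  have hcone : ∀ v, fderiv ℝ ρ x v < 0 → v ∈ tangentConeAt ℝ Ω x := by
    intro v hv
    refine mem_tangentConeAt_of_add_smul_mem (l := 𝓝[>] (0 : ℝ)) (c := fun t => t)
      (tendsto_id'.mpr <| nhdsGT_le_nhdsNE 0) ?_
    have hline : HasDerivAt (fun t : ℝ => ρ (x + t • v)) (fderiv ℝ ρ x v) 0 := by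
      have h2 : HasDerivAt (fun t : ℝ => x + t • v) v 0 := by
        simpa using ((hasDerivAt_id (0 : ℝ)).smul_const v).const_add x
      have h3 : HasFDerivAt ρ (fderiv ℝ ρ x) (x + (0 : ℝ) • v) := by simpa using hd
      exact h3.comp_hasDerivAt (0 : ℝ) h2
    have hslope := (hasDerivAt_iff_tendsto_slope.1 hline).mono_left (nhdsGT_le_nhdsNE 0)
    have hneg := hslope.eventually (gt_mem_nhds hv)
    have hmemU : ∀ᶠ t : ℝ in 𝓝[>] 0, x + t • v ∈ U := by
      have : ContinuousAt (fun t : ℝ => x + t • v) 0 := by fun_prop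
      exact (this.eventually (by simpa using hU.mem_nhds hxU)).filter_mono nhdsWithin_le_nhds
    filter_upwards [hneg, hmemU, self_mem_nhdsWithin] with t ht htU ht0
    have ht0' : (0 : ℝ) < t := ht0
    have : x + t • v ∈ Ω ∩ U := by
      rw [hΩU]
      refine ⟨htU, ?_⟩
      rw [slope_def_field] at ht
      simp only [zero_smul, add_zero, hρx, sub_zero] at ht
      by_contra! hge
      exact absurd ht (not_lt.2 (div_nonneg hge ht0'.le))
    exact this.1
  refine UniqueDiffWithinAt.closure ⟨?_, hx⟩
  obtain ⟨v₀, hv₀⟩ : ∃ v, fderiv ℝ ρ x v < 0 := by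
    obtain ⟨v, hv⟩ : ∃ v, fderiv ℝ ρ x v ≠ 0 := by
      by_contra! hall
      exact hρ' x hxU (ContinuousLinearMap.ext hall)
    rcases lt_or_gt_of_ne hv with hlt | hgt
    · exact ⟨v, hlt⟩
    · exact ⟨-v, by simpa using hgt⟩
  -- Any `v` enters the half-space after adding a large multiple of `v₀`, hence is a difference of
  -- two elements of the span.
  have htop : Submodule.span ℝ (tangentConeAt ℝ Ω x) = ⊤ := by
    rw [eq_top_iff]
    intro v _
    obtain ⟨n, hn⟩ : ∃ n : ℝ, fderiv ℝ ρ x (v + n • v₀) < 0 := by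
      refine ⟨(1 + |fderiv ℝ ρ x v|) / (-(fderiv ℝ ρ x v₀)), ?_⟩
      have : fderiv ℝ ρ x v₀ ≠ 0 := hv₀.ne
      have h1 : fderiv ℝ ρ x (v + ((1 + |fderiv ℝ ρ x v|) / (-(fderiv ℝ ρ x v₀))) • v₀)
          = fderiv ℝ ρ x v - (1 + |fderiv ℝ ρ x v|) := by
        simp only [map_add, map_smul, smul_eq_mul]; field_simp; ring
      rw [h1]
      linarith [le_abs_self (fderiv ℝ ρ x v)]
    have h1 := Submodule.subset_span (R := ℝ) (hcone _ hn)
    have h2 := Submodule.subset_span (R := ℝ) (hcone _ hv₀)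
    have := Submodule.sub_mem _ h1 (Submodule.smul_mem _ n h2)
    simpa using this
  rw [htop]
  exact dense_univ

theorem continuousOn_gradBar {Ω : Set E3} {d : E3 → ℝ} (hU : UniqueDiffOn ℝ (closure Ω))
    (hd : ContDiffOn ℝ 2 d (closure Ω)) : ContinuousOn (gradBar Ω d) (closure Ω) := by
  refine continuousOn_pi.2 fun j => ?_
  exact (hd.continuousOn_fderivWithin hU (by norm_num)).clm_apply continuousOn_const

theorem gradBar_eq {Ω : Set E3} (hO : IsOpen Ω) {d : E3 → ℝ} {x : E3} (hx : x ∈ Ω) (j : Fin 3) :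
    gradBar Ω d x j = fderiv ℝ d x (basisVec j) := by
  unfold gradBar
  rw [fderivWithin_of_mem_nhds (mem_of_superset (hO.mem_nhds hx) subset_closure)]

/-! ### Smooth approximation of continuous fields on compact sets -/

/-- Tietze extension from `K`, then uniform smooth approximation on the whole space. -/
theorem exists_smooth_approx {K : Set E3} (hK : IsCompact K) {v : E3 → ℝ} (hv : ContinuousOn v K)
    {κ : ℝ} (hκ : 0 < κ) : ∃ w : E3 → ℝ, ContDiff ℝ ∞ w ∧ ∀ x ∈ K, |w x - v x| < κ := by
  obtain ⟨g, hg⟩ := ContinuousMap.exists_restrict_eq hK.isClosed ⟨K.domRestrict v, hv.domRestrict⟩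
  obtain ⟨w, hw1, hw2, -⟩ := g.continuous.exists_contDiff_approx ⊤ (ε := fun _ => κ)
    continuous_const (fun _ => hκ)
  refine ⟨w, by simpa using hw1, fun x hx => ?_⟩
  have h1 : g x = v x := by
    have := congrArg (fun f => f ⟨x, hx⟩) hg
    exact this
  have := hw2 x
  rwa [h1, Real.dist_eq] at this

/-- The transversal direction built from `∇d` is only known to be continuous up to the closure.
Replacing it by a smooth `w` keeps the scalar product bounded below and lets the weak divergence of
the resulting field be computed by the product rule. -/
theorem exists_smooth_dot_ge {K : Set E3} (hK : IsCompact K) {v : E3 → Fin 3 → ℝ}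
    (hv : ContinuousOn v K) (h0 : ∀ x ∈ K, v x ≠ 0) :
    ∃ w : Fin 3 → E3 → ℝ, (∀ j, ContDiff ℝ ∞ (w j)) ∧
      ∃ c : ℝ, 0 < c ∧ ∀ x ∈ K, c ≤ ∑ j, w j x * v x j := by
  rcases K.eq_empty_or_nonempty with rfl | hne
  · exact ⟨fun _ _ => 0, fun _ => contDiff_const, 1, one_pos, by simp⟩
  have hvj : ∀ j, ContinuousOn (fun x => v x j) K := fun j => (continuousOn_pi.1 hv) j
  have hq : ContinuousOn (fun x => ∑ j, v x j ^ 2) K :=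
    continuousOn_finsetSum _ fun j _ => (hvj j).pow 2
  have hs : ContinuousOn (fun x => ∑ j, |v x j|) K :=
    continuousOn_finsetSum _ fun j _ => (hvj j).abs
  obtain ⟨x0, hx0, hmin⟩ := hK.exists_isMinOn hne hq
  obtain ⟨x1, hx1, hmax⟩ := hK.exists_isMaxOn hne hs
  set m := ∑ j, v x0 j ^ 2 with hm
  set M := ∑ j, |v x1 j| with hM
  have hmpos : 0 < m := by
    obtain ⟨j, hj⟩ := Function.ne_iff.1 (h0 x0 hx0)
    exact Finset.sum_pos' (fun i _ => sq_nonneg _) ⟨j, Finset.mem_univ _, sq_pos_of_ne_zero hj⟩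
  have hM0 : 0 ≤ M := Finset.sum_nonneg fun _ _ => abs_nonneg _
  -- An approximation error `κ` costs at most `κ ∑ |v_j| ≤ κ M`, which is to be below half of the
  -- minimum `m` of `|v|²`; `M + 1` avoids dividing by zero.
  set κ := m / (2 * (M + 1)) with hκ
  have hκpos : 0 < κ := by positivity
  choose w hw hw' using fun j => exists_smooth_approx hK (hvj j) hκpos
  refine ⟨w, hw, m / 2, by positivity, fun x hx => ?_⟩
  have h1 : m ≤ ∑ j, v x j ^ 2 := hmin hx
  have h2 : ∑ j, |v x j| ≤ M := hmax hx
  have h3 : ∑ j, (v x j ^ 2 - κ * |v x j|) ≤ ∑ j, w j x * v x j := by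
    refine Finset.sum_le_sum fun j _ => ?_
    have h4 : |(w j x - v x j) * v x j| ≤ κ * |v x j| := by
      rw [abs_mul]; exact mul_le_mul_of_nonneg_right (hw' j x hx).le (abs_nonneg _)
    nlinarith [neg_abs_le ((w j x - v x j) * v x j)]
  rw [Finset.sum_sub_distrib, ← Finset.mul_sum] at h3
  have h5 : κ * ∑ j, |v x j| ≤ m / 2 := by
    calc κ * ∑ j, |v x j| ≤ κ * (M + 1) := by gcongr; linarith
      _ = m / 2 := by rw [hκ]; field_simp
  linarith

/-! ### Weak derivatives tested with `C^1` functions -/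

/-- Mollification. The compact set `K` is chosen before `ε`, so that all approximants live on one
set where dominated convergence applies. This matters because the test functions used later contain
a truncated square and are only `C¹`. -/
theorem exists_smooth_approx_of_contDiff_one {Ω : Set E3} (hΩ : IsOpen Ω) {η : E3 → ℝ}
    (hη : ContDiff ℝ 1 η) (hc : HasCompactSupport η) (hs : tsupport η ⊆ Ω) (j : Fin 3) :
    ∃ K : Set E3, IsCompact K ∧ K ⊆ Ω ∧ tsupport η ⊆ K ∧
      ∀ ε : ℝ, 0 < ε → ∃ ζ : E3 → ℝ, ContDiff ℝ ∞ ζ ∧ tsupport ζ ⊆ K ∧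
      (∀ x, |ζ x - η x| ≤ ε) ∧
      ∀ x, |fderiv ℝ ζ x (basisVec j) - fderiv ℝ η x (basisVec j)| ≤ ε := by
  obtain ⟨δ, hδ, hδs⟩ := hc.isCompact.exists_cthickening_subset_open hΩ hs
  refine ⟨Metric.cthickening δ (tsupport η), hc.isCompact.cthickening, hδs,
    Metric.self_subset_cthickening _, fun ε hε => ?_⟩
  have hηd : Continuous (fun x => fderiv ℝ η x (basisVec j)) :=
    (hη.continuous_fderiv one_ne_zero).clm_apply continuous_const
  have hcd : HasCompactSupport (fun x => fderiv ℝ η x (basisVec j)) :=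
    (hc.fderiv ℝ).comp_left (g := fun L : E3 →L[ℝ] ℝ => L (basisVec j)) (by simp)
  have hu1 := hc.uniformContinuous_of_continuous hη.continuous
  have hu2 := hcd.uniformContinuous_of_continuous hηd
  obtain ⟨δ1, hδ1, h1⟩ := Metric.uniformContinuous_iff.1 hu1 ε hε
  obtain ⟨δ2, hδ2, h2⟩ := Metric.uniformContinuous_iff.1 hu2 ε hε
  -- The bound by `δ` keeps the support in the thickening; `δ1` and `δ2` are moduli of uniform
  -- continuity for `η` and its derivative.
  set r := min δ (min δ1 δ2) with hr
  have hrpos : 0 < r := by positivity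
  let φ : ContDiffBump (0 : E3) := ⟨r / 2, r, by positivity, by linarith⟩
  have hφ : φ.rOut = r := rfl
  let L := ContinuousLinearMap.lsmul ℝ ℝ (E := ℝ)
  have hloc : LocallyIntegrable (φ.normed volume) volume :=
    (φ.continuous_normed (μ := volume)).locallyIntegrable
  refine ⟨MeasureTheory.convolution (φ.normed volume) η L volume, ?_, ?_, ?_, ?_⟩
  · exact φ.hasCompactSupport_normed.contDiff_convolution_left _ φ.contDiff_normed
      (hη.continuous.locallyIntegrable)
  · refine closure_minimal ?_ Metric.isClosed_cthickening
    refine (support_convolution_subset (L := L)).trans ?_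
    rw [φ.support_normed_eq, hφ]
    rintro _ ⟨a, ha, y, hy, rfl⟩
    refine Metric.mem_cthickening_of_dist_le _ y _ _ (subset_tsupport _ hy) ?_
    have : ‖a‖ < r := by simpa using ha
    simpa using this.le.trans (min_le_left _ _)
  · intro x
    have := φ.dist_normed_convolution_le (μ := volume) (g := η) (x₀ := x) (ε := ε)
      hη.continuous.aestronglyMeasurable (fun y hy => by
        refine (h1 (lt_of_lt_of_le (Metric.mem_ball.1 hy) ?_)).le
        exact (min_le_right _ _).trans (min_le_left _ _))
    rwa [Real.dist_eq] at this
  · intro x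
    rw [(hc.hasFDerivAt_convolution_right L hloc hη x).fderiv,
      convolution_precompR_apply L hloc (hc.fderiv ℝ) (hη.continuous_fderiv one_ne_zero)]
    have := φ.dist_normed_convolution_le (μ := volume)
      (g := fun x => fderiv ℝ η x (basisVec j)) (x₀ := x) (ε := ε)
      hηd.aestronglyMeasurable (fun y hy => by
        refine (h2 (lt_of_lt_of_le (Metric.mem_ball.1 hy) ?_)).le
        exact (min_le_right _ _).trans (min_le_right _ _))
    rwa [Real.dist_eq] at this

theorem HasWeakPartial.integral_eq_of_contDiff_one {Ω : Set E3} (hΩ : IsOpen Ω) {j : Fin 3}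
    {u v : E3 → ℝ} (h : HasWeakPartial Ω j u v) {η : E3 → ℝ}
    (hη : ContDiff ℝ 1 η) (hc : HasCompactSupport η) (hs : tsupport η ⊆ Ω) :
    ∫ x in Ω, u x * fderiv ℝ η x (basisVec j) = -∫ x in Ω, v x * η x := by
  obtain ⟨hu, hv, htest⟩ := h
  obtain ⟨K, hK, hKΩ, hηK, happ⟩ := exists_smooth_approx_of_contDiff_one hΩ hη hc hs j
  choose ζ hζ hζK hζ0 hζ1 using fun n : ℕ => happ (1 / ((n : ℝ) + 1)) (by positivity)
  have hlim : Tendsto (fun n : ℕ => 1 / ((n : ℝ) + 1)) atTop (𝓝 0) :=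
    tendsto_one_div_add_atTop_nhds_zero_nat
  have key : ∀ (a g : E3 → ℝ) (G : ℕ → E3 → ℝ), LocallyIntegrableOn a Ω → Continuous g →
      (∀ n, Continuous (G n)) → (∀ x ∉ K, g x = 0) → (∀ n, ∀ x ∉ K, G n x = 0) →
      (∀ n x, |G n x - g x| ≤ 1 / ((n : ℝ) + 1)) →
      Tendsto (fun n => ∫ x in Ω, a x * G n x) atTop (𝓝 (∫ x in Ω, a x * g x)) := by
    intro a g G ha hg hG hgK hGK hGg
    have haK : IntegrableOn a K := ha.integrableOn_compact_subset hKΩ hK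
    have hres : ∀ f : E3 → ℝ, (∀ x ∉ K, f x = 0) →
        ∫ x in Ω, a x * f x = ∫ x in K, a x * f x := by
      intro f hf
      refine setIntegral_eq_of_subset_of_forall_sdiff_eq_zero hΩ.measurableSet hKΩ ?_
      intro x hx; rw [hf x hx.2, mul_zero]
    rw [hres g hgK]
    simp_rw [fun n => hres (G n) (hGK n)]
    obtain ⟨B, hB⟩ := hK.exists_bound_of_continuousOn hg.continuousOn
    refine tendsto_integral_of_dominated_convergence (fun x => ‖a x‖ * (B + 1)) ?_ ?_ ?_ ?_
    · exact fun n => haK.aestronglyMeasurable.mul (hG n).aestronglyMeasurable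
    · exact haK.norm.mul_const _
    · intro n
      filter_upwards [ae_restrict_mem hK.measurableSet] with x hx
      rw [norm_mul]
      gcongr
      have h1 : 1 / ((n : ℝ) + 1) ≤ 1 := by
        rw [div_le_one (by positivity)]; linarith [(Nat.cast_nonneg n : (0 : ℝ) ≤ n)]
      calc ‖G n x‖ = ‖g x + (G n x - g x)‖ := by congr 1; ring
        _ ≤ ‖g x‖ + |G n x - g x| := norm_add_le _ _
        _ ≤ B + 1 := add_le_add (hB x hx) ((hGg n x).trans h1)
    · refine Eventually.of_forall fun x => Tendsto.const_mul _ ?_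
      rw [tendsto_iff_dist_tendsto_zero]
      exact squeeze_zero (fun _ => dist_nonneg) (fun n => by rw [Real.dist_eq]; exact hGg n x) hlim
  have hcompact : ∀ n, HasCompactSupport (ζ n) := fun n =>
    HasCompactSupport.of_support_subset_isCompact hK ((subset_tsupport _).trans (hζK n))
  have hd0 : ∀ f : E3 → ℝ, tsupport f ⊆ K → ∀ x ∉ K, fderiv ℝ f x (basisVec j) = 0 := by
    intro f hf x hx
    have : fderiv ℝ f x = 0 := by
      by_contra hne
      exact hx (hf (support_fderiv_subset ℝ hne))
    rw [this]; rfl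
  have h0 : ∀ f : E3 → ℝ, tsupport f ⊆ K → ∀ x ∉ K, f x = 0 := fun f hf x hx =>
    image_eq_zero_of_notMem_tsupport fun hx' => hx (hf hx')
  have hA := key u (fun x => fderiv ℝ η x (basisVec j)) (fun n x => fderiv ℝ (ζ n) x (basisVec j))
    hu ((hη.continuous_fderiv one_ne_zero).clm_apply continuous_const)
    (fun n => ((hζ n).continuous_fderiv (by simp)).clm_apply continuous_const)
    (hd0 η hηK) (fun n => hd0 _ (hζK n)) hζ1
  have hB := (key v η ζ hv hη.continuous (fun n => (hζ n).continuous) (h0 η hηK)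
    (fun n => h0 _ (hζK n)) hζ0).neg
  have heq : ∀ n, ∫ x in Ω, u x * fderiv ℝ (ζ n) x (basisVec j) = -∫ x in Ω, v x * ζ n x :=
    fun n => htest _ (hζ n) (hcompact n) ((hζK n).trans hKΩ)
  simp_rw [heq] at hA
  exact tendsto_nhds_unique hA hB


/-! ### Coverings adapted to the two-dimensional Hausdorff measure -/

/-- An almost optimal cover in the definition of the Hausdorff measure is turned into balls centred
on `S`, with radii slightly larger than the diameters of the pieces. The factor `2` pays for `(D +
a)² ≤ 2 D² + 2 a²`. -/
theorem exists_ball_cover_of_hausdorffMeasure {S : Set E3} (hne : S.Nonempty)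
    (hS : Measure.hausdorffMeasure 2 S ≠ ⊤) {δ : ℝ} (hδ : 0 < δ) {ε : ℝ≥0∞} (hε : ε ≠ 0) :
    ∃ (x : ℕ → E3) (r : ℕ → ℝ), (∀ n, x n ∈ S) ∧ (∀ n, 0 < r n) ∧ (∀ n, r n < δ) ∧
      S ⊆ ⋃ n, Metric.ball (x n) (r n) ∧
      ∑' n, ENNReal.ofReal (r n ^ 2) ≤ 2 * Measure.hausdorffMeasure 2 S + ε := by
  classical
  have hε4 : ε / 4 ≠ 0 := by simp [hε]
  have hlt : Measure.hausdorffMeasure 2 S < Measure.hausdorffMeasure 2 S + ε / 4 :=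
    ENNReal.lt_add_right hS hε4
  have hcov : ⨅ (t : ℕ → Set E3) (_ : S ⊆ ⋃ n, t n)
      (_ : ∀ n, Metric.ediam (t n) ≤ ENNReal.ofReal (δ / 2)),
      ∑' n, ⨆ _ : (t n).Nonempty, Metric.ediam (t n) ^ (2 : ℝ)
        < Measure.hausdorffMeasure 2 S + ε / 4 := by
    refine lt_of_le_of_lt ?_ hlt
    rw [Measure.hausdorffMeasure_apply]
    exact le_iSup₂_of_le (ENNReal.ofReal (δ / 2)) (by simpa using hδ) le_rfl
  simp only [iInf_lt_iff] at hcov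
  obtain ⟨t, htS, htd, hsum⟩ := hcov
  obtain ⟨e, he, hesum⟩ := ENNReal.exists_pos_sum_of_countable hε4 ℕ
  obtain ⟨x0, hx0⟩ := hne
  let u : ℕ → Set E3 := fun n => t n ∩ S
  let x : ℕ → E3 := fun n => if h : (u n).Nonempty then h.choose else x0
  have hxu : ∀ n, (u n).Nonempty → x n ∈ u n := fun n h => by
    simp only [x, dif_pos h]; exact h.choose_spec
  -- The enlargement makes the radius positive and the open ball cover its piece. It is summable
  -- through `e n`, satisfies `a² ≤ a` because `a ≤ 1`, and keeps the radius at most `δ / 2 + δ /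
  -- 4`.
  let a : ℕ → ℝ := fun n => min (e n : ℝ) (min 1 (δ / 4))
  have ha0 : ∀ n, 0 < a n := fun n => lt_min (by exact_mod_cast he n) (by positivity)
  have hfin : ∀ n, Metric.ediam (u n) ≤ ENNReal.ofReal (δ / 2) := fun n =>
    (Metric.ediam_mono inter_subset_left).trans (htd n)
  have hfin' : ∀ n, Metric.ediam (u n) ≠ ⊤ := fun n =>
    ((hfin n).trans_lt ENNReal.ofReal_lt_top).ne
  have hdiam : ∀ n, Metric.diam (u n) ≤ δ / 2 := fun n => by
    rw [Metric.diam]; exact ENNReal.toReal_le_of_le_ofReal (by positivity) (hfin n)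
  refine ⟨x, fun n => Metric.diam (u n) + a n, ?_, ?_, ?_, ?_, ?_⟩
  · intro n
    by_cases h : (u n).Nonempty
    · exact (hxu n h).2
    · simp only [x, dif_neg h]; exact hx0
  · intro n; have := Metric.diam_nonneg (s := u n); linarith [ha0 n]
  · intro n
    have : a n ≤ δ / 4 := (min_le_right _ _).trans (min_le_right _ _)
    linarith [hdiam n]
  · intro y hy
    obtain ⟨n, hn⟩ := mem_iUnion.1 (htS hy)
    refine mem_iUnion.2 ⟨n, ?_⟩
    have hyu : y ∈ u n := ⟨hn, hy⟩
    rw [Metric.mem_ball]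
    have := Metric.dist_le_diam_of_mem (Metric.isBounded_iff_ediam_ne_top.2 (hfin' n)) hyu
      (hxu n ⟨y, hyu⟩)
    linarith [ha0 n]
  · have hterm : ∀ n, ENNReal.ofReal ((Metric.diam (u n) + a n) ^ 2)
        ≤ 2 * (⨆ _ : (t n).Nonempty, Metric.ediam (t n) ^ (2 : ℝ)) + 2 * (e n : ℝ≥0∞) := by
      intro n
      have h1 : (Metric.diam (u n) + a n) ^ 2 ≤ 2 * Metric.diam (u n) ^ 2 + 2 * (e n : ℝ) := by
        have h2 : a n ≤ e n := min_le_left _ _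
        have h3 : a n ≤ 1 := (min_le_right _ _).trans (min_le_left _ _)
        nlinarith [sq_nonneg (Metric.diam (u n) - a n), ha0 n]
      refine (ENNReal.ofReal_le_ofReal h1).trans ?_
      rw [ENNReal.ofReal_add (by positivity) (by positivity), ENNReal.ofReal_mul (by norm_num),
        ENNReal.ofReal_mul (by norm_num), ENNReal.ofReal_coe_nnreal, ENNReal.ofReal_ofNat]
      gcongr
      rcases (u n).eq_empty_or_nonempty with h | h
      · simp [h]
      · have htn : (t n).Nonempty := h.mono inter_subset_left
        rw [ciSup_pos htn, ENNReal.ofReal_pow Metric.diam_nonneg, Metric.diam,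
          ENNReal.ofReal_toReal (hfin' n), ← ENNReal.rpow_natCast]
        refine ENNReal.rpow_le_rpow (Metric.ediam_mono inter_subset_left) (by norm_num)
    refine (ENNReal.tsum_le_tsum hterm).trans ?_
    rw [ENNReal.tsum_add, ENNReal.tsum_mul_left, ENNReal.tsum_mul_left]
    calc 2 * ∑' n, (⨆ _ : (t n).Nonempty, Metric.ediam (t n) ^ (2 : ℝ)) + 2 * ∑' n, (e n : ℝ≥0∞)
        ≤ 2 * (Measure.hausdorffMeasure 2 S + ε / 4) + 2 * (ε / 4) := by
          gcongr
      _ = 2 * Measure.hausdorffMeasure 2 S + 4 * (ε / 4) := by ring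
      _ = 2 * Measure.hausdorffMeasure 2 S + ε := by
          rw [ENNReal.mul_div_cancel (by norm_num) (by norm_num)]

/-- On each dyadic level set of `h` the weight is constant up to a factor `2`, so the unweighted
cover can be used level by level. The constant `4` is this `2` times the `2` of
`exists_ball_cover_of_hausdorffMeasure`. The lower bound `c` starts the dyadic scale and makes every
level set of finite measure. -/
theorem exists_weighted_ball_cover {S : Set E3} (hSm : MeasurableSet S) {h : E3 → ℝ}
    (hh : Measurable h) {c : ℝ} (hc : 0 < c) (hch : ∀ x ∈ S, c ≤ h x)
    (hI : ∫⁻ x in S, ENNReal.ofReal (h x) ∂(Measure.hausdorffMeasure 2) ≠ ⊤)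
    {δ : ℝ} (hδ : 0 < δ) {ε : ℝ≥0∞} (hε : ε ≠ 0) :
    ∃ (ι : Type) (x : ι → E3) (r : ι → ℝ), (∀ n, x n ∈ S) ∧ (∀ n, 0 < r n) ∧ (∀ n, r n < δ) ∧
      S ⊆ ⋃ n, Metric.ball (x n) (r n) ∧
      ∑' n, ENNReal.ofReal (h (x n) * r n ^ 2)
        ≤ 4 * ∫⁻ x in S, ENNReal.ofReal (h x) ∂(Measure.hausdorffMeasure 2) + ε := by
  let k : E3 → ℕ := fun x => Nat.log 2 ⌊h x / c⌋₊
  have hk : Measurable k :=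
    (measurable_from_nat (f := Nat.log 2)).comp (Nat.measurable_floor.comp (hh.div_const c))
  let T : ℕ → Set E3 := fun m => S ∩ k ⁻¹' {m}
  have hTm : ∀ m, MeasurableSet (T m) := fun m => hSm.inter (hk (measurableSet_singleton m))
  have hTd : Pairwise (Function.onFun Disjoint T) := by
    intro m n hmn
    refine Set.disjoint_left.2 fun x hx hx' => hmn ?_
    exact (hx.2 : k x = m).symm.trans hx'.2
  have hTU : ⋃ m, T m = S := by
    ext x; simp [T]
  have hlow : ∀ m, ∀ x ∈ T m, c * 2 ^ m ≤ h x := by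
    rintro m x ⟨hxS, hxm⟩
    have hxm' : Nat.log 2 ⌊h x / c⌋₊ = m := hxm
    have h1 : 1 ≤ h x / c := (one_le_div hc).2 (hch x hxS)
    have h2 : ⌊h x / c⌋₊ ≠ 0 := (Nat.floor_pos.2 h1).ne'
    have h3 := Nat.pow_log_le_self 2 h2
    rw [hxm'] at h3
    have h4 : ((2 ^ m : ℕ) : ℝ) ≤ h x / c := (Nat.cast_le.2 h3).trans (Nat.floor_le (by linarith))
    rw [le_div_iff₀ hc] at h4
    push_cast at h4
    linarith
  have hup : ∀ m, ∀ x ∈ T m, h x ≤ 2 * (c * 2 ^ m) := by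
    rintro m x ⟨hxS, hxm⟩
    have hxm' : Nat.log 2 ⌊h x / c⌋₊ = m := hxm
    have h3 := Nat.lt_pow_succ_log_self (b := 2) (by norm_num) ⌊h x / c⌋₊
    rw [hxm'] at h3
    have h4 : h x / c < ((2 ^ m.succ : ℕ) : ℝ) := (Nat.floor_lt' (by positivity)).1 h3
    rw [div_lt_iff₀ hc] at h4
    push_cast [pow_succ] at h4
    linarith
  set μ : Measure E3 := Measure.hausdorffMeasure 2 with hμ
  have hTint : ∀ m, ENNReal.ofReal (c * 2 ^ m) * μ (T m) ≤ ∫⁻ x in T m, ENNReal.ofReal (h x) ∂μ := by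
    intro m
    rw [← setLIntegral_const]
    exact setLIntegral_mono' (hTm m) fun x hx => ENNReal.ofReal_le_ofReal (hlow m x hx)
  have hTfin : ∀ m, μ (T m) ≠ ⊤ := by
    intro m hinf
    have h1 := hTint m
    rw [hinf, ENNReal.mul_top (by simp; positivity)] at h1
    exact hI (top_le_iff.1 (h1.trans (lintegral_mono_set inter_subset_left)))
  obtain ⟨e, he, hesum⟩ := ENNReal.exists_pos_sum_of_countable hε ℕ
  have hcov : ∀ m : {m // (T m).Nonempty}, ∃ (x : ℕ → E3) (r : ℕ → ℝ), (∀ n, x n ∈ T m) ∧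
      (∀ n, 0 < r n) ∧ (∀ n, r n < δ) ∧ T m ⊆ ⋃ n, Metric.ball (x n) (r n) ∧
      ∑' n, ENNReal.ofReal (r n ^ 2)
        -- The error is divided by the upper bound of `h` on the level, so that after weighting it
        -- is the summable `e m`.
        ≤ 2 * μ (T m) + (e m : ℝ≥0∞) / ENNReal.ofReal (2 * (c * 2 ^ (m : ℕ))) := fun m =>
    exists_ball_cover_of_hausdorffMeasure m.2 (hTfin m) hδ
      (ENNReal.div_ne_zero.2 ⟨by simpa using (he m).ne', ENNReal.ofReal_ne_top⟩)
  choose x r hxT hr0 hrδ hTc hsum using hcov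
  refine ⟨{m // (T m).Nonempty} × ℕ, fun p => x p.1 p.2, fun p => r p.1 p.2,
    fun p => (hxT p.1 p.2).1, fun p => hr0 _ _, fun p => hrδ _ _, ?_, ?_⟩
  · intro y hy
    rw [← hTU] at hy
    obtain ⟨m, hm⟩ := mem_iUnion.1 hy
    obtain ⟨n, hn⟩ := mem_iUnion.1 (hTc ⟨m, ⟨y, hm⟩⟩ hm)
    exact mem_iUnion.2 ⟨(⟨m, ⟨y, hm⟩⟩, n), hn⟩
  · rw [ENNReal.tsum_prod (f := fun m n => ENNReal.ofReal (h (x m n) * r m n ^ 2))]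
    have hm : ∀ m : {m // (T m).Nonempty}, ∑' n, ENNReal.ofReal (h (x m n) * r m n ^ 2)
        ≤ 4 * ∫⁻ y in T m, ENNReal.ofReal (h y) ∂μ + e m := by
      intro m
      calc ∑' n, ENNReal.ofReal (h (x m n) * r m n ^ 2)
          ≤ ∑' n, ENNReal.ofReal (2 * (c * 2 ^ (m : ℕ))) * ENNReal.ofReal (r m n ^ 2) := by
            refine ENNReal.tsum_le_tsum fun n => ?_
            rw [← ENNReal.ofReal_mul (by positivity)]
            exact ENNReal.ofReal_le_ofReal
              (mul_le_mul_of_nonneg_right (hup m _ (hxT m n)) (sq_nonneg _))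
        _ ≤ ENNReal.ofReal (2 * (c * 2 ^ (m : ℕ))) *
              (2 * μ (T m) + (e m : ℝ≥0∞) / ENNReal.ofReal (2 * (c * 2 ^ (m : ℕ)))) := by
            rw [ENNReal.tsum_mul_left]; gcongr; exact hsum m
        _ = 4 * (ENNReal.ofReal (c * 2 ^ (m : ℕ)) * μ (T m)) + e m := by
            rw [mul_add, ENNReal.mul_div_cancel (by simp; positivity) ENNReal.ofReal_ne_top,
              ENNReal.ofReal_mul (by norm_num), ENNReal.ofReal_ofNat]
            ring
        _ ≤ _ := by gcongr; exact hTint m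
    refine (ENNReal.tsum_le_tsum hm).trans ?_
    rw [ENNReal.tsum_add, ENNReal.tsum_mul_left]
    gcongr
    · calc ∑' m : {m // (T m).Nonempty}, ∫⁻ y in T m, ENNReal.ofReal (h y) ∂μ
          ≤ ∑' m, ∫⁻ y in T m, ENNReal.ofReal (h y) ∂μ :=
            ENNReal.tsum_comp_le_tsum_of_injective Subtype.val_injective
              (fun m => ∫⁻ y in T m, ENNReal.ofReal (h y) ∂μ)
        _ = ∫⁻ y in S, ENNReal.ofReal (h y) ∂μ := by
            rw [← lintegral_iUnion hTm hTd, hTU]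
    · exact (ENNReal.tsum_comp_le_tsum_of_injective Subtype.val_injective
        (fun m => (e m : ℝ≥0∞))).trans hesum.le

/-! ### Cut-off functions -/

/-- All the functions are translates and dilates of one fixed bump, hence the constant `M` serves
every centre and radius. -/
theorem exists_scaled_bump : ∃ M : ℝ, 0 < M ∧ ∀ (x : E3) (r : ℝ), 0 < r →
    ∃ θ : E3 → ℝ, ContDiff ℝ ∞ θ ∧ (∀ y, 0 ≤ θ y ∧ θ y ≤ 1) ∧ (∀ y ∈ Metric.ball x r, θ y = 1) ∧
      (∀ y ∉ Metric.closedBall x (2 * r), θ y = 0) ∧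
      ∀ y, ‖fderiv ℝ θ y‖ ≤ (Metric.closedBall x (2 * r)).indicator (fun _ => M / r) y := by
  let f : ContDiffBump (0 : E3) := ⟨1, 2, one_pos, by norm_num⟩
  have hf : ContDiff ℝ ∞ f := f.contDiff
  obtain ⟨M, hM⟩ := (f.hasCompactSupport.fderiv ℝ).exists_bound_of_continuous
    (hf.continuous_fderiv (by simp))
  have hM0 : 0 ≤ M := (norm_nonneg _).trans (hM 0)
  refine ⟨M + 1, by linarith, fun x r hr => ?_⟩
  refine ⟨fun y => f (r⁻¹ • (y - x)), ?_, ?_, ?_, ?_, ?_⟩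
  · exact hf.comp ((contDiff_id.sub contDiff_const).const_smul _)
  · exact fun y => ⟨f.nonneg, f.le_one⟩
  · intro y hy
    refine f.one_of_mem_closedBall ?_
    rw [Metric.mem_ball, dist_eq_norm] at hy
    rw [mem_closedBall_zero_iff, norm_smul, norm_inv, Real.norm_of_nonneg hr.le,
      inv_mul_le_iff₀ hr]
    change _ ≤ r * 1
    linarith
  · intro y hy
    refine f.zero_of_le_dist ?_
    rw [Metric.mem_closedBall, not_le, dist_eq_norm] at hy
    rw [dist_zero_right, norm_smul, norm_inv, Real.norm_of_nonneg hr.le, le_inv_mul_iff₀ hr]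
    change r * 2 ≤ _
    linarith
  · intro y
    by_cases hy : y ∈ Metric.closedBall x (2 * r)
    · rw [indicator_of_mem hy]
      have h1 : HasFDerivAt (fun y => r⁻¹ • (y - x)) (r⁻¹ • ContinuousLinearMap.id ℝ E3) y :=
        ((hasFDerivAt_id y).sub_const x).const_smul r⁻¹
      have h2 : HasFDerivAt f (fderiv ℝ f (r⁻¹ • (y - x))) (r⁻¹ • (y - x)) :=
        (hf.differentiable (by simp) _).hasFDerivAt
      have h3 : HasFDerivAt (fun y => f (r⁻¹ • (y - x)))
          ((fderiv ℝ f (r⁻¹ • (y - x))).comp (r⁻¹ • ContinuousLinearMap.id ℝ E3)) y :=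
        HasFDerivAt.comp (g := f) y h2 h1
      rw [h3.fderiv, ContinuousLinearMap.comp_smul, ContinuousLinearMap.comp_id, norm_smul,
        norm_inv, Real.norm_of_nonneg hr.le, div_eq_inv_mul]
      gcongr
      exact (hM _).trans (by linarith)
    · rw [indicator_of_notMem hy]
      have : (fun y => f (r⁻¹ • (y - x))) =ᶠ[𝓝 y] fun _ => (0 : ℝ) := by
        filter_upwards [Metric.isClosed_closedBall.isOpen_compl.mem_nhds hy] with z hz
        refine f.zero_of_le_dist ?_
        rw [mem_compl_iff, Metric.mem_closedBall, not_le, dist_eq_norm] at hz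
        rw [dist_zero_right, norm_smul, norm_inv, Real.norm_of_nonneg hr.le, le_inv_mul_iff₀ hr]
        change r * 2 ≤ _
        linarith
      rw [this.fderiv_eq]
      simp

/-- The cut-off is the product of the factors `1 - θ_i`. Each factor lies in `[0, 1]`, so the
Leibniz rule bounds the gradient by the plain sum of the individual gradients, with no dependence on
the number of balls. -/
theorem exists_ball_cutoff : ∃ M : ℝ, 0 < M ∧ ∀ {ι : Type} (s : Finset ι) (x : ι → E3)
    (r : ι → ℝ), (∀ i, 0 < r i) →
    ∃ χ : E3 → ℝ, ContDiff ℝ ∞ χ ∧ (∀ y, 0 ≤ χ y ∧ χ y ≤ 1) ∧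
      (∀ i ∈ s, ∀ y ∈ Metric.ball (x i) (r i), χ y = 0) ∧
      (∀ y, (∀ i ∈ s, y ∉ Metric.closedBall (x i) (2 * r i)) → χ y = 1) ∧
      ∀ y, ‖fderiv ℝ χ y‖
        ≤ ∑ i ∈ s, (Metric.closedBall (x i) (2 * r i)).indicator (fun _ => M / r i) y := by
  classical
  obtain ⟨M, hM, hb⟩ := exists_scaled_bump
  refine ⟨M, hM, fun {ι} s x r hr => ?_⟩
  induction s using Finset.induction_on with
  | empty => exact ⟨fun _ => 1, contDiff_const, by simp, by simp, by simp, by simp⟩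
  | insert a s ha ih =>
    obtain ⟨χ, h1, h2, h3, h4, h5⟩ := ih
    obtain ⟨θ, t1, t2, t3, t4, t5⟩ := hb (x a) (r a) (hr a)
    have hθ : ContDiff ℝ ∞ (fun y => 1 - θ y) := contDiff_const.sub t1
    refine ⟨fun y => χ y * (1 - θ y), h1.mul hθ, ?_, ?_, ?_, ?_⟩
    · intro y
      have := h2 y; have := t2 y
      constructor
      · exact mul_nonneg (by linarith) (by linarith)
      · nlinarith
    · intro i hi y hy
      rcases Finset.mem_insert.1 hi with rfl | hi
      · simp [t3 y hy]
      · simp [h3 i hi y hy]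
    · intro y hy
      simp only
      rw [t4 y (hy a (Finset.mem_insert_self _ _)),
        h4 y (fun i hi => hy i (Finset.mem_insert_of_mem hi))]
      norm_num
    · intro y
      rw [Finset.sum_insert ha]
      have d1 : HasFDerivAt χ (fderiv ℝ χ y) y := (h1.differentiable (by simp) y).hasFDerivAt
      have d2 : HasFDerivAt (fun y => 1 - θ y) (-fderiv ℝ θ y) y := by
        simpa using ((t1.differentiable (by simp) y).hasFDerivAt).const_sub 1
      have d3 : HasFDerivAt (fun y => χ y * (1 - θ y)) _ y := d1.mul d2
      rw [d3.fderiv]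
      refine (norm_add_le _ _).trans (add_le_add ?_ ?_)
      · rw [norm_smul, norm_neg, Real.norm_of_nonneg (h2 y).1]
        calc χ y * ‖fderiv ℝ θ y‖ ≤ 1 * ‖fderiv ℝ θ y‖ := by gcongr; exact (h2 y).2
          _ ≤ _ := by rw [one_mul]; exact t5 y
      · have := t2 y
        rw [norm_smul, Real.norm_of_nonneg (by linarith : (0 : ℝ) ≤ 1 - θ y)]
        calc (1 - θ y) * ‖fderiv ℝ χ y‖ ≤ 1 * ‖fderiv ℝ χ y‖ := by gcongr; linarith
          _ ≤ _ := by rw [one_mul]; exact h5 y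

/-- A smooth cut-off which vanishes near the compact set `K` and whose gradient is controlled,
in a weighted `L¹` sense, by the two-dimensional Hausdorff measure of `K`. -/
theorem exists_hausdorff_cutoff : ∃ C : ℝ, 0 < C ∧ ∀ (Z K : Set E3), IsCompact Z → IsCompact K →
    K ⊆ Z → ∀ h : E3 → ℝ, ContinuousOn h Z → (∀ x ∈ Z, 0 ≤ h x) → ∀ c : ℝ, 0 < c →
    (∀ x ∈ K, c ≤ h x) →
    ∫⁻ x in K, ENNReal.ofReal (h x) ∂(Measure.hausdorffMeasure 2) ≠ ⊤ → ∀ δ : ℝ, 0 < δ →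
    ∃ χ : E3 → ℝ, ContDiff ℝ ∞ χ ∧ (∀ y, 0 ≤ χ y ∧ χ y ≤ 1) ∧
      (∃ U, IsOpen U ∧ K ⊆ U ∧ ∀ y ∈ U, χ y = 0) ∧
      (∀ y, (∀ z ∈ K, δ ≤ dist y z) → χ y = 1) ∧
      ∫⁻ x in Z, ENNReal.ofReal (h x * ‖fderiv ℝ χ x‖)
        ≤ ENNReal.ofReal C * (∫⁻ x in K, ENNReal.ofReal (h x) ∂(Measure.hausdorffMeasure 2)
            + ENNReal.ofReal δ) := by
  obtain ⟨M, hM, hcut⟩ := exists_ball_cutoff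
  set v := (volume (Metric.ball (0 : E3) 1)).toReal with hv
  have hv' : volume (Metric.ball (0 : E3) 1) = ENNReal.ofReal v :=
    (ENNReal.ofReal_toReal measure_ball_lt_top.ne).symm
  have hv0 : 0 < v := ENNReal.toReal_pos (Metric.measure_ball_pos _ _ one_pos).ne'
    measure_ball_lt_top.ne
  -- On a doubled ball: oscillation factor `2`, gradient `M / r`, volume `8 r³ v`, together `16 M v
  -- r²`; the weighted cover contributes the remaining `4`.
  refine ⟨64 * (M * v), by positivity, ?_⟩
  intro Z K hZ hK hKZ h hh h0 c hc hch hI δ hδ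
  classical
  have hmeas : Measurable (K.indicator h) := by
    have := (hh.mono hKZ).measurable_piecewise (g := 0) continuousOn_const
      hK.measurableSet
    rwa [piecewise_eq_indicator] at this
  have hI' : ∫⁻ x in K, ENNReal.ofReal (K.indicator h x) ∂(Measure.hausdorffMeasure 2)
      = ∫⁻ x in K, ENNReal.ofReal (h x) ∂(Measure.hausdorffMeasure 2) :=
    setLIntegral_congr_fun hK.measurableSet fun x hx => by simp only [indicator_of_mem hx]
  -- Since `h ≥ c` at the centres, an oscillation below `c` yields `h y ≤ 2 * h (x i)` on the
  -- doubled balls.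
  obtain ⟨δ', hδ', hunif⟩ := Metric.uniformContinuousOn_iff.1
    (hZ.uniformContinuousOn_of_continuous hh) c hc
  obtain ⟨ι, x, r, hxK, hr0, hrδ, hKc, hsum⟩ := exists_weighted_ball_cover hK.measurableSet hmeas hc
    (fun y hy => by rw [indicator_of_mem hy]; exact hch y hy) (by rwa [hI'])
    (δ := min δ δ' / 2) (by positivity) (ε := ENNReal.ofReal δ) (by simpa using hδ)
  rw [hI'] at hsum
  have hx' : ∀ n, K.indicator h (x n) = h (x n) := fun n => indicator_of_mem (hxK n) _
  simp_rw [hx'] at hsum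
  obtain ⟨s, hs⟩ := hK.elim_finite_subcover _ (fun _ => Metric.isOpen_ball) hKc
  obtain ⟨χ, c1, c2, c3, c4, c5⟩ := hcut s x r hr0
  refine ⟨χ, c1, c2, ⟨⋃ i ∈ s, Metric.ball (x i) (r i),
    isOpen_biUnion fun _ _ => Metric.isOpen_ball, hs, ?_⟩, ?_, ?_⟩
  · intro y hy
    obtain ⟨i, hi, hy⟩ := mem_iUnion₂.1 hy
    exact c3 i hi y hy
  · intro y hy
    refine c4 y fun i hi hyi => ?_
    have h1 := hy _ (hxK i)
    have h2 := hrδ i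
    have h3 := min_le_left δ δ'
    rw [Metric.mem_closedBall] at hyi
    linarith
  · have hpt : ∀ y ∈ Z, ENNReal.ofReal (h y * ‖fderiv ℝ χ y‖) ≤
        ∑ i ∈ s, (Metric.closedBall (x i) (2 * r i)).indicator
          (fun _ => ENNReal.ofReal (2 * h (x i) * (M / r i))) y := by
      intro y hy
      have h1 : h y * ‖fderiv ℝ χ y‖ ≤ ∑ i ∈ s, (Metric.closedBall (x i) (2 * r i)).indicator
          (fun _ => 2 * h (x i) * (M / r i)) y := by
        refine (mul_le_mul_of_nonneg_left (c5 y) (h0 y hy)).trans ?_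
        rw [Finset.mul_sum]
        refine Finset.sum_le_sum fun i _ => ?_
        by_cases hyi : y ∈ Metric.closedBall (x i) (2 * r i)
        · rw [indicator_of_mem hyi, indicator_of_mem hyi]
          have h2 : dist y (x i) < δ' := by
            have := hrδ i
            have := min_le_right δ δ'
            rw [Metric.mem_closedBall] at hyi
            linarith
          have h3 := hunif y hy (x i) (hKZ (hxK i)) h2
          rw [Real.dist_eq] at h3
          have h4 := hch _ (hxK i)
          have : h y ≤ 2 * h (x i) := by linarith [le_abs_self (h y - h (x i))]
          have hri := hr0 i
          gcongr
        · rw [indicator_of_notMem hyi, indicator_of_notMem hyi, mul_zero]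
      refine (ENNReal.ofReal_le_ofReal h1).trans ?_
      rw [ENNReal.ofReal_sum_of_nonneg]
      · refine Finset.sum_le_sum fun i _ => ?_
        by_cases hyi : y ∈ Metric.closedBall (x i) (2 * r i)
        · rw [indicator_of_mem hyi, indicator_of_mem hyi]
        · rw [indicator_of_notMem hyi, indicator_of_notMem hyi]; simp
      · intro i _
        refine indicator_nonneg (fun z _ => ?_) y
        have := h0 _ (hKZ (hxK i))
        have := hr0 i
        positivity
    calc ∫⁻ x in Z, ENNReal.ofReal (h x * ‖fderiv ℝ χ x‖)
        ≤ ∫⁻ y in Z, ∑ i ∈ s, (Metric.closedBall (x i) (2 * r i)).indicator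
          (fun _ => ENNReal.ofReal (2 * h (x i) * (M / r i))) y :=
          setLIntegral_mono' hZ.measurableSet hpt
      _ ≤ ∫⁻ y, ∑ i ∈ s, (Metric.closedBall (x i) (2 * r i)).indicator
          (fun _ => ENNReal.ofReal (2 * h (x i) * (M / r i))) y := setLIntegral_le_lintegral _ _
      _ = ∑ i ∈ s, ENNReal.ofReal (2 * h (x i) * (M / r i)) *
            volume (Metric.closedBall (x i) (2 * r i)) := by
          rw [lintegral_finsetSum]
          · refine Finset.sum_congr rfl fun i _ => ?_
            rw [lintegral_indicator_const Metric.isClosed_closedBall.measurableSet]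
          · intro i _
            exact measurable_const.indicator Metric.isClosed_closedBall.measurableSet
      _ = ∑ i ∈ s, ENNReal.ofReal (16 * (M * v)) * ENNReal.ofReal (h (x i) * r i ^ 2) := by
          refine Finset.sum_congr rfl fun i _ => ?_
          have hri := hr0 i
          have hhi := h0 _ (hKZ (hxK i))
          rw [Measure.addHaar_closedBall _ _ (by positivity), hv', ← ENNReal.ofReal_mul
            (by positivity), ← ENNReal.ofReal_mul (by positivity), ← ENNReal.ofReal_mul
            (by positivity)]
          congr 1
          simp only [finrank_euclideanSpace, Fintype.card_fin]
          field_simp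
          ring
      _ ≤ ENNReal.ofReal (16 * (M * v)) * ∑' n, ENNReal.ofReal (h (x n) * r n ^ 2) := by
          rw [← Finset.mul_sum]
          gcongr
          exact ENNReal.sum_le_tsum s
      _ ≤ ENNReal.ofReal (16 * (M * v)) *
          (4 * (∫⁻ x in K, ENNReal.ofReal (h x) ∂(Measure.hausdorffMeasure 2)
            + ENNReal.ofReal δ)) := by
          gcongr
          refine hsum.trans ?_
          rw [mul_add]
          gcongr
          calc ENNReal.ofReal δ = 1 * ENNReal.ofReal δ := (one_mul _).symm
            _ ≤ 4 * ENNReal.ofReal δ := by gcongr; norm_num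
      _ = _ := by
          rw [← mul_assoc]
          congr 1
          rw [show (4 : ℝ≥0∞) = ENNReal.ofReal 4 by simp, ← ENNReal.ofReal_mul (by positivity)]
          congr 1
          ring


/-! ### Truncated squares -/

theorem hasDerivAt_sq_posPart (u : ℝ) :
    HasDerivAt (fun u : ℝ => max u 0 ^ 2) (2 * max u 0) u := by
  rcases lt_trichotomy u 0 with h | h | h
  · have : (fun u : ℝ => max u 0 ^ 2) =ᶠ[𝓝 u] fun _ => 0 := by
      filter_upwards [gt_mem_nhds h] with y hy
      simp [max_eq_right (le_of_lt hy)]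
    rw [max_eq_right h.le, mul_zero]
    exact (hasDerivAt_const u (0 : ℝ)).congr_of_eventuallyEq this
  · subst h
    have : (fun u : ℝ => max u 0 ^ 2) =O[𝓝 0] fun u : ℝ => ‖u - 0‖ ^ 2 := by
      refine Asymptotics.IsBigO.of_bound 1 (Eventually.of_forall fun y => ?_)
      rw [one_mul, sub_zero, norm_pow, norm_pow, norm_norm]
      gcongr
      rcases le_total y 0 with hy | hy <;> simp [hy]
    simpa using (this.hasFDerivAt one_lt_two).hasDerivAt
  · have : (fun u : ℝ => max u 0 ^ 2) =ᶠ[𝓝 u] fun u => u ^ 2 := by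
      filter_upwards [lt_mem_nhds h] with y hy
      rw [max_eq_left (le_of_lt hy)]
    rw [max_eq_left h.le]
    have h2 := (hasDerivAt_pow 2 u).congr_of_eventuallyEq this
    simpa using h2

/-- The square of the soft-thresholded value, `((|y| - ε)⁺)²`. -/
def truncSq (ε y : ℝ) : ℝ := max (y - ε) 0 ^ 2 + max (-y - ε) 0 ^ 2

/-- The derivative of `truncSq ε`. -/
def truncSqDeriv (ε y : ℝ) : ℝ := 2 * max (y - ε) 0 - 2 * max (-y - ε) 0

theorem hasDerivAt_truncSq (ε y : ℝ) : HasDerivAt (truncSq ε) (truncSqDeriv ε y) y := by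
  have h1 : HasDerivAt (fun y : ℝ => max (y - ε) 0 ^ 2) (2 * max (y - ε) 0 * 1) y :=
    HasDerivAt.comp (h₂ := fun u : ℝ => max u 0 ^ 2) y (hasDerivAt_sq_posPart (y - ε)) ((hasDerivAt_id y).sub_const ε)
  have h2 : HasDerivAt (fun y : ℝ => max (-y - ε) 0 ^ 2) (2 * max (-y - ε) 0 * -1) y :=
    HasDerivAt.comp (h₂ := fun u : ℝ => max u 0 ^ 2) y (hasDerivAt_sq_posPart (-y - ε)) ((hasDerivAt_neg y).sub_const ε)
  exact (h1.add h2).congr_deriv (by rw [truncSqDeriv]; ring)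

theorem contDiff_truncSq (ε : ℝ) : ContDiff ℝ 1 (truncSq ε) := by
  rw [contDiff_one_iff_deriv]
  refine ⟨fun y => (hasDerivAt_truncSq ε y).differentiableAt, ?_⟩
  rw [funext fun y => (hasDerivAt_truncSq ε y).deriv]
  unfold truncSqDeriv
  fun_prop

theorem truncSq_nonneg (ε y : ℝ) : 0 ≤ truncSq ε y := by unfold truncSq; positivity

theorem truncSq_le {ε : ℝ} (hε : 0 ≤ ε) (y : ℝ) : truncSq ε y ≤ y ^ 2 := by
  unfold truncSq
  rcases max_cases (y - ε) 0 with h | h <;> rcases max_cases (-y - ε) 0 with h' | h' <;>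
    rw [h.1, h'.1] <;> nlinarith

/-- The identity `T'² = 4 T`, valid for `T = y²`, survives truncation because the two positive parts
are never nonzero together. It lets the cross term `T' (X · ∇F)` be absorbed as if no truncation had
been made. -/
theorem truncSqDeriv_sq {ε : ℝ} (hε : 0 ≤ ε) (y : ℝ) :
    truncSqDeriv ε y ^ 2 = 4 * truncSq ε y := by
  have : max (y - ε) 0 * max (-y - ε) 0 = 0 := by
    rcases le_total y 0 with h | h
    · rw [max_eq_right (by linarith : y - ε ≤ 0), zero_mul]
    · rw [max_eq_right (by linarith : -y - ε ≤ 0), mul_zero]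
  unfold truncSq truncSqDeriv
  linear_combination (-8) * this

theorem truncSq_eq_zero {ε y : ℝ} (h : |y| ≤ ε) : truncSq ε y = 0 := by
  have := abs_le.1 h
  unfold truncSq
  rw [max_eq_right (by linarith), max_eq_right (by linarith)]
  norm_num

theorem tendsto_truncSq (y : ℝ) : Tendsto (fun ε => truncSq ε y) (𝓝 0) (𝓝 (y ^ 2)) := by
  have : Continuous fun ε => truncSq ε y := by unfold truncSq; fun_prop
  have h0 : truncSq 0 y = y ^ 2 := by
    unfold truncSq
    rcases le_total y 0 with h | h <;> simp [h]
  simpa [h0] using this.tendsto 0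

/-! ### A first-order weighted estimate for smooth functions -/

/-- `D` is the weak divergence of the field `X` in `O`, tested with `C¹` functions. -/
def IsWeakDiv (O : Set E3) (X : Fin 3 → E3 → ℝ) (D : E3 → ℝ) : Prop :=
  ∀ η : E3 → ℝ, ContDiff ℝ 1 η → HasCompactSupport η → tsupport η ⊆ O →
    ∫ x in O, ((∑ j, X j x * fderiv ℝ η x (basisVec j)) + D x * η x) = 0

/-- Here `z` will be the integrand of the weak divergence identity, whose integral vanishes. No
finiteness of `∫ v` is needed, as the claim is trivial when that integral is infinite. -/
theorem lintegral_le_of_le_add {α : Type*} [MeasurableSpace α] {μ : Measure α} {u v z : α → ℝ}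
    (hu : ∀ᵐ x ∂μ, 0 ≤ u x) (hv0 : ∀ᵐ x ∂μ, 0 ≤ v x) (hv : AEStronglyMeasurable v μ)
    (hz : Integrable z μ) (hz0 : ∫ x, z x ∂μ = 0) (h : ∀ᵐ x ∂μ, u x ≤ v x + z x) :
    ∫⁻ x, ENNReal.ofReal (u x) ∂μ ≤ ∫⁻ x, ENNReal.ofReal (v x) ∂μ := by
  by_cases hfin : ∫⁻ x, ENNReal.ofReal (v x) ∂μ = ⊤
  · rw [hfin]; exact le_top
  have hvi : Integrable v μ :=
    (lintegral_ofReal_ne_top_iff_integrable hv hv0).1 hfin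
  calc ∫⁻ x, ENNReal.ofReal (u x) ∂μ ≤ ∫⁻ x, ENNReal.ofReal (v x + z x) ∂μ :=
        lintegral_mono_ae (h.mono fun x hx => ENNReal.ofReal_le_ofReal hx)
    _ = ENNReal.ofReal (∫ x, (v x + z x) ∂μ) := by
        refine (ofReal_integral_eq_lintegral_ofReal (f := fun x => v x + z x) (hvi.add hz) ?_).symm
        filter_upwards [hu, h] with x h1 h2 using h1.trans h2
    _ = ENNReal.ofReal (∫ x, v x ∂μ) := by rw [integral_add hvi hz, hz0, add_zero]
    _ = ∫⁻ x, ENNReal.ofReal (v x) ∂μ := ofReal_integral_eq_lintegral_ofReal hvi hv0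

theorem norm_basisVec (j : Fin 3) : ‖basisVec j‖ = 1 := by simp [basisVec]

theorem abs_fderiv_basisVec_le (f : E3 → ℝ) (x : E3) (j : Fin 3) :
    |fderiv ℝ f x (basisVec j)| ≤ ‖fderiv ℝ f x‖ := by
  have := (fderiv ℝ f x).le_opNorm (basisVec j)
  rwa [norm_basisVec, mul_one] at this

/-- The hypotheses on a first-order operator `X · ∇` and a weight `W` on `O` under which the
weighted estimate holds: `X` and its weak divergence `D` are bounded by `M`, and
`X · ∇W ≥ c σ W`. -/
structure IsTransportWeight (O : Set E3) (X : Fin 3 → E3 → ℝ) (D W σ : E3 → ℝ) (M c : ℝ) :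
    Prop where
  isOpen : IsOpen O
  isBounded : Bornology.IsBounded O
  measX : ∀ j, AEStronglyMeasurable (X j) (volume.restrict O)
  measD : AEStronglyMeasurable D (volume.restrict O)
  boundX : ∀ j, ∀ᵐ x ∂volume.restrict O, |X j x| ≤ M
  boundD : ∀ᵐ x ∂volume.restrict O, |D x| ≤ M
  weakDiv : IsWeakDiv O X D
  contW : ContinuousOn W (closure O)
  posW : ∀ x ∈ closure O, 0 < W x
  diffW : ContDiffOn ℝ 1 W O
  contσ : ContinuousOn σ (closure O)
  posσ : ∀ x ∈ closure O, 0 < σ x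
  largeσ : ∀ x ∈ closure O, 4 * M ≤ c * σ x
  posc : 0 < c
  nonnegM : 0 ≤ M
  grad : ∀ x ∈ O, c * σ x * W x ≤ ∑ j, X j x * fderiv ℝ W x (basisVec j)

section Transport

variable {O : Set E3} {X : Fin 3 → E3 → ℝ} {D W σ : E3 → ℝ} {M c : ℝ}

/-- The product `χ · truncSq ε (F) · W`, extended by zero, is an admissible test function whatever
the boundary looks like. Near a frontier point with `|F| < ε` the truncation vanishes, and near any
other frontier point `χ` does. -/
theorem exists_testFunction (h : IsTransportWeight O X D W σ M c) {F χ : E3 → ℝ}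
    (hF : ContDiff ℝ ∞ F) (hχ : ContDiff ℝ ∞ χ) {ε : ℝ} {U : Set E3}
    (hU : IsOpen U) (hKU : {x | x ∈ frontier O ∧ ε ≤ |F x|} ⊆ U) (hχU : ∀ y ∈ U, χ y = 0) :
    ∃ η : E3 → ℝ, ContDiff ℝ 1 η ∧ HasCompactSupport η ∧ tsupport η ⊆ O ∧
      ∀ x ∈ O, η x = χ x * truncSq ε (F x) * W x ∧
        fderiv ℝ η x = (χ x * truncSq ε (F x)) • fderiv ℝ W x + W x •
          (χ x • (truncSqDeriv ε (F x) • fderiv ℝ F x) + truncSq ε (F x) • fderiv ℝ χ x) := by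
  set η₀ : E3 → ℝ := fun x => χ x * truncSq ε (F x) * W x with hη₀
  set η : E3 → ℝ := O.indicator η₀ with hη
  have hzero : ∀ x ∉ O, η =ᶠ[𝓝 x] 0 := by
    intro x hx
    by_cases hxc : x ∈ closure O
    · have hxf : x ∈ frontier O := by rw [h.isOpen.frontier_eq]; exact ⟨hxc, hx⟩
      by_cases hFx : ε ≤ |F x|
      · filter_upwards [hU.mem_nhds (hKU ⟨hxf, hFx⟩)] with y hy
        simp [hη, hη₀, indicator, hχU y hy]
      · push Not at hFx
        filter_upwards [(hF.continuous.abs.continuousAt (x := x)).eventually (gt_mem_nhds hFx)]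
          with y hy
        simp [hη, hη₀, indicator, truncSq_eq_zero (le_of_lt hy)]
    · filter_upwards [isClosed_closure.isOpen_compl.mem_nhds hxc] with y hy
      exact indicator_of_notMem (fun hy' => hy (subset_closure hy')) _
  have heq : ∀ x ∈ O, η =ᶠ[𝓝 x] η₀ := by
    intro x hx
    filter_upwards [h.isOpen.mem_nhds hx] with y hy
    exact indicator_of_mem hy _
  have hts : tsupport η ⊆ O := by
    intro x hx
    by_contra hxO
    exact (notMem_tsupport_iff_eventuallyEq.2 (hzero x hxO)) hx
  have hT : ContDiff ℝ 1 (fun x => χ x * truncSq ε (F x)) :=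
    (hχ.of_le (by simp)).mul ((contDiff_truncSq ε).comp (hF.of_le (by simp)))
  refine ⟨η, ?_, ?_, hts, ?_⟩
  · rw [contDiff_iff_contDiffAt]
    intro x
    by_cases hx : x ∈ O
    · exact (hT.contDiffAt.mul (h.diffW.contDiffAt (h.isOpen.mem_nhds hx))).congr_of_eventuallyEq
        (heq x hx)
    · exact contDiffAt_const.congr_of_eventuallyEq (hzero x hx)
  · exact HasCompactSupport.of_support_subset_isCompact h.isBounded.isCompact_closure
      ((subset_tsupport _).trans (hts.trans subset_closure))
  · intro x hx
    refine ⟨indicator_of_mem hx _, ?_⟩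
    rw [(heq x hx).fderiv_eq]
    have d1 : HasFDerivAt χ (fderiv ℝ χ x) x := (hχ.differentiable (by simp) x).hasFDerivAt
    have d2 : HasFDerivAt (fun x => truncSq ε (F x)) (truncSqDeriv ε (F x) • fderiv ℝ F x) x :=
      (hasDerivAt_truncSq ε (F x)).comp_hasFDerivAt x
        (hF.differentiable (by simp) x).hasFDerivAt
    have d3 : HasFDerivAt W (fderiv ℝ W x) x :=
      ((h.diffW.contDiffAt (h.isOpen.mem_nhds hx)).differentiableAt one_ne_zero).hasFDerivAt
    exact ((d1.mul d2).mul d3).fderiv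

theorem IsWeakDiv.integrable (h : IsTransportWeight O X D W σ M c) {η : E3 → ℝ}
    (hη : ContDiff ℝ 1 η) (hc : HasCompactSupport η) :
    Integrable (fun x => (∑ j, X j x * fderiv ℝ η x (basisVec j)) + D x * η x)
      (volume.restrict O) := by
  refine Integrable.add (integrable_finsetSum _ fun j _ => ?_) ?_
  · refine Integrable.bdd_mul (c := M) ?_ (h.measX j) (h.boundX j)
    refine (Continuous.integrable_of_hasCompactSupport ?_ ?_).restrict
    · exact (hη.continuous_fderiv one_ne_zero).clm_apply continuous_const
    · exact (hc.fderiv ℝ).comp_left (g := fun L : E3 →L[ℝ] ℝ => L (basisVec j)) (by simp)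
  · exact Integrable.bdd_mul (c := M)
      (hη.continuous.integrable_of_hasCompactSupport hc).restrict h.measD h.boundD

/-- The main term supplies `c σ` in front of `χ T W`. Completing the square in `T' y` uses `c σ / 2`
of it, the divergence uses `M ≤ c σ / 4`, and `c σ / 4` remains. The derivative of the cut-off is
left as the term with `G`. -/
theorem pointwise_transport_bound {χ T T' W σ M c y Y G A D : ℝ} (hχ0 : 0 ≤ χ) (hχ1 : χ ≤ 1)
    (hT0 : 0 ≤ T) (hT' : T' ^ 2 = 4 * T) (hW : 0 < W) (hσ : 0 < σ) (hc : 0 < c)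
    (hσM : 4 * M ≤ c * σ) (hD : |D| ≤ M) (hA : c * σ * W ≤ A) (hY : |Y| ≤ G) :
    c / 4 * (χ * T * W * σ) ≤ 2 / c * (W * σ⁻¹ * y ^ 2) + T * W * G +
      (χ * T * A + W * (χ * (T' * y) + T * Y) + D * (χ * T * W)) := by
  have h1 : -(c / 2 * σ * T + 2 / c * σ⁻¹ * y ^ 2) ≤ T' * y := by
    have : 0 ≤ 2 / (c * σ) * (c * σ * T' / 4 + y) ^ 2 := by positivity
    have e : 2 / (c * σ) * (c * σ * T' / 4 + y) ^ 2
        = c * σ / 8 * T' ^ 2 + T' * y + 2 / c * σ⁻¹ * y ^ 2 := by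
      field_simp; ring
    rw [e, hT'] at this
    linarith
  have h2 : χ * T * (c * σ * W) ≤ χ * T * A := mul_le_mul_of_nonneg_left hA (by positivity)
  have h3 : W * χ * (-(c / 2 * σ * T + 2 / c * σ⁻¹ * y ^ 2)) ≤ W * χ * (T' * y) :=
    mul_le_mul_of_nonneg_left h1 (by positivity)
  have h4 : T * W * (-G) ≤ T * W * Y :=
    mul_le_mul_of_nonneg_left (abs_le.1 hY).1 (by positivity)
  have h5 : (χ * T * W) * (-M) ≤ (χ * T * W) * D :=
    mul_le_mul_of_nonneg_left (abs_le.1 hD).1 (by positivity)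
  have h6 : (χ * T * W) * (4 * M) ≤ (χ * T * W) * (c * σ) :=
    mul_le_mul_of_nonneg_left hσM (by positivity)
  have h7 : χ * (2 / c * (W * σ⁻¹ * y ^ 2)) ≤ 1 * (2 / c * (W * σ⁻¹ * y ^ 2)) :=
    mul_le_mul_of_nonneg_right hχ1 (by positivity)
  nlinarith

/-- The weak divergence identity is tested with the function of `exists_testFunction`. The last
integral replaces the boundary term and is over the closure so that it matches
`exists_hausdorff_cutoff`. -/
theorem transport_estimate_cutoff (h : IsTransportWeight O X D W σ M c) {F χ : E3 → ℝ}
    (hF : ContDiff ℝ ∞ F) (hχ : ContDiff ℝ ∞ χ) (hχ01 : ∀ y, 0 ≤ χ y ∧ χ y ≤ 1)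
    {ε : ℝ} (hε : 0 ≤ ε) {U : Set E3} (hU : IsOpen U)
    (hKU : {x | x ∈ frontier O ∧ ε ≤ |F x|} ⊆ U) (hχU : ∀ y ∈ U, χ y = 0) :
    ENNReal.ofReal (c / 4) *
      ∫⁻ x in O, ENNReal.ofReal (χ x * truncSq ε (F x) * W x * σ x) ≤
    ENNReal.ofReal (2 / c) * (∫⁻ x in O, ENNReal.ofReal
        (W x * (σ x)⁻¹ * (∑ j, X j x * fderiv ℝ F x (basisVec j)) ^ 2)) +
      ENNReal.ofReal (3 * M) *
        ∫⁻ x in closure O, ENNReal.ofReal (F x ^ 2 * W x * ‖fderiv ℝ χ x‖) := by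
  obtain ⟨η, hη1, hηc, hηO, hηx⟩ := exists_testFunction h hF hχ hU hKU hχU
  have hOm := h.isOpen.measurableSet
  have hcO : ∀ {f : E3 → ℝ}, ContinuousOn f (closure O) →
      AEStronglyMeasurable f (volume.restrict O) := fun hf =>
    (hf.mono subset_closure).aestronglyMeasurable hOm
  have hmW := hcO h.contW
  have hmσ := hcO (h.contσ.inv₀ fun x hx => (h.posσ x hx).ne')
  have hmF : AEStronglyMeasurable (fun x => ∑ j, X j x * fderiv ℝ F x (basisVec j))
      (volume.restrict O) :=
    Finset.aestronglyMeasurable_fun_sum _ fun j _ => (h.measX j).mul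
      ((hF.continuous_fderiv (by simp)).clm_apply continuous_const).aestronglyMeasurable
  have hm1 : AEStronglyMeasurable
      (fun x => 2 / c * (W x * (σ x)⁻¹ * (∑ j, X j x * fderiv ℝ F x (basisVec j)) ^ 2))
      (volume.restrict O) := ((hmW.mul hmσ).mul (hmF.pow 2)).const_mul _
  have hm2 : AEStronglyMeasurable
      (fun x => 3 * M * (F x ^ 2 * W x * ‖fderiv ℝ χ x‖)) (volume.restrict O) :=
    (((hF.continuous.pow 2).aestronglyMeasurable.mul hmW).mul
      (hχ.continuous_fderiv (by simp)).norm.aestronglyMeasurable).const_mul _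
  have hcpos := h.posc
  have hM0 := h.nonnegM
  have main := lintegral_le_of_le_add (μ := volume.restrict O)
    (u := fun x => c / 4 * (χ x * truncSq ε (F x) * W x * σ x))
    (v := fun x => 2 / c * (W x * (σ x)⁻¹ * (∑ j, X j x * fderiv ℝ F x (basisVec j)) ^ 2)
      + 3 * M * (F x ^ 2 * W x * ‖fderiv ℝ χ x‖))
    (z := fun x => (∑ j, X j x * fderiv ℝ η x (basisVec j)) + D x * η x)
    ?_ ?_ (hm1.add hm2) (IsWeakDiv.integrable h hη1 hηc) (h.weakDiv η hη1 hηc hηO) ?_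
  · calc _ = ∫⁻ x in O, ENNReal.ofReal (c / 4 * (χ x * truncSq ε (F x) * W x * σ x)) := by
          rw [← lintegral_const_mul' _ _ ENNReal.ofReal_ne_top]
          exact lintegral_congr fun x => (ENNReal.ofReal_mul (by positivity)).symm
      _ ≤ _ := main
      _ ≤ ∫⁻ x in O, (ENNReal.ofReal
            (2 / c * (W x * (σ x)⁻¹ * (∑ j, X j x * fderiv ℝ F x (basisVec j)) ^ 2)) +
            ENNReal.ofReal (3 * M * (F x ^ 2 * W x * ‖fderiv ℝ χ x‖))) :=
          lintegral_mono fun x => ENNReal.ofReal_add_le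
      _ = (∫⁻ x in O, ENNReal.ofReal
            (2 / c * (W x * (σ x)⁻¹ * (∑ j, X j x * fderiv ℝ F x (basisVec j)) ^ 2))) +
            ∫⁻ x in O, ENNReal.ofReal (3 * M * (F x ^ 2 * W x * ‖fderiv ℝ χ x‖)) :=
          lintegral_add_left' hm1.aemeasurable.ennreal_ofReal _
      _ ≤ _ := by
          gcongr
          · rw [← lintegral_const_mul' _ _ ENNReal.ofReal_ne_top]
            exact (lintegral_congr fun x => ENNReal.ofReal_mul (by positivity)).le
          · rw [← lintegral_const_mul' _ _ ENNReal.ofReal_ne_top]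
            refine (lintegral_mono_set subset_closure).trans
              (lintegral_congr fun x => ENNReal.ofReal_mul (by positivity)).le
  · filter_upwards [ae_restrict_mem hOm] with x hx
    have := (hχ01 x).1
    have := truncSq_nonneg ε (F x)
    have := h.posW x (subset_closure hx)
    have := h.posσ x (subset_closure hx)
    positivity
  · filter_upwards [ae_restrict_mem hOm] with x hx
    have := h.posW x (subset_closure hx)
    have := h.posσ x (subset_closure hx)
    positivity
  · filter_upwards [ae_restrict_mem hOm, h.boundD, ae_all_iff.2 h.boundX] with x hx hDx hXx
    have hY : |∑ j, X j x * fderiv ℝ χ x (basisVec j)| ≤ 3 * M * ‖fderiv ℝ χ x‖ := by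
      refine (Finset.abs_sum_le_sum_abs _ _).trans ?_
      calc ∑ j, |X j x * fderiv ℝ χ x (basisVec j)| ≤ ∑ _j : Fin 3, M * ‖fderiv ℝ χ x‖ := by
            refine Finset.sum_le_sum fun j _ => ?_
            rw [abs_mul]
            exact mul_le_mul (hXx j) (abs_fderiv_basisVec_le _ _ _) (abs_nonneg _) hM0
        _ = _ := by simp; ring
    have hWx := h.posW x (subset_closure hx)
    have key := pointwise_transport_bound (y := ∑ j, X j x * fderiv ℝ F x (basisVec j))
      (hχ01 x).1 (hχ01 x).2 (truncSq_nonneg ε (F x))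
      (truncSqDeriv_sq hε (F x)) hWx (h.posσ x (subset_closure hx)) hcpos
      (h.largeσ x (subset_closure hx)) hDx (h.grad x hx) hY
    obtain ⟨e1, e2⟩ := hηx x hx
    have hgrad : ∑ j, X j x * fderiv ℝ η x (basisVec j)
        = χ x * truncSq ε (F x) * (∑ j, X j x * fderiv ℝ W x (basisVec j)) + W x *
          (χ x * (truncSqDeriv ε (F x) * ∑ j, X j x * fderiv ℝ F x (basisVec j))
            + truncSq ε (F x) * ∑ j, X j x * fderiv ℝ χ x (basisVec j)) := by
      rw [e2]
      simp only [add_apply, smul_apply, smul_eq_mul,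
        Fin.sum_univ_three]
      ring
    rw [hgrad, e1]
    refine key.trans (add_le_add (add_le_add le_rfl ?_) le_rfl)
    have h1 := truncSq_le hε (F x)
    calc truncSq ε (F x) * W x * (3 * M * ‖fderiv ℝ χ x‖)
        ≤ F x ^ 2 * W x * (3 * M * ‖fderiv ℝ χ x‖) := by gcongr
      _ = _ := by ring

theorem lintegral_hausdorffMeasure_le (S : Set E3) (f : E3 → ℝ≥0∞) :
    ∫⁻ x in S, f x ∂(Measure.hausdorffMeasure 2) ≤
      ENNReal.ofReal 2 * ∫⁻ x in S, f x ∂surfaceMeasure := by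
  unfold surfaceMeasure
  rw [Measure.restrict_smul, lintegral_smul_measure, smul_eq_mul, ← mul_assoc,
    ← ENNReal.ofReal_mul (by norm_num)]
  have : (1 : ℝ≥0∞) ≤ ENNReal.ofReal (2 * (Real.pi / 4)) := by
    rw [ENNReal.one_le_ofReal]; linarith [Real.pi_gt_three]
  calc _ = 1 * ∫⁻ x in S, f x ∂(Measure.hausdorffMeasure 2) := (one_mul _).symm
    _ ≤ _ := by gcongr

/-- Weighted estimate for `X · ∇F` with `F` smooth, with a boundary term on an arbitrary
topological boundary. -/
theorem transport_estimate_smooth : ∃ C₀ : ℝ, 0 < C₀ ∧ ∀ {O : Set E3} {X : Fin 3 → E3 → ℝ}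
    {D W σ : E3 → ℝ} {M c : ℝ}, IsTransportWeight O X D W σ M c → ∀ F : E3 → ℝ,
    ContDiff ℝ ∞ F →
    ENNReal.ofReal (c / 4) * ∫⁻ x in O, ENNReal.ofReal (W x * σ x * F x ^ 2) ≤
    ENNReal.ofReal (2 / c) * (∫⁻ x in O, ENNReal.ofReal
        (W x * (σ x)⁻¹ * (∑ j, X j x * fderiv ℝ F x (basisVec j)) ^ 2)) +
      ENNReal.ofReal (C₀ * (M + 1)) *
        ∫⁻ x in frontier O, ENNReal.ofReal (W x * F x ^ 2) ∂surfaceMeasure := by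
  obtain ⟨C, hC, hcut⟩ := exists_hausdorff_cutoff
  -- The factor `6` is `3` from the three components of `X · ∇χ` times `2` from comparing the
  -- Hausdorff measure with `surfaceMeasure`.
  refine ⟨6 * C, by positivity, ?_⟩
  intro O X D W σ M c h F hF
  have hM0 := h.nonnegM
  set R := ∫⁻ x in O, ENNReal.ofReal
        (W x * (σ x)⁻¹ * (∑ j, X j x * fderiv ℝ F x (basisVec j)) ^ 2)
  set I := ∫⁻ x in frontier O, ENNReal.ofReal (W x * F x ^ 2) ∂surfaceMeasure with hI
  by_cases hIt : I = ⊤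
  · rw [hIt, ENNReal.mul_top (by simp; positivity)]; simp
  have hZ : IsCompact (closure O) := h.isBounded.isCompact_closure
  have hfr : frontier O ⊆ closure O := frontier_subset_closure
  set g : E3 → ℝ := fun x => F x ^ 2 * W x with hg
  have hgI : ∫⁻ x in frontier O, ENNReal.ofReal (g x) ∂(Measure.hausdorffMeasure 2)
      ≤ ENNReal.ofReal 2 * I := by
    refine (lintegral_hausdorffMeasure_le _ _).trans (le_of_eq ?_)
    rw [hI]
    congr 1
    exact lintegral_congr fun x => by rw [hg, mul_comm]
  have hg0 : ∀ x ∈ closure O, 0 ≤ g x := fun x hx =>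
    mul_nonneg (sq_nonneg _) (h.posW x hx).le
  have hgc : ContinuousOn g (closure O) := (hF.continuous.pow 2).continuousOn.mul h.contW
  set e : ℕ → ℝ := fun n => 1 / ((n : ℝ) + 1) with he
  have he0 : ∀ n, 0 < e n := fun n => by simp only [he]; positivity
  have helim : Tendsto e atTop (𝓝 0) := tendsto_one_div_add_atTop_nhds_zero_nat
  have hχ : ∀ n, ∃ χ : E3 → ℝ, ContDiff ℝ ∞ χ ∧ (∀ y, 0 ≤ χ y ∧ χ y ≤ 1) ∧
      (∃ U, IsOpen U ∧ {x | x ∈ frontier O ∧ e n ≤ |F x|} ⊆ U ∧ ∀ y ∈ U, χ y = 0) ∧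
      (∀ y, (∀ z ∈ {x | x ∈ frontier O ∧ e n ≤ |F x|}, e n ≤ dist y z) → χ y = 1) ∧
      ∫⁻ x in closure O, ENNReal.ofReal (g x * ‖fderiv ℝ χ x‖)
        ≤ ENNReal.ofReal C * (ENNReal.ofReal 2 * I + ENNReal.ofReal (e n)) := by
    intro n
    -- This set is compact and `F² W` is bounded below on it by a positive constant, as the weighted
    -- covering requires; without truncation there would be no such bound.
    set K := {x | x ∈ frontier O ∧ e n ≤ |F x|} with hK
    have hKf : K ⊆ frontier O := fun x hx => hx.1
    have hKc : IsCompact K := by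
      refine hZ.of_isClosed_subset ?_ (hKf.trans hfr)
      exact isClosed_frontier.inter (isClosed_le continuous_const hF.continuous.abs)
    obtain ⟨w, hw, hWw⟩ : ∃ w : ℝ, 0 < w ∧ ∀ x ∈ K, w ≤ W x := by
      rcases K.eq_empty_or_nonempty with hKe | hKne
      · exact ⟨1, one_pos, by simp [hKe]⟩
      · obtain ⟨x0, hx0, hmin⟩ := hKc.exists_isMinOn hKne (h.contW.mono (hKf.trans hfr))
        exact ⟨W x0, h.posW _ (hfr (hKf hx0)), fun x hx => hmin hx⟩
    have hKI : ∫⁻ x in K, ENNReal.ofReal (g x) ∂(Measure.hausdorffMeasure 2)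
        ≤ ENNReal.ofReal 2 * I := (lintegral_mono_set hKf).trans hgI
    obtain ⟨χ, c1, c2, c3, c4, c5⟩ := hcut (closure O) K hZ hKc (hKf.trans hfr) g hgc hg0
      (e n ^ 2 * w) (mul_pos (pow_pos (he0 n) 2) hw) (fun x hx => by
        have h1 : e n ^ 2 ≤ F x ^ 2 := by
          rw [← sq_abs (F x)]; exact pow_le_pow_left₀ (he0 n).le hx.2 2
        exact mul_le_mul h1 (hWw x hx) hw.le (sq_nonneg _))
      (ne_top_of_le_ne_top (ENNReal.mul_ne_top ENNReal.ofReal_ne_top hIt) hKI) (e n) (he0 n)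
    exact ⟨χ, c1, c2, c3, c4, c5.trans (by gcongr)⟩
  choose χ c1 c2 c3 c4 c5 using hχ
  have hstep : ∀ n, ENNReal.ofReal (c / 4) *
      ∫⁻ x in O, ENNReal.ofReal (χ n x * truncSq (e n) (F x) * W x * σ x) ≤
      ENNReal.ofReal (2 / c) * R + ENNReal.ofReal (3 * M) *
        (ENNReal.ofReal C * (ENNReal.ofReal 2 * I + ENNReal.ofReal (e n))) := by
    intro n
    obtain ⟨U, hU, hKU, hχU⟩ := c3 n
    refine (transport_estimate_cutoff h hF (c1 n) (c2 n) (he0 n).le hU hKU hχU).trans ?_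
    gcongr
    exact c5 n
  have hOm := h.isOpen.measurableSet
  -- A point of `O` has positive distance to the frontier, so `χ n` equals `1` there as soon as `e
  -- n` is smaller than that distance.
  have hptw : ∀ x ∈ O, Tendsto
      (fun n => ENNReal.ofReal (χ n x * truncSq (e n) (F x) * W x * σ x)) atTop
      (𝓝 (ENNReal.ofReal (W x * σ x * F x ^ 2))) := by
    intro x hx
    obtain ⟨r, hr, hball⟩ := Metric.isOpen_iff.1 h.isOpen x hx
    have hev : ∀ᶠ n in atTop, χ n x = 1 := by
      filter_upwards [helim.eventually (gt_mem_nhds hr)] with n hn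
      refine c4 n x fun z hz => hn.le.trans ?_
      by_contra! hlt
      have h1 : z ∈ O := hball (by rwa [Metric.mem_ball, dist_comm])
      have h2 := hz.1
      rw [h.isOpen.frontier_eq] at h2
      exact h2.2 h1
    have h3 : Tendsto (fun n => 1 * truncSq (e n) (F x) * W x * σ x) atTop
        (𝓝 (1 * F x ^ 2 * W x * σ x)) :=
      ((((tendsto_truncSq (F x)).comp helim).const_mul 1).mul_const _).mul_const _
    have h4 : 1 * F x ^ 2 * W x * σ x = W x * σ x * F x ^ 2 := by ring
    rw [h4] at h3
    refine (ENNReal.tendsto_ofReal h3).congr' ?_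
    filter_upwards [hev] with n hn
    rw [hn]
  have hmeas : ∀ n, AEMeasurable
      (fun x => ENNReal.ofReal (χ n x * truncSq (e n) (F x) * W x * σ x))
      (volume.restrict O) := by
    intro n
    refine AEMeasurable.ennreal_ofReal (AEStronglyMeasurable.aemeasurable ?_)
    refine ContinuousOn.aestronglyMeasurable ?_ hOm
    have ht : Continuous fun x => χ n x * truncSq (e n) (F x) :=
      (c1 n).continuous.mul ((contDiff_truncSq (e n)).continuous.comp hF.continuous)
    exact (ht.continuousOn.mul (h.contW.mono subset_closure)).mul (h.contσ.mono subset_closure)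
  -- The right-hand side is already bounded uniformly in `n`, so lower semicontinuity on the left is
  -- enough.
  have hfatou : ∫⁻ x in O, ENNReal.ofReal (W x * σ x * F x ^ 2) ≤
      liminf (fun n => ∫⁻ x in O,
        ENNReal.ofReal (χ n x * truncSq (e n) (F x) * W x * σ x)) atTop := by
    refine le_trans (le_of_eq ?_) (lintegral_liminf_le' hmeas)
    exact setLIntegral_congr_fun hOm fun x hx => (hptw x hx).liminf_eq.symm
  have hlimR : Tendsto (fun n => ENNReal.ofReal (2 / c) * R + ENNReal.ofReal (3 * M) *
        (ENNReal.ofReal C * (ENNReal.ofReal 2 * I + ENNReal.ofReal (e n)))) atTop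
      (𝓝 (ENNReal.ofReal (2 / c) * R + ENNReal.ofReal (3 * M) *
        (ENNReal.ofReal C * (ENNReal.ofReal 2 * I + ENNReal.ofReal 0)))) := by
    refine tendsto_const_nhds.add (ENNReal.Tendsto.const_mul (ENNReal.Tendsto.const_mul
      (tendsto_const_nhds.add (ENNReal.tendsto_ofReal helim)) (Or.inr ENNReal.ofReal_ne_top))
      (Or.inr ENNReal.ofReal_ne_top))
  calc ENNReal.ofReal (c / 4) * ∫⁻ x in O, ENNReal.ofReal (W x * σ x * F x ^ 2)
      ≤ ENNReal.ofReal (c / 4) * liminf (fun n => ∫⁻ x in O,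
        ENNReal.ofReal (χ n x * truncSq (e n) (F x) * W x * σ x)) atTop := by gcongr
    _ = liminf (fun n => ENNReal.ofReal (c / 4) * ∫⁻ x in O,
        ENNReal.ofReal (χ n x * truncSq (e n) (F x) * W x * σ x)) atTop :=
        (ENNReal.liminf_const_mul_of_ne_top ENNReal.ofReal_ne_top).symm
    _ ≤ liminf (fun n => ENNReal.ofReal (2 / c) * R + ENNReal.ofReal (3 * M) *
        (ENNReal.ofReal C * (ENNReal.ofReal 2 * I + ENNReal.ofReal (e n)))) atTop :=
        liminf_le_liminf (Eventually.of_forall hstep)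
    _ = ENNReal.ofReal (2 / c) * R + ENNReal.ofReal (3 * M) *
        (ENNReal.ofReal C * (ENNReal.ofReal 2 * I + ENNReal.ofReal 0)) := hlimR.liminf_eq
    _ ≤ _ := by
        have : ENNReal.ofReal (3 * M) * (ENNReal.ofReal C * (ENNReal.ofReal 2 * I))
            = ENNReal.ofReal (3 * M * (C * 2)) * I := by
          rw [ENNReal.ofReal_mul (p := 3 * M) (by positivity), ENNReal.ofReal_mul hC.le]
          ring
        rw [ENNReal.ofReal_zero, add_zero, this]
        have h2 : 3 * M * (C * 2) ≤ 6 * C * (M + 1) := by nlinarith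
        gcongr

end Transport


/-! ### Passage to functions with traces -/

theorem lintegral_ofReal_sq {α : Type*} [MeasurableSpace α] (μ : Measure α) (u : α → ℝ) :
    ∫⁻ x, ENNReal.ofReal (u x ^ 2) ∂μ = eLpNorm u 2 μ ^ 2 := by
  have h := eLpNorm_nnreal_pow_eq_lintegral (μ := μ) (f := u) (p := 2) (by norm_num)
  have h2 : ((2 : NNReal) : ℝ≥0∞) = 2 := rfl
  have h3 : (((2 : NNReal) : ℝ)) = ((2 : ℕ) : ℝ) := by norm_num
  rw [h2, h3, ENNReal.rpow_natCast] at h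
  rw [h]
  refine lintegral_congr fun x => ?_
  rw [ENNReal.rpow_natCast, ← ofReal_norm, ← ENNReal.ofReal_pow (norm_nonneg _), Real.norm_eq_abs,
    sq_abs]

theorem lintegral_weight_sq_le {α : Type*} [MeasurableSpace α] {μ : Measure α} {a u v : α → ℝ}
    {B : ℝ} (ha0 : ∀ᵐ x ∂μ, 0 ≤ a x) (haB : ∀ᵐ x ∂μ, a x ≤ B)
    (hm : AEMeasurable (fun x => a x * v x ^ 2) μ) :
    ∫⁻ x, ENNReal.ofReal (a x * u x ^ 2) ∂μ ≤
      2 * (∫⁻ x, ENNReal.ofReal (a x * v x ^ 2) ∂μ) +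
        ENNReal.ofReal (2 * B) * eLpNorm (fun x => u x - v x) 2 μ ^ 2 := by
  rw [← lintegral_ofReal_sq, ← lintegral_const_mul' _ _ ENNReal.ofNat_ne_top,
    ← lintegral_const_mul' _ _ ENNReal.ofReal_ne_top,
    ← lintegral_add_left' (hm.ennreal_ofReal.const_mul _)]
  refine lintegral_mono_ae ?_
  filter_upwards [ha0, haB] with x h0 hB
  have h2B : 0 ≤ 2 * B := by linarith
  rw [← ENNReal.ofReal_mul h2B, ← ENNReal.ofReal_ofNat 2, ← ENNReal.ofReal_mul (by norm_num),
    ← ENNReal.ofReal_add (by positivity) (by positivity)]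
  refine ENNReal.ofReal_le_ofReal ?_
  have h1 : a x * (u x - v x) ^ 2 ≤ B * (u x - v x) ^ 2 := by gcongr
  -- `(u - 2v)² ≥ 0` is the same as `u² ≤ 2v² + 2(u - v)²`.
  nlinarith [mul_nonneg h0 (sq_nonneg (u x - 2 * v x))]

theorem lintegral_weight_dot_sq_le {α : Type*} [MeasurableSpace α] {μ : Measure α} {a : α → ℝ}
    {X u v : Fin 3 → α → ℝ} {B M : ℝ} (ha0 : ∀ᵐ x ∂μ, 0 ≤ a x) (haB : ∀ᵐ x ∂μ, a x ≤ B)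
    (hX : ∀ j, ∀ᵐ x ∂μ, |X j x| ≤ M)
    (hm : AEMeasurable (fun x => a x * (∑ j, X j x * v j x) ^ 2) μ)
    (huv : ∀ j, AEMeasurable (fun x => u j x - v j x) μ) :
    ∫⁻ x, ENNReal.ofReal (a x * (∑ j, X j x * u j x) ^ 2) ∂μ ≤
      2 * (∫⁻ x, ENNReal.ofReal (a x * (∑ j, X j x * v j x) ^ 2) ∂μ) +
        ENNReal.ofReal (6 * B * M ^ 2) * ∑ j, eLpNorm (fun x => u j x - v j x) 2 μ ^ 2 := by
  simp_rw [← lintegral_ofReal_sq]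
  rw [← lintegral_finsetSum' _ fun j _ => ((huv j).pow_const 2).ennreal_ofReal,
    ← lintegral_const_mul' _ _ ENNReal.ofNat_ne_top,
    ← lintegral_const_mul' _ _ ENNReal.ofReal_ne_top,
    ← lintegral_add_left' (hm.ennreal_ofReal.const_mul _)]
  refine lintegral_mono_ae ?_
  filter_upwards [ha0, haB, ae_all_iff.2 hX] with x h0 hB hXx
  have hB0 : 0 ≤ B := h0.trans hB
  rw [← ENNReal.ofReal_sum_of_nonneg (fun _ _ => sq_nonneg _), ← ENNReal.ofReal_mul (by positivity),
    ← ENNReal.ofReal_ofNat 2, ← ENNReal.ofReal_mul (by norm_num),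
    ← ENNReal.ofReal_add (by positivity) (by positivity)]
  refine ENNReal.ofReal_le_ofReal ?_
  set p := ∑ j, X j x * u j x with hp
  set q := ∑ j, X j x * v j x with hq
  have hd : (p - q) ^ 2 ≤ 3 * M ^ 2 * ∑ j, (u j x - v j x) ^ 2 := by
    have e : p - q = ∑ j, X j x * (u j x - v j x) := by
      rw [hp, hq, ← Finset.sum_sub_distrib]
      exact Finset.sum_congr rfl fun j _ => by ring
    rw [e]
    have h1 := sq_sum_le_card_mul_sum_sq (s := (Finset.univ : Finset (Fin 3)))
      (f := fun j => X j x * (u j x - v j x))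
    refine h1.trans ?_
    rw [Finset.card_univ, Fintype.card_fin, mul_assoc]
    push_cast
    gcongr
    rw [Finset.mul_sum]
    refine Finset.sum_le_sum fun j _ => ?_
    rw [mul_pow]
    exact mul_le_mul_of_nonneg_right (sq_le_sq' (abs_le.1 (hXx j)).1 (abs_le.1 (hXx j)).2)
      (sq_nonneg _)
  have h1 : a x * (p - q) ^ 2 ≤ B * (3 * M ^ 2 * ∑ j, (u j x - v j x) ^ 2) :=
    mul_le_mul hB hd (sq_nonneg _) hB0
  nlinarith [mul_nonneg h0 (sq_nonneg (p - 2 * q))]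

/-- Weighted estimate for `X · ∇f` for `f` with a trace on the boundary of `O`. -/
theorem transport_estimate {M c : ℝ} (hM : 0 ≤ M) (hc : 0 < c) : ∃ C : ℝ, 0 < C ∧
    ∀ {Ω O : Set E3} {X : Fin 3 → E3 → ℝ} {D W σ : E3 → ℝ}, O ⊆ Ω →
    IsTransportWeight O X D W σ M c → ∀ f τ : E3 → ℝ,
    (∀ j, AEStronglyMeasurable (weakPartial Ω j f) (volume.restrict Ω)) →
    IsTrace Ω (frontier O) f τ →
    ∫⁻ x in O, ENNReal.ofReal (W x * σ x * f x ^ 2) ≤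
      ENNReal.ofReal C * (∫⁻ x in O, ENNReal.ofReal
        (W x * (σ x)⁻¹ * (∑ j, X j x * weakPartial Ω j f x) ^ 2)) +
      ENNReal.ofReal C *
        ∫⁻ x in frontier O, ENNReal.ofReal (W x * τ x ^ 2) ∂surfaceMeasure := by
  obtain ⟨C₀, hC₀, hsm⟩ := transport_estimate_smooth
  -- The factor `4 / c` inverts `c / 4`. Each inner `4` is `2 · 2`, the cost of replacing `f` by `F
  -- n` on the left and back again on the right; the error terms vanish in the limit.
  refine ⟨4 / c * (4 * (2 / c) + 4 * (C₀ * (M + 1))), by positivity, ?_⟩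
  intro Ω O X D W σ hOΩ h f τ hfm ⟨hτm, F, hF, hF0, hF1, hFτ⟩
  have hZ : IsCompact (closure O) := h.isBounded.isCompact_closure
  have hOm := h.isOpen.measurableSet
  have hfr : frontier O ⊆ closure O := frontier_subset_closure
  have hμ : volume.restrict O ≤ volume.restrict Ω := Measure.restrict_mono hOΩ le_rfl
  have hσi : ContinuousOn (fun x => (σ x)⁻¹) (closure O) :=
    h.contσ.inv₀ fun x hx => (h.posσ x hx).ne'
  obtain ⟨B1, hB1⟩ := hZ.exists_bound_of_continuousOn (h.contW.mul h.contσ)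
  obtain ⟨B2, hB2⟩ := hZ.exists_bound_of_continuousOn (h.contW.mul hσi)
  obtain ⟨B3, hB3⟩ := hZ.exists_bound_of_continuousOn h.contW
  have hW := h.posW
  have hσ := h.posσ
  set R := ∫⁻ x in O, ENNReal.ofReal
        (W x * (σ x)⁻¹ * (∑ j, X j x * weakPartial Ω j f x) ^ 2)
  set I := ∫⁻ x in frontier O, ENNReal.ofReal (W x * τ x ^ 2) ∂surfaceMeasure
  set L := ∫⁻ x in O, ENNReal.ofReal (W x * σ x * f x ^ 2)
  let E1 : ℕ → ℝ≥0∞ := fun n => eLpNorm (fun x => F n x - f x) 2 (volume.restrict Ω) ^ 2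
  let E2 : ℕ → ℝ≥0∞ := fun n => ∑ j, eLpNorm
        (fun x => fderiv ℝ (F n) x (basisVec j) - weakPartial Ω j f x) 2 (volume.restrict Ω) ^ 2
  let E3' : ℕ → ℝ≥0∞ := fun n =>
    eLpNorm (fun x => F n x - τ x) 2 (surfaceMeasure.restrict (frontier O)) ^ 2
  have aeO : ∀ {p : E3 → Prop}, (∀ x ∈ closure O, p x) → ∀ᵐ x ∂volume.restrict O, p x :=
    fun hp => by
      filter_upwards [ae_restrict_mem hOm] with x hx using hp x (subset_closure hx)
  have aeF : ∀ {p : E3 → Prop}, (∀ x ∈ closure O, p x) →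
      ∀ᵐ x ∂surfaceMeasure.restrict (frontier O), p x := fun hp => by
    filter_upwards [ae_restrict_mem isClosed_frontier.measurableSet] with x hx using hp x (hfr hx)
  have hdFm : ∀ n j, AEStronglyMeasurable (fun x => fderiv ℝ (F n) x (basisVec j))
      (volume.restrict O) := fun n j =>
    (((hF n).continuous_fderiv (by simp)).clm_apply continuous_const).aestronglyMeasurable
  have hfm' : ∀ j, AEStronglyMeasurable (weakPartial Ω j f) (volume.restrict O) := fun j =>
    (hfm j).mono_measure hμ
  have s1 : ∀ n, L ≤ 2 * (∫⁻ x in O, ENNReal.ofReal (W x * σ x * F n x ^ 2)) +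
      ENNReal.ofReal (2 * B1) * E1 n := by
    intro n
    refine (lintegral_weight_sq_le (B := B1) (v := F n)
      (aeO fun x hx => (mul_pos (hW x hx) (hσ x hx)).le)
      (aeO fun x hx => (le_abs_self _).trans (hB1 x hx)) ?_).trans ?_
    · exact ((((h.contW.mul h.contσ).mono subset_closure).mul
        ((hF n).continuous.pow 2).continuousOn).aestronglyMeasurable hOm).aemeasurable
    · gcongr
      rw [show (fun x => f x - F n x) = f - F n from rfl, eLpNorm_sub_comm]
      exact pow_le_pow_left' (eLpNorm_mono_measure (F n - f) hμ) 2
  have s2 : ∀ n, ∫⁻ x in O, ENNReal.ofReal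
        (W x * (σ x)⁻¹ * (∑ j, X j x * fderiv ℝ (F n) x (basisVec j)) ^ 2) ≤
        2 * R + ENNReal.ofReal (6 * B2 * M ^ 2) * E2 n := by
    intro n
    refine (lintegral_weight_dot_sq_le (B := B2) (v := fun j => weakPartial Ω j f)
      (u := fun j x => fderiv ℝ (F n) x (basisVec j))
      (aeO fun x hx => (mul_pos (hW x hx) (inv_pos.2 (hσ x hx))).le)
      (aeO fun x hx => (le_abs_self _).trans (hB2 x hx)) h.boundX ?_ ?_).trans ?_
    · refine AEStronglyMeasurable.aemeasurable ?_
      refine (((h.contW.mul hσi).mono subset_closure).aestronglyMeasurable hOm).mul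
        (AEStronglyMeasurable.pow ?_ 2)
      exact Finset.aestronglyMeasurable_fun_sum _ fun j _ => (h.measX j).mul (hfm' j)
    · exact fun j => ((hdFm n j).sub (hfm' j)).aemeasurable
    · gcongr
      exact Finset.sum_le_sum fun j _ => pow_le_pow_left' (eLpNorm_mono_measure _ hμ) 2
  have s3 : ∀ n, ∫⁻ x in frontier O, ENNReal.ofReal (W x * F n x ^ 2) ∂surfaceMeasure ≤
      2 * I + ENNReal.ofReal (2 * B3) * E3' n := by
    intro n
    refine lintegral_weight_sq_le (B := B3) (v := τ)
      (aeF fun x hx => (hW x hx).le)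
      (aeF fun x hx => (le_abs_self _).trans (hB3 x hx)) ?_
    exact (((h.contW.mono hfr).aestronglyMeasurable isClosed_frontier.measurableSet).mul
        (hτm.pow 2)).aemeasurable
  have hstep : ∀ n, ENNReal.ofReal (c / 4) * L ≤
      2 * (ENNReal.ofReal (2 / c) * (2 * R + ENNReal.ofReal (6 * B2 * M ^ 2) * E2 n) +
        ENNReal.ofReal (C₀ * (M + 1)) * (2 * I + ENNReal.ofReal (2 * B3) * E3' n)) +
      ENNReal.ofReal (c / 4) * (ENNReal.ofReal (2 * B1) * E1 n) := by
    intro n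
    calc ENNReal.ofReal (c / 4) * L ≤ ENNReal.ofReal (c / 4) *
          (2 * (∫⁻ x in O, ENNReal.ofReal (W x * σ x * F n x ^ 2)) +
            ENNReal.ofReal (2 * B1) * E1 n) := by gcongr; exact s1 n
      _ = 2 * (ENNReal.ofReal (c / 4) * ∫⁻ x in O, ENNReal.ofReal (W x * σ x * F n x ^ 2)) +
            ENNReal.ofReal (c / 4) * (ENNReal.ofReal (2 * B1) * E1 n) := by ring
      _ ≤ _ := by
          gcongr
          refine (hsm h (F n) (hF n)).trans ?_
          gcongr
          · exact s2 n
          · exact s3 n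
  have sq0 : ∀ {e : ℕ → ℝ≥0∞}, Tendsto e atTop (𝓝 0) →
      Tendsto (fun n => e n ^ 2) atTop (𝓝 0) := fun he => by
    simpa using ENNReal.Tendsto.pow (n := 2) he
  have cm : ∀ {e : ℕ → ℝ≥0∞} {l : ℝ≥0∞} (k : ℝ), Tendsto e atTop (𝓝 l) →
      Tendsto (fun n => ENNReal.ofReal k * e n) atTop (𝓝 (ENNReal.ofReal k * l)) := fun k he =>
    ENNReal.Tendsto.const_mul he (Or.inr ENNReal.ofReal_ne_top)
  have hE1 : Tendsto E1 atTop (𝓝 0) := sq0 hF0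
  have hE2 : Tendsto E2 atTop (𝓝 0) := by
    simpa using tendsto_finsetSum (Finset.univ : Finset (Fin 3)) fun j _ => sq0 (hF1 j)
  have hE3 : Tendsto E3' atTop (𝓝 0) := sq0 hFτ
  have hlim := ((ENNReal.Tendsto.const_mul (a := 2) (((cm (2 / c) ((cm (6 * B2 * M ^ 2) hE2).const_add
    (2 * R))).add (cm (C₀ * (M + 1)) ((cm (2 * B3) hE3).const_add (2 * I)))))
    (Or.inr ENNReal.ofNat_ne_top)).add (cm (c / 4) (cm (2 * B1) hE1)))
  have hfin := ge_of_tendsto' hlim hstep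
  simp only [mul_zero, add_zero] at hfin
  calc L = ENNReal.ofReal (4 / c) * (ENNReal.ofReal (c / 4) * L) := by
        rw [← mul_assoc, ← ENNReal.ofReal_mul (by positivity),
          show 4 / c * (c / 4) = 1 by field_simp, ENNReal.ofReal_one, one_mul]
    _ ≤ ENNReal.ofReal (4 / c) * (2 * (ENNReal.ofReal (2 / c) * (2 * R) +
          ENNReal.ofReal (C₀ * (M + 1)) * (2 * I))) := by gcongr
    _ = ENNReal.ofReal (4 / c * (4 * (2 / c))) * R
          + ENNReal.ofReal (4 / c * (4 * (C₀ * (M + 1)))) * I := by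
        rw [ENNReal.ofReal_mul (q := 4 * (2 / c)) (by positivity),
          ENNReal.ofReal_mul (p := 4) (q := 2 / c) (by norm_num),
          ENNReal.ofReal_mul (q := 4 * (C₀ * (M + 1))) (by positivity),
          ENNReal.ofReal_mul (p := 4) (q := C₀ * (M + 1)) (by norm_num),
          show ENNReal.ofReal 4 = 2 * 2 by norm_num]
        ring
    _ ≤ _ := by
        gcongr
        · have : 0 ≤ C₀ * (M + 1) := by positivity
          linarith
        · have : 0 ≤ 2 / c := by positivity
          linarith


/-! ### Calculus of weak derivatives -/

section WeakCalculus

variable {Ω : Set E3} {j : Fin 3}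

theorem LocallyIntegrableOn.integrable_mul_test {u ζ : E3 → ℝ} (hu : LocallyIntegrableOn u Ω)
    (hζ : Continuous ζ) (hc : HasCompactSupport ζ) (hs : tsupport ζ ⊆ Ω) :
    Integrable (fun x => u x * ζ x) (volume.restrict Ω) := by
  have hK : IntegrableOn u (tsupport ζ) := hu.integrableOn_compact_subset hs hc
  obtain ⟨B, hB⟩ := hc.exists_bound_of_continuous hζ
  have h1 : IntegrableOn (fun x => u x * ζ x) (tsupport ζ) := by
    have : Integrable (fun x => ζ x * u x) (volume.restrict (tsupport ζ)) :=
      Integrable.bdd_mul (c := B) hK hζ.aestronglyMeasurable (Eventually.of_forall hB)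
    simpa only [mul_comm, IntegrableOn] using this
  refine ((integrableOn_iff_integrable_of_support_subset ?_).1 h1).restrict
  exact (Function.support_mul_subset_right u ζ).trans (subset_tsupport ζ)

theorem continuous_partial {η : E3 → ℝ} (hη : ContDiff ℝ 1 η) (j : Fin 3) :
    Continuous fun x => fderiv ℝ η x (basisVec j) :=
  (hη.continuous_fderiv one_ne_zero).clm_apply continuous_const

theorem hasCompactSupport_partial {η : E3 → ℝ} (hc : HasCompactSupport η) (j : Fin 3) :
    HasCompactSupport fun x => fderiv ℝ η x (basisVec j) :=
  (hc.fderiv ℝ).comp_left (g := fun L : E3 →L[ℝ] ℝ => L (basisVec j)) (by simp)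

theorem tsupport_partial_subset (η : E3 → ℝ) (j : Fin 3) :
    tsupport (fun x => fderiv ℝ η x (basisVec j)) ⊆ tsupport η := by
  refine closure_minimal (fun x hx => support_fderiv_subset ℝ (f := η) ?_) (isClosed_tsupport η)
  intro h0
  exact hx (by simp [h0])

/-- The fundamental lemma of the calculus of variations for `v - v'`. -/
theorem LocallyIntegrableOn.ae_eq_of_test (hΩ : IsOpen Ω) {v v' : E3 → ℝ}
    (hv : LocallyIntegrableOn v Ω) (hv' : LocallyIntegrableOn v' Ω)
    (h : ∀ η : E3 → ℝ, ContDiff ℝ ∞ η → HasCompactSupport η → tsupport η ⊆ Ω →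
      ∫ x in Ω, v x * η x = ∫ x in Ω, v' x * η x) : v =ᵐ[volume.restrict Ω] v' := by
  have h0 := hΩ.ae_eq_zero_of_integral_contDiff_smul_eq_zero (hv.sub hv') (fun η h1 h2 h3 => by
    have e : ∫ x, η x • (v - v') x = ∫ x in Ω, η x • (v - v') x := by
      refine (setIntegral_eq_integral_of_forall_compl_eq_zero fun x hx => ?_).symm
      rw [image_eq_zero_of_notMem_tsupport fun hx' => hx (h3 hx'), zero_smul]
    rw [e]
    have e2 : ∀ x, η x • (v - v') x = v x * η x - v' x * η x := fun x => by
      simp only [Pi.sub_apply, smul_eq_mul]; ring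
    simp_rw [e2]
    rw [integral_sub (LocallyIntegrableOn.integrable_mul_test hv h1.continuous h2 h3)
      (LocallyIntegrableOn.integrable_mul_test hv' h1.continuous h2 h3), h η h1 h2 h3, sub_self])
  rw [Filter.EventuallyEq, ae_restrict_iff' hΩ.measurableSet]
  filter_upwards [h0] with x hx hxΩ
  exact sub_eq_zero.1 (hx hxΩ)

theorem LocallyIntegrableOn.congr_ae (hΩ : IsOpen Ω) {u u' : E3 → ℝ}
    (hu : LocallyIntegrableOn u Ω) (h : u =ᵐ[volume.restrict Ω] u') :
    LocallyIntegrableOn u' Ω := by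
  rw [locallyIntegrableOn_iff hΩ.isLocallyClosed] at hu ⊢
  intro k hk hkc
  exact (hu k hk hkc).congr_fun_ae (ae_restrict_of_ae_restrict_of_subset hk h)

theorem HasWeakPartial.ae_eq (hΩ : IsOpen Ω) {u v v' : E3 → ℝ} (h : HasWeakPartial Ω j u v)
    (h' : HasWeakPartial Ω j u v') : v =ᵐ[volume.restrict Ω] v' := by
  refine LocallyIntegrableOn.ae_eq_of_test hΩ h.2.1 h'.2.1 fun η h1 h2 h3 => ?_
  have e1 := h.2.2 η h1 h2 h3
  have e2 := h'.2.2 η h1 h2 h3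
  linarith

theorem hasWeakPartial_weakPartial {u : E3 → ℝ} (h : ∃ v, HasWeakPartial Ω j u v) :
    HasWeakPartial Ω j u (weakPartial Ω j u) := by
  unfold weakPartial
  rw [dif_pos h]
  exact h.choose_spec

theorem HasWeakPartial.weakPartial_ae_eq (hΩ : IsOpen Ω) {u v : E3 → ℝ}
    (h : HasWeakPartial Ω j u v) : weakPartial Ω j u =ᵐ[volume.restrict Ω] v :=
  (hasWeakPartial_weakPartial ⟨v, h⟩).ae_eq hΩ h

theorem HasWeakPartial.congr_ae (hΩ : IsOpen Ω) {u u' v v' : E3 → ℝ} (h : HasWeakPartial Ω j u v)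
    (hu : u =ᵐ[volume.restrict Ω] u') (hv : v =ᵐ[volume.restrict Ω] v') :
    HasWeakPartial Ω j u' v' := by
  refine ⟨LocallyIntegrableOn.congr_ae hΩ h.1 hu, LocallyIntegrableOn.congr_ae hΩ h.2.1 hv, ?_⟩
  intro η h1 h2 h3
  have e1 : ∫ x in Ω, u x * fderiv ℝ η x (basisVec j) = ∫ x in Ω, u' x * fderiv ℝ η x (basisVec j) :=
    integral_congr_ae (hu.mono fun x hx => by simp only [hx])
  have e2 : ∫ x in Ω, v x * η x = ∫ x in Ω, v' x * η x :=
    integral_congr_ae (hv.mono fun x hx => by simp only [hx])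
  rw [← e1, ← e2]
  exact h.2.2 η h1 h2 h3

theorem HasWeakPartial.add {u v u' v' : E3 → ℝ} (h : HasWeakPartial Ω j u v)
    (h' : HasWeakPartial Ω j u' v') :
    HasWeakPartial Ω j (fun x => u x + u' x) (fun x => v x + v' x) := by
  refine ⟨h.1.add h'.1, h.2.1.add h'.2.1, fun η h1 h2 h3 => ?_⟩
  have hη := h1.of_le (m := 1) (by simp)
  have hs := (tsupport_partial_subset η j).trans h3
  simp only [add_mul]
  rw [integral_add (LocallyIntegrableOn.integrable_mul_test h.1 (continuous_partial hη j)
      (hasCompactSupport_partial h2 j) hs) (LocallyIntegrableOn.integrable_mul_test h'.1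
      (continuous_partial hη j) (hasCompactSupport_partial h2 j) hs),
    integral_add (LocallyIntegrableOn.integrable_mul_test h.2.1 h1.continuous h2 h3)
      (LocallyIntegrableOn.integrable_mul_test h'.2.1 h1.continuous h2 h3),
    h.2.2 η h1 h2 h3, h'.2.2 η h1 h2 h3]
  ring

theorem HasWeakPartial.neg {u v : E3 → ℝ} (h : HasWeakPartial Ω j u v) :
    HasWeakPartial Ω j (fun x => -u x) (fun x => -v x) := by
  refine ⟨h.1.neg, h.2.1.neg, fun η h1 h2 h3 => ?_⟩
  simp only [neg_mul, integral_neg]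
  rw [h.2.2 η h1 h2 h3]

theorem HasWeakPartial.sub {u v u' v' : E3 → ℝ} (h : HasWeakPartial Ω j u v)
    (h' : HasWeakPartial Ω j u' v') :
    HasWeakPartial Ω j (fun x => u x - u' x) (fun x => v x - v' x) := by
  simpa only [sub_eq_add_neg] using h.add h'.neg

/-- Needed for the constant entries of the two coefficient matrices: the identity for `P`, the zero
diagonal of `crossMatrix` for `Q`. -/
theorem hasWeakPartial_const (Ω : Set E3) (j : Fin 3) (c : ℝ) :
    HasWeakPartial Ω j (fun _ => c) (fun _ => 0) := by
  refine ⟨(locallyIntegrable_const c).locallyIntegrableOn _,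
    (locallyIntegrable_const (0 : ℝ)).locallyIntegrableOn _, fun η h1 h2 h3 => ?_⟩
  have e : ∫ x in Ω, c * fderiv ℝ η x (basisVec j) = ∫ x, c * fderiv ℝ η x (basisVec j) := by
    refine setIntegral_eq_integral_of_forall_compl_eq_zero fun x hx => ?_
    have : x ∉ tsupport (fun x => fderiv ℝ η x (basisVec j)) := fun hx' =>
      hx (h3 (tsupport_partial_subset η j hx'))
    rw [image_eq_zero_of_notMem_tsupport this, mul_zero]
  have hη := h1.of_le (m := 1) (by simp)
  have hi := (continuous_partial hη j).integrable_of_hasCompactSupport (μ := volume)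
    (hasCompactSupport_partial h2 j)
  rw [e, integral_mul_fderiv_eq_neg_fderiv_mul_of_integrable]
  · simp
  · simp
  · exact hi.const_mul c
  · exact (h1.continuous.integrable_of_hasCompactSupport h2).const_mul c
  · exact fun x _ => differentiableAt_const c
  · exact fun x _ => h1.differentiable (by simp) x

/-- Both derivatives are moved onto the test function, where the second derivative is symmetric. -/
theorem HasWeakPartial.comm (hΩ : IsOpen Ω) {i : Fin 3} {u ui uj uij uji : E3 → ℝ}
    (hi : HasWeakPartial Ω i u ui) (hj : HasWeakPartial Ω j u uj)
    (hij : HasWeakPartial Ω j ui uij) (hji : HasWeakPartial Ω i uj uji) :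
    uij =ᵐ[volume.restrict Ω] uji := by
  refine LocallyIntegrableOn.ae_eq_of_test hΩ hij.2.1 hji.2.1 fun η h1 h2 h3 => ?_
  have hsm : ∀ k, ContDiff ℝ ∞ fun x => fderiv ℝ η x (basisVec k) := fun k =>
    (h1.fderiv_right (m := ∞) (by simp)).clm_apply contDiff_const
  have e1 := hij.2.2 η h1 h2 h3
  have e2 := hji.2.2 η h1 h2 h3
  have e3 := hi.2.2 _ (hsm j) (hasCompactSupport_partial h2 j)
    ((tsupport_partial_subset η j).trans h3)
  have e4 := hj.2.2 _ (hsm i) (hasCompactSupport_partial h2 i)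
    ((tsupport_partial_subset η i).trans h3)
  have hd : ∀ x (k l : Fin 3), fderiv ℝ (fun x => fderiv ℝ η x (basisVec k)) x (basisVec l)
      = fderiv ℝ (fderiv ℝ η) x (basisVec l) (basisVec k) := by
    intro x k l
    have hdd : DifferentiableAt ℝ (fderiv ℝ η) x :=
      (h1.fderiv_right (m := ∞) (by simp)).differentiable (by simp) x
    rw [fderiv_clm_apply hdd (differentiableAt_const _)]
    simp
  have hsymm : ∀ x, fderiv ℝ (fun x => fderiv ℝ η x (basisVec j)) x (basisVec i)
      = fderiv ℝ (fun x => fderiv ℝ η x (basisVec i)) x (basisVec j) := by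
    intro x
    rw [hd, hd]
    exact ((contDiff_infty.1 h1 2).contDiffAt.isSymmSndFDerivAt (by simp)).eq _ _
  simp_rw [hsymm] at e3
  linarith

end WeakCalculus

/-! ### Product rules and weak divergences of products. -/

section Products

variable {Ω : Set E3}

/-- On a finite measure space `L²` convergence implies `L¹` convergence, which can be paired with a
bounded function. -/
theorem tendsto_integral_mul_of_tendsto_eLpNorm {α : Type*} [MeasurableSpace α] {μ : Measure α}
    [IsFiniteMeasure μ] {G : ℕ → α → ℝ} {g k : α → ℝ} (hg : MemLp g 2 μ)
    (hG : ∀ n, MemLp (G n) 2 μ) (hk : MemLp k ⊤ μ)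
    (h : Tendsto (fun n => eLpNorm (fun x => G n x - g x) 2 μ) atTop (𝓝 0)) :
    Tendsto (fun n => ∫ x, G n x * k x ∂μ) atTop (𝓝 (∫ x, g x * k x ∂μ)) := by
  have hi : ∀ {f : α → ℝ}, MemLp f 2 μ → Integrable (fun x => f x * k x) μ := fun hf =>
    (hf.integrable one_le_two).mul_of_top_left hk
  refine tendsto_integral_of_L1' _ (hi hg).aestronglyMeasurable
    (Eventually.of_forall fun n => hi (hG n)) ?_
  have hbound : ∀ n, eLpNorm ((fun x => G n x * k x) - fun x => g x * k x) 1 μ ≤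
      eLpNorm (fun x => G n x - g x) 2 μ * (μ univ ^ (1 / (1 : ℝ≥0∞).toReal - 1 / (2 : ℝ≥0∞).toReal)
        * eLpNorm k ⊤ μ) := by
    intro n
    have e : ((fun x => G n x * k x) - fun x => g x * k x) = (fun x => G n x - g x) • k := by
      ext x; simp only [Pi.sub_apply, Pi.smul_apply', smul_eq_mul]; ring
    have hm : AEStronglyMeasurable (fun x => G n x - g x) μ :=
      (hG n).aestronglyMeasurable.sub hg.aestronglyMeasurable
    rw [e, ← mul_assoc]
    exact (eLpNorm_smul_le_eLpNorm_mul_eLpNorm_top 1 k hm).trans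
      (mul_le_mul_left (eLpNorm_le_eLpNorm_mul_rpow_measure_univ one_le_two hm) _)
  have hc : μ univ ^ (1 / (1 : ℝ≥0∞).toReal - 1 / (2 : ℝ≥0∞).toReal) * eLpNorm k ⊤ μ ≠ ⊤ :=
    ENNReal.mul_ne_top (ENNReal.rpow_ne_top_of_nonneg (by norm_num) (measure_ne_top _ _))
      hk.eLpNorm_ne_top
  have hlim := ENNReal.Tendsto.mul_const h (Or.inr hc)
  rw [zero_mul] at hlim
  exact tendsto_of_tendsto_of_tendsto_of_le_of_le tendsto_const_nhds hlim (fun _ => zero_le)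
    hbound

/-- Product rule for an `H¹`-limit of smooth functions and a `W^{1,∞}` function. -/
theorem HasWeakPartial.mul_of_approx (hb : Bornology.IsBounded Ω) {j : Fin 3}
    {u uj a a' : E3 → ℝ} {F : ℕ → E3 → ℝ} (hF : ∀ n, ContDiff ℝ ∞ (F n))
    (hu : MemLp u 2 (volume.restrict Ω)) (huj : MemLp uj 2 (volume.restrict Ω))
    (hF0 : Tendsto (fun n => eLpNorm (fun x => F n x - u x) 2 (volume.restrict Ω)) atTop (𝓝 0))
    (hF1 : Tendsto (fun n => eLpNorm (fun x => fderiv ℝ (F n) x (basisVec j) - uj x) 2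
      (volume.restrict Ω)) atTop (𝓝 0))
    (ha : MemLp a ⊤ (volume.restrict Ω)) (ha' : MemLp a' ⊤ (volume.restrict Ω))
    (h : HasWeakPartial Ω j a a') :
    HasWeakPartial Ω j (fun x => u x * a x) (fun x => uj x * a x + u x * a' x) := by
  have : IsFiniteMeasure (volume.restrict Ω) := ⟨by
    simpa using hb.measure_lt_top⟩
  have hLp : ∀ {G : E3 → ℝ}, Continuous G → MemLp G 2 (volume.restrict Ω) := fun {G} hG => by
    obtain ⟨B, hB⟩ := hb.isCompact_closure.exists_bound_of_continuousOn hG.continuousOn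
    have hmem : MemLp G 2 (volume.restrict (closure Ω)) := by
      have : IsFiniteMeasure (volume.restrict (closure Ω)) :=
        ⟨by simpa using hb.isCompact_closure.measure_lt_top⟩
      refine MemLp.of_bound hG.aestronglyMeasurable B ?_
      filter_upwards [ae_restrict_mem isClosed_closure.measurableSet] with x hx using hB x hx
    exact hmem.mono_measure (Measure.restrict_mono subset_closure le_rfl)
  have hprod : ∀ {f k : E3 → ℝ}, MemLp f 2 (volume.restrict Ω) → MemLp k ⊤ (volume.restrict Ω) →
      Integrable (fun x => f x * k x) (volume.restrict Ω) := fun hf hk =>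
    (hf.integrable one_le_two).mul_of_top_left hk
  have hloc : ∀ {f : E3 → ℝ}, Integrable f (volume.restrict Ω) → LocallyIntegrableOn f Ω :=
    fun hf => IntegrableOn.locallyIntegrableOn hf
  refine ⟨hloc (hprod hu ha), hloc ((hprod huj ha).add (hprod hu ha')), fun η h1 h2 h3 => ?_⟩
  have hη1 := h1.of_le (m := 1) (by simp)
  have tη : MemLp η ⊤ (volume.restrict Ω) :=
    h1.continuous.memLp_top_of_hasCompactSupport h2 _
  have tdη : MemLp (fun x => fderiv ℝ η x (basisVec j)) ⊤ (volume.restrict Ω) :=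
    (continuous_partial hη1 j).memLp_top_of_hasCompactSupport (hasCompactSupport_partial h2 j) _
  have k1 : MemLp (fun x => a x * fderiv ℝ η x (basisVec j)) ⊤ (volume.restrict Ω) := tdη.mul ha
  have k2 : MemLp (fun x => a x * η x) ⊤ (volume.restrict Ω) := tη.mul ha
  have k3 : MemLp (fun x => a' x * η x) ⊤ (volume.restrict Ω) := tη.mul ha'
  have hFc : ∀ n, ContDiff ℝ 1 (F n) := fun n => (hF n).of_le (by simp)
  have m0 : ∀ n, MemLp (F n) 2 (volume.restrict Ω) := fun n => hLp (hF n).continuous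
  have m1 : ∀ n, MemLp (fun x => fderiv ℝ (F n) x (basisVec j)) 2 (volume.restrict Ω) := fun n =>
    hLp (continuous_partial (hFc n) j)
  have l1 := tendsto_integral_mul_of_tendsto_eLpNorm hu m0 k1 hF0
  have l2 := tendsto_integral_mul_of_tendsto_eLpNorm huj m1 k2 hF1
  have l3 := tendsto_integral_mul_of_tendsto_eLpNorm hu m0 k3 hF0
  -- For smooth `F n` the product `F n · η` is itself a test function for the weak derivative of
  -- `a`.
  have key : ∀ n, (∫ x in Ω, F n x * (a x * fderiv ℝ η x (basisVec j))) =
      -((∫ x in Ω, fderiv ℝ (F n) x (basisVec j) * (a x * η x))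
        + ∫ x in Ω, F n x * (a' x * η x)) := by
    intro n
    have hts : tsupport (fun x => F n x * η x) ⊆ tsupport η := tsupport_mul_subset_right
    have e := h.2.2 (fun x => F n x * η x) ((hF n).mul h1) h2.mul_left (hts.trans h3)
    have hd : ∀ x, fderiv ℝ (fun x => F n x * η x) x (basisVec j) =
        F n x * fderiv ℝ η x (basisVec j) + η x * fderiv ℝ (F n) x (basisVec j) := by
      intro x
      have d1 := ((hF n).differentiable (by simp) x).hasFDerivAt
      have d2 := (h1.differentiable (by simp) x).hasFDerivAt
      have d3 : HasFDerivAt (fun x => F n x * η x) _ x := d1.mul d2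
      rw [d3.fderiv]
      simp
    have e1 : ∫ x in Ω, a x * fderiv ℝ (fun x => F n x * η x) x (basisVec j) =
        (∫ x in Ω, F n x * (a x * fderiv ℝ η x (basisVec j)))
          + ∫ x in Ω, fderiv ℝ (F n) x (basisVec j) * (a x * η x) := by
      rw [← integral_add (hprod (m0 n) k1) (hprod (m1 n) k2)]
      exact integral_congr_ae (Eventually.of_forall fun x => by simp only [hd]; ring)
    have e2 : ∫ x in Ω, a' x * (F n x * η x) = ∫ x in Ω, F n x * (a' x * η x) :=
      integral_congr_ae (Eventually.of_forall fun x => by ring)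
    rw [e1, e2] at e
    linarith
  simp_rw [key] at l1
  have huniq := tendsto_nhds_unique l1 (l2.add l3).neg
  have f1 : ∫ x in Ω, u x * a x * fderiv ℝ η x (basisVec j) =
      ∫ x in Ω, u x * (a x * fderiv ℝ η x (basisVec j)) :=
    integral_congr_ae (Eventually.of_forall fun x => by ring)
  have f2 : ∫ x in Ω, (uj x * a x + u x * a' x) * η x =
      (∫ x in Ω, uj x * (a x * η x)) + ∫ x in Ω, u x * (a' x * η x) := by
    rw [← integral_add (hprod huj k2) (hprod hu k3)]
    exact integral_congr_ae (Eventually.of_forall fun x => by ring)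
  rw [f1, f2, huniq]

/-- Product rule for a function with a trace and a `W^{1,∞}` coefficient. -/
theorem IsTrace.hasWeakPartial_mul (hb : Bornology.IsBounded Ω) {S : Set E3} {u τ a : E3 → ℝ}
    (ht : IsTrace Ω S u τ) (hu : MemSobolev Ω 2 1 u) (ha : MemSobolev Ω ⊤ 1 a) (j : Fin 3) :
    HasWeakPartial Ω j (fun x => u x * a x)
      (fun x => weakPartial Ω j u x * a x + u x * weakPartial Ω j a x) := by
  -- The sequence that defines the trace is an approximation in `H¹(Ω)` by smooth functions, which
  -- is all the product rule asks for.
  obtain ⟨-, F, hF, hF0, hF1, -⟩ := ht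
  exact HasWeakPartial.mul_of_approx hb hF hu.1 (hu.2 j).2 hF0 (hF1 j) ha.1 (ha.2 j).2
    (hasWeakPartial_weakPartial (ha.2 j).1)

/-- The weak divergence of `B w`, with `B` a field of matrices with weak derivatives and `w`
smooth. -/
theorem isWeakDiv_of_hasWeakPartial (hΩ : IsOpen Ω) {O : Set E3} (hOΩ : O ⊆ Ω)
    {B B' : Fin 3 → Fin 3 → E3 → ℝ} {w : Fin 3 → E3 → ℝ}
    (hB : ∀ l m, HasWeakPartial Ω l (B l m) (B' l m)) (hw : ∀ m, ContDiff ℝ ∞ (w m)) :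
    IsWeakDiv O (fun l x => ∑ m, B l m x * w m x)
      (fun x => ∑ l, ∑ m, (B' l m x * w m x + B l m x * fderiv ℝ (w m) x (basisVec l))) := by
  intro η h1 h2 h3
  have h3Ω := h3.trans hOΩ
  have hi1 : ∀ l m, Integrable (fun x => B l m x * fderiv ℝ (fun x => w m x * η x) x (basisVec l))
      (volume.restrict Ω) := fun l m => by
    have hζ : ContDiff ℝ 1 (fun x => w m x * η x) := ((hw m).of_le (by simp)).mul h1
    have hζs : tsupport (fun x => w m x * η x) ⊆ tsupport η := tsupport_mul_subset_right
    exact LocallyIntegrableOn.integrable_mul_test (hB l m).1 (continuous_partial hζ l)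
      (hasCompactSupport_partial h2.mul_left l)
      ((tsupport_partial_subset _ l).trans (hζs.trans h3Ω))
  have hi2 : ∀ l m, Integrable (fun x => B' l m x * (w m x * η x)) (volume.restrict Ω) :=
    fun l m => by
    have hζs : tsupport (fun x => w m x * η x) ⊆ tsupport η := tsupport_mul_subset_right
    exact LocallyIntegrableOn.integrable_mul_test (hB l m).2.1 ((hw m).continuous.mul h1.continuous)
      h2.mul_left (hζs.trans h3Ω)
  -- Regrouped this way, each pair `(l, m)` is the weak derivative identity of `B l m` tested with
  -- the `C¹` function `w m · η`.
  have e0 : ∀ x, (∑ l, (∑ m, B l m x * w m x) * fderiv ℝ η x (basisVec l)) +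
      (∑ l, ∑ m, (B' l m x * w m x + B l m x * fderiv ℝ (w m) x (basisVec l))) * η x =
      ∑ l, ∑ m, (B l m x * fderiv ℝ (fun x => w m x * η x) x (basisVec l)
        + B' l m x * (w m x * η x)) := by
    intro x
    have hd : ∀ l m, fderiv ℝ (fun x => w m x * η x) x (basisVec l) =
        w m x * fderiv ℝ η x (basisVec l) + η x * fderiv ℝ (w m) x (basisVec l) := by
      intro l m
      have d1 := ((hw m).differentiable (by simp) x).hasFDerivAt
      have d2 := (h1.differentiable (by simp) x).hasFDerivAt
      have d3 : HasFDerivAt (fun x => w m x * η x) _ x := d1.mul d2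
      rw [d3.fderiv]
      simp
    simp only [hd, Finset.sum_mul]
    rw [← Finset.sum_add_distrib]
    refine Finset.sum_congr rfl fun l _ => ?_
    rw [← Finset.sum_add_distrib]
    exact Finset.sum_congr rfl fun m _ => by ring
  calc ∫ x in O, ((∑ l, (∑ m, B l m x * w m x) * fderiv ℝ η x (basisVec l)) +
      (∑ l, ∑ m, (B' l m x * w m x + B l m x * fderiv ℝ (w m) x (basisVec l))) * η x)
      = ∫ x in Ω, ((∑ l, (∑ m, B l m x * w m x) * fderiv ℝ η x (basisVec l)) +
      (∑ l, ∑ m, (B' l m x * w m x + B l m x * fderiv ℝ (w m) x (basisVec l))) * η x) := by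
        refine (setIntegral_eq_of_subset_of_forall_sdiff_eq_zero hΩ.measurableSet hOΩ ?_).symm
        intro x hx
        have hx' : x ∉ tsupport η := fun hx' => hx.2 (h3 hx')
        have hf : ∀ l, fderiv ℝ η x (basisVec l) = 0 := fun l =>
          image_eq_zero_of_notMem_tsupport (f := fun x => fderiv ℝ η x (basisVec l))
            fun hx'' => hx' (tsupport_partial_subset η l hx'')
        simp [hf, image_eq_zero_of_notMem_tsupport hx']
    _ = ∫ x in Ω, ∑ l, ∑ m, (B l m x * fderiv ℝ (fun x => w m x * η x) x (basisVec l)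
        + B' l m x * (w m x * η x)) := by simp_rw [e0]
    _ = ∑ l, ∑ m, ((∫ x in Ω, B l m x * fderiv ℝ (fun x => w m x * η x) x (basisVec l))
        + ∫ x in Ω, B' l m x * (w m x * η x)) := by
        have hi : ∀ l m, Integrable (fun x => B l m x * fderiv ℝ (fun x => w m x * η x) x
            (basisVec l) + B' l m x * (w m x * η x)) (volume.restrict Ω) := fun l m =>
          (hi1 l m).add (hi2 l m)
        rw [integral_finsetSum _ fun l _ => integrable_finsetSum _ fun m _ => hi l m]
        refine Finset.sum_congr rfl fun l _ => ?_
        rw [integral_finsetSum _ fun m _ => hi l m]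
        exact Finset.sum_congr rfl fun m _ => integral_add (hi1 l m) (hi2 l m)
    _ = 0 := by
        refine Finset.sum_eq_zero fun l _ => Finset.sum_eq_zero fun m _ => ?_
        have hζs : tsupport (fun x => w m x * η x) ⊆ tsupport η := tsupport_mul_subset_right
        rw [(hB l m).integral_eq_of_contDiff_one hΩ (((hw m).of_le (by simp)).mul h1)
          h2.mul_left (hζs.trans h3Ω)]
        ring

end Products


/-! ### Exponential weights -/

/-- A bounded field `X` on `O` with bounded weak divergence, uniformly transversal to the level
sets of the non-negative function `q`. -/
structure IsTransversalField (O : Set E3) (X : Fin 3 → E3 → ℝ) (D q : E3 → ℝ) (M c : ℝ) :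
    Prop where
  isOpen : IsOpen O
  isBounded : Bornology.IsBounded O
  measX : ∀ j, AEStronglyMeasurable (X j) (volume.restrict O)
  measD : AEStronglyMeasurable D (volume.restrict O)
  boundX : ∀ j, ∀ᵐ x ∂volume.restrict O, |X j x| ≤ M
  boundD : ∀ᵐ x ∂volume.restrict O, |D x| ≤ M
  weakDiv : IsWeakDiv O X D
  contq : ContinuousOn q (closure O)
  nonnegq : ∀ x ∈ closure O, 0 ≤ q x
  diffq : ContDiffOn ℝ 1 q O
  posc : 0 < c
  nonnegM : 0 ≤ M
  grad : ∀ x ∈ O, c ≤ ∑ j, X j x * fderiv ℝ q x (basisVec j)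

section ExpWeight

variable {O : Set E3} {X : Fin 3 → E3 → ℝ} {D q : E3 → ℝ} {M c : ℝ}

/-- Differentiating the exponent gives `X · ∇W = (κ λ + 2 s λ e^{λ q}) W (X · ∇q)`. One of the two
copies of `s λ e^{λ q}` outweighs `κ λ`, even for `κ = -1`, because `s e^{λ q} ≥ 1`; the other copy
is `σ`. Non-negativity of `q` is what makes `σ ≥ s`. -/
theorem IsTransversalField.isTransportWeight (h : IsTransversalField O X D q M c) {κ K lam s : ℝ}
    (hκ : |κ| ≤ 1) (hK : 0 < K) (hlam : 1 ≤ lam) (hs : 1 ≤ s) (hsM : 4 * M ≤ c * s) :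
    IsTransportWeight O X D
      (fun x => K * Real.exp (κ * lam * q x + 2 * s * Real.exp (lam * q x)))
      (fun x => s * lam * Real.exp (lam * q x)) M c where
  isOpen := h.isOpen
  isBounded := h.isBounded
  measX := h.measX
  measD := h.measD
  boundX := h.boundX
  boundD := h.boundD
  weakDiv := h.weakDiv
  contW := by have := h.contq; fun_prop
  posW := fun x _ => by positivity
  diffW := by have := h.diffq; fun_prop
  contσ := by have := h.contq; fun_prop
  posσ := fun x _ => by positivity
  largeσ := fun x hx => by
    have h1 : 1 ≤ Real.exp (lam * q x) :=
      Real.one_le_exp (mul_nonneg (by linarith) (h.nonnegq x hx))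
    have h2 : s ≤ s * lam * Real.exp (lam * q x) := by
      nlinarith [mul_le_mul hlam h1 zero_le_one (by linarith : (0 : ℝ) ≤ lam)]
    exact hsM.trans (mul_le_mul_of_nonneg_left h2 h.posc.le)
  posc := h.posc
  nonnegM := h.nonnegM
  grad := fun x hx => by
    have hq : HasFDerivAt q (fderiv ℝ q x) x :=
      ((h.diffq.contDiffAt (h.isOpen.mem_nhds hx)).differentiableAt one_ne_zero).hasFDerivAt
    have hW := ((((hq.const_mul (κ * lam)).add
      ((hq.const_mul lam).exp.const_mul (2 * s))).exp).const_mul K).fderiv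
    set e := Real.exp (lam * q x) with he
    set W := K * Real.exp (κ * lam * q x + 2 * s * e) with hWdef
    have hWpos : 0 < W := by positivity
    have hgr := h.grad x hx
    have h1 : 1 ≤ e := Real.one_le_exp (mul_nonneg (by linarith)
      (h.nonnegq x (subset_closure hx)))
    have hsum : ∑ j, X j x * fderiv ℝ
        (fun x => K * Real.exp (κ * lam * q x + 2 * s * Real.exp (lam * q x))) x (basisVec j)
        = (κ * lam + 2 * s * lam * e) * W * ∑ j, X j x * fderiv ℝ q x (basisVec j) := by
      have hW' : fderiv ℝ
        (fun x => K * Real.exp (κ * lam * q x + 2 * s * Real.exp (lam * q x))) x = _ := hW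
      rw [hW', Finset.mul_sum]
      refine Finset.sum_congr rfl fun j _ => ?_
      simp only [add_apply, smul_apply, smul_eq_mul, Pi.add_apply]
      rw [hWdef, he]
      ring
    rw [hsum]
    have h2 : s * lam * e ≤ κ * lam + 2 * s * lam * e := by
      have h3 := (abs_le.1 hκ).1
      have h4 : 1 ≤ s * e := by nlinarith
      nlinarith
    have h5 : 0 ≤ s * lam * e := by positivity
    calc c * (s * lam * e) * W = (s * lam * e) * W * c := by ring
      _ ≤ (κ * lam + 2 * s * lam * e) * W * ∑ j, X j x * fderiv ℝ q x (basisVec j) := by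
        have hc := h.posc
        gcongr
        exact mul_nonneg (h5.trans h2) hWpos.le

/-- The two Carleman estimates for the first-order operator `X · ∇`. -/
theorem IsTransversalField.carleman (h : IsTransversalField O X D q M c) :
    ∃ C s₀ : ℝ, 0 < C ∧ 1 ≤ s₀ ∧ ∀ lam ≥ (1 : ℝ), ∀ s ≥ s₀, ∀ {Ω : Set E3}, O ⊆ Ω →
    ∀ f τ : E3 → ℝ,
    (∀ j, AEStronglyMeasurable (weakPartial Ω j f) (volume.restrict Ω)) →
    IsTrace Ω (frontier O) f τ →
    (∫⁻ x in O, ENNReal.ofReal (s ^ 2 * lam ^ 2 * Real.exp (lam * q x) ^ 2 * f x ^ 2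
        * Real.exp (2 * s * Real.exp (lam * q x))) ≤
      ENNReal.ofReal C * (∫⁻ x in O, ENNReal.ofReal
        ((∑ j, X j x * weakPartial Ω j f x) ^ 2 * Real.exp (2 * s * Real.exp (lam * q x)))) +
      ENNReal.ofReal C * ∫⁻ x in frontier O, ENNReal.ofReal
        (s * lam * Real.exp (lam * q x) * τ x ^ 2 * Real.exp (2 * s * Real.exp (lam * q x)))
          ∂surfaceMeasure) ∧
    (∫⁻ x in O, ENNReal.ofReal (f x ^ 2 * Real.exp (2 * s * Real.exp (lam * q x))) ≤
      ENNReal.ofReal C * (∫⁻ x in O, ENNReal.ofReal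
        (1 / (s ^ 2 * lam ^ 2 * Real.exp (lam * q x) ^ 2) *
          (∑ j, X j x * weakPartial Ω j f x) ^ 2 * Real.exp (2 * s * Real.exp (lam * q x)))) +
      ENNReal.ofReal C * ∫⁻ x in frontier O, ENNReal.ofReal
        (1 / (s * lam * Real.exp (lam * q x)) * τ x ^ 2
          * Real.exp (2 * s * Real.exp (lam * q x))) ∂surfaceMeasure) := by
  obtain ⟨C, hC, hest⟩ := transport_estimate h.nonnegM h.posc
  -- Since `σ ≥ s`, this threshold ensures `4 M ≤ c σ`. Only `s` has to be large; `λ ≥ 1` suffices.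
  refine ⟨C, max 1 (4 * M / c), hC, le_max_left _ _, ?_⟩
  intro lam hlam s hs Ω hOΩ f τ hfm ht
  have hs1 : 1 ≤ s := (le_max_left _ _).trans hs
  have hsM : 4 * M ≤ c * s := by
    have := (le_max_right 1 (4 * M / c)).trans hs
    rw [div_le_iff₀ h.posc] at this
    linarith
  have hs0 : 0 < s := by linarith
  have hl0 : 0 < lam := by linarith
  constructor
  -- With `φ = e^{λ q}`, here `W = s λ φ e^{2sφ}`, so `W σ = s² λ² φ² e^{2sφ}` and `W / σ =
  -- e^{2sφ}`.
  · have key := hest hOΩ (h.isTransportWeight (κ := 1) (K := s * lam) (by simp) (by positivity)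
      hlam hs1 hsM) f τ hfm ht
    convert key using 3
    · rename_i x
      congr 1
      rw [Real.exp_add, one_mul]
      ring
    · congr 1
      ext x
      congr 1
      rw [Real.exp_add, one_mul]
      have := (Real.exp_pos (lam * q x)).ne'
      field_simp
    · congr 1
      ext x
      congr 1
      rw [Real.exp_add, one_mul]
      ring
  -- Here `W = (s λ φ)⁻¹ e^{2sφ}`, so `W σ = e^{2sφ}` and `W / σ = (s λ φ)⁻² e^{2sφ}`.
  · have key := hest hOΩ (h.isTransportWeight (κ := -1) (K := 1 / (s * lam)) (by simp)
      (by positivity) hlam hs1 hsM) f τ hfm ht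
    have hexp : ∀ x, Real.exp (-1 * lam * q x + 2 * s * Real.exp (lam * q x)) =
        (Real.exp (lam * q x))⁻¹ * Real.exp (2 * s * Real.exp (lam * q x)) := fun x => by
      rw [Real.exp_add, ← Real.exp_neg]
      congr 2
      ring
    simp only [hexp] at key
    convert key using 3
    · rename_i x
      congr 1
      have := (Real.exp_pos (lam * q x)).ne'
      field_simp
    · congr 1
      ext x
      congr 1
      have := (Real.exp_pos (lam * q x)).ne'
      field_simp
    · congr 1
      ext x
      congr 1
      have := (Real.exp_pos (lam * q x)).ne'
      field_simp

end ExpWeight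

/-! ### Uniform bounds and the construction of transversal fields. -/

theorem MemLp.exists_ae_abs_le {α : Type*} [MeasurableSpace α] {μ : Measure α} {u : α → ℝ}
    (hu : MemLp u ⊤ μ) : ∃ M : ℝ, 0 ≤ M ∧ ∀ᵐ x ∂μ, |u x| ≤ M := by
  refine ⟨(eLpNorm u ⊤ μ).toReal, ENNReal.toReal_nonneg, ?_⟩
  have hfin := hu.eLpNorm_ne_top
  rw [eLpNorm_exponent_top] at hfin ⊢
  filter_upwards [ae_le_eLpNormEssSup (f := u) (μ := μ)] with x hx
  have := (ENNReal.toReal_le_toReal (by simp) hfin).2 hx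
  simpa using this

theorem exists_common_ae_bound {α ι : Type*} [Finite ι] [MeasurableSpace α] {μ : Measure α}
    {u : ι → α → ℝ} (hu : ∀ i, MemLp (u i) ⊤ μ) :
    ∃ M : ℝ, 0 ≤ M ∧ ∀ᵐ x ∂μ, ∀ i, |u i x| ≤ M := by
  have := Fintype.ofFinite ι
  choose M hM hb using fun i => MemLp.exists_ae_abs_le (hu i)
  refine ⟨∑ i, M i, Finset.sum_nonneg fun i _ => hM i, ?_⟩
  filter_upwards [ae_all_iff.2 hb] with x hx i
  exact (hx i).trans (Finset.single_le_sum (fun j _ => hM j) (Finset.mem_univ i))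

theorem exists_common_bound_on_compact {ι : Type*} [Finite ι] {K : Set E3} (hK : IsCompact K)
    {u : ι → E3 → ℝ} (hu : ∀ i, ContinuousOn (u i) K) :
    ∃ M : ℝ, 0 ≤ M ∧ ∀ x ∈ K, ∀ i, |u i x| ≤ M := by
  have := Fintype.ofFinite ι
  choose M hb using fun i => hK.exists_bound_of_continuousOn (hu i)
  refine ⟨∑ i, |M i|, Finset.sum_nonneg fun i _ => abs_nonneg _, ?_⟩
  intro x hx i
  exact ((hb i x hx).trans (le_abs_self _)).trans
    (Finset.single_le_sum (fun j _ => abs_nonneg (M j)) (Finset.mem_univ i))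

/-- A field of the form `B w`, with `w` smooth, transversal to the level sets of `d`. -/
theorem exists_transversalField {Ω O : Set E3} (hΩ : IsSmoothBoundedDomain Ω) (hO : IsOpen O)
    (hOΩ : O ⊆ Ω) {d : E3 → ℝ} (hd : ContDiffOn ℝ 2 d (closure Ω)) (hpos : ∀ x ∈ Ω, 0 ≤ d x)
    {k : ℝ} (hk : 0 ≤ k)
    {B B' : Fin 3 → Fin 3 → E3 → ℝ} (hB : ∀ l m, HasWeakPartial Ω l (B l m) (B' l m))
    (hBL : ∀ l m, MemLp (B l m) ⊤ (volume.restrict Ω))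
    (hBL' : ∀ l m, MemLp (B' l m) ⊤ (volume.restrict Ω))
    (hBc : ∀ l m, ContinuousOn (B l m) (closure O))
    (hv : ∀ x ∈ closure O, (fun m => ∑ l, B l m x * gradBar Ω d x l) ≠ 0) :
    ∃ w : Fin 3 → E3 → ℝ, ∃ (D : E3 → ℝ) (M c : ℝ),
      IsTransversalField O (fun l x => ∑ m, B l m x * w m x) D (fun x => d x + k) M c ∧
      ∀ x ∈ closure O, ∀ m, |w m x| ≤ M := by
  have hcl : closure O ⊆ closure Ω := closure_mono hOΩ
  have hOb : Bornology.IsBounded O := hΩ.isBounded.subset hOΩ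
  have hZ := hOb.isCompact_closure
  have hgrad := continuousOn_gradBar (hΩ.smooth.uniqueDiffOn_closure hΩ.isOpen) hd
  have hvc : ContinuousOn (fun x m => ∑ l, B l m x * gradBar Ω d x l) (closure O) :=
    continuousOn_pi.2 fun m => continuousOn_finsetSum _ fun l _ =>
      (hBc l m).mul ((continuousOn_pi.1 hgrad l).mono hcl)
  -- With `X = B w`, the quantity `X · ∇d` equals `w · (Bᵀ ∇d)`, so `w` has to follow `Bᵀ ∇d`, which
  -- has no zero on the compact closure.
  obtain ⟨w, hw, c, hc, hwc⟩ := exists_smooth_dot_ge hZ hvc hv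
  have hμ : volume.restrict O ≤ volume.restrict Ω := Measure.restrict_mono hOΩ le_rfl
  obtain ⟨M1, hM1, hb1⟩ := exists_common_ae_bound (u := fun p : Fin 3 × Fin 3 => B p.1 p.2)
    (fun p => (hBL p.1 p.2).mono_measure hμ)
  obtain ⟨M2, hM2, hb2⟩ := exists_common_ae_bound (u := fun p : Fin 3 × Fin 3 => B' p.1 p.2)
    (fun p => (hBL' p.1 p.2).mono_measure hμ)
  obtain ⟨M3, hM3, hb3⟩ := exists_common_bound_on_compact hZ (u := w)
    (fun m => (hw m).continuous.continuousOn)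
  have hwd : ∀ m l, Continuous fun x => fderiv ℝ (w m) x (basisVec l) := fun m l =>
    continuous_partial ((hw m).of_le (by simp)) l
  obtain ⟨M4, hM4, hb4⟩ := exists_common_bound_on_compact hZ
    (u := fun (p : Fin 3 × Fin 3) x => fderiv ℝ (w p.1) x (basisVec p.2))
    (fun p => (hwd p.1 p.2).continuousOn)
  have hOm := hO.measurableSet
  -- One number that dominates `w` (first term), `X` (second) and the weak divergence (third).
  refine ⟨w, _, M3 + 3 * (M1 * M3) + 9 * (M2 * M3 + M1 * M4), c,
    ⟨hO, hOb, ?_, ?_, ?_, ?_, isWeakDiv_of_hasWeakPartial hΩ.isOpen hOΩ hB hw, ?_, ?_, ?_, hc,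
      by positivity, ?_⟩, ?_⟩
  · exact fun l => Finset.aestronglyMeasurable_fun_sum _ fun m _ =>
      ((hBL l m).aestronglyMeasurable.mono_measure hμ).mul (hw m).continuous.aestronglyMeasurable
  · exact Finset.aestronglyMeasurable_fun_sum _ fun l _ =>
      Finset.aestronglyMeasurable_fun_sum _ fun m _ =>
      (((hBL' l m).aestronglyMeasurable.mono_measure hμ).mul
        (hw m).continuous.aestronglyMeasurable).add
      (((hBL l m).aestronglyMeasurable.mono_measure hμ).mul (hwd m l).aestronglyMeasurable)
  · intro l
    filter_upwards [hb1, ae_restrict_mem hOm] with x h1 hx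
    have h3 := hb3 x (subset_closure hx)
    calc |∑ m, B l m x * w m x| ≤ ∑ m, |B l m x * w m x| := Finset.abs_sum_le_sum_abs _ _
      _ ≤ ∑ _m : Fin 3, M1 * M3 := by
        refine Finset.sum_le_sum fun m _ => ?_
        rw [abs_mul]
        exact mul_le_mul (h1 (l, m)) (h3 m) (abs_nonneg _) hM1
      _ = 3 * (M1 * M3) := by simp
      _ ≤ _ := by
        have : 0 ≤ M2 * M3 := by positivity
        have : 0 ≤ M1 * M4 := by positivity
        linarith
  · filter_upwards [hb1, hb2, ae_restrict_mem hOm] with x h1 h2 hx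
    have h3 := hb3 x (subset_closure hx)
    have h4 := hb4 x (subset_closure hx)
    calc |∑ l, ∑ m, (B' l m x * w m x + B l m x * fderiv ℝ (w m) x (basisVec l))|
        ≤ ∑ l, ∑ m, |B' l m x * w m x + B l m x * fderiv ℝ (w m) x (basisVec l)| :=
          (Finset.abs_sum_le_sum_abs _ _).trans
            (Finset.sum_le_sum fun l _ => Finset.abs_sum_le_sum_abs _ _)
      _ ≤ ∑ _l : Fin 3, ∑ _m : Fin 3, (M2 * M3 + M1 * M4) := by
        refine Finset.sum_le_sum fun l _ => Finset.sum_le_sum fun m _ => ?_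
        refine (abs_add_le _ _).trans (add_le_add ?_ ?_)
        · rw [abs_mul]
          exact mul_le_mul (h2 (l, m)) (h3 m) (abs_nonneg _) hM2
        · rw [abs_mul]
          exact mul_le_mul (h1 (l, m)) (h4 (m, l)) (abs_nonneg _) hM1
      _ = 9 * (M2 * M3 + M1 * M4) := by simp; ring
      _ ≤ _ := by
        have : 0 ≤ M1 * M3 := by positivity
        linarith
  · exact (hd.continuousOn.mono hcl).add continuousOn_const
  · intro x hx
    have : 0 ≤ d x := by
      have hmem : closure Ω ⊆ {x | x ∈ closure Ω ∧ 0 ≤ d x} := by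
        refine closure_minimal (fun y hy => ⟨subset_closure hy, hpos y hy⟩) ?_
        exact hd.continuousOn.preimage_isClosed_of_isClosed isClosed_closure isClosed_Ici
      exact (hmem (hcl hx)).2
    exact add_nonneg this hk
  · exact ((hd.mono (hOΩ.trans subset_closure)).of_le (by norm_num)).add contDiffOn_const
  · intro x hx
    refine (hwc x (subset_closure hx)).trans (le_of_eq ?_)
    have hfd : ∀ l, fderiv ℝ (fun x => d x + k) x (basisVec l) = gradBar Ω d x l := fun l => by
      rw [fderiv_add_const, gradBar_eq hΩ.isOpen (hOΩ hx)]
    simp only [hfd, Finset.mul_sum, Finset.sum_mul]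
    rw [Finset.sum_comm]
    exact Finset.sum_congr rfl fun l _ => Finset.sum_congr rfl fun m _ => by ring
  · intro x hx m
    refine (hb3 x hx m).trans ?_
    have : 0 ≤ 3 * (M1 * M3) + 9 * (M2 * M3 + M1 * M4) := by positivity
    linarith


/-! ### Absorption of lower-order terms -/

theorem ENNReal.exists_ofReal_of_ne_top {x : ℝ≥0∞} (hx : x ≠ ⊤) :
    ∃ r : ℝ, 0 ≤ r ∧ x = ENNReal.ofReal r :=
  ⟨x.toReal, ENNReal.toReal_nonneg, (ENNReal.ofReal_toReal hx).symm⟩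

/-- `L₀` and `L j` are the weighted integrals of the function and of its derivatives, `N` and `V`
the lower-order remainders, `S` the source and `Bd` the boundary term. From `6 C K ≤ s ≤ s²` each
remainder enters with factor at most `1 / 6`. With `R = C K S + C Bd` this gives `L₀ ≤ (6/5) R` and
`∑ L j ≤ L₀ + 6 R`, so the total is at most `(42/5) R`. Subtracting requires `L₀` and `L j` to be
finite. -/
theorem absorb_lower_order {L₀ N V S Bd : ℝ≥0∞} {L : Fin 3 → ℝ≥0∞} {C K s : ℝ} (hC : 0 < C)
    (hK : 0 ≤ K) (hs : 1 ≤ s) (hsK : 6 * (C * K) ≤ s) (hL₀ : L₀ ≠ ⊤) (hL : ∀ j, L j ≠ ⊤)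
    (h0 : L₀ ≤ ENNReal.ofReal C * (ENNReal.ofReal K * (N + S)) + ENNReal.ofReal C * Bd)
    (hN : N ≤ ENNReal.ofReal (1 / s ^ 2) * L₀)
    (h1 : ∀ j, L j ≤ ENNReal.ofReal C * (ENNReal.ofReal K * (V + S)) + ENNReal.ofReal C * Bd)
    (hV : V ≤ ENNReal.ofReal (1 / s ^ 2) * (∑ j, L j + L₀)) :
    ∑ j, L j + L₀ ≤ ENNReal.ofReal (10 * (C * K + C)) * S + ENNReal.ofReal (10 * (C * K + C)) * Bd := by
  have hCg : 0 < 10 * (C * K + C) := by positivity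
  have hCg' : ENNReal.ofReal (10 * (C * K + C)) ≠ 0 := by simpa using hCg
  by_cases hS : S = ⊤
  · rw [hS, ENNReal.mul_top hCg', top_add]; exact le_top
  by_cases hBd : Bd = ⊤
  · rw [hBd, ENNReal.mul_top hCg', add_top]; exact le_top
  have hNt : N ≠ ⊤ := ne_top_of_le_ne_top (ENNReal.mul_ne_top ENNReal.ofReal_ne_top hL₀) hN
  have hVt : V ≠ ⊤ := ne_top_of_le_ne_top (ENNReal.mul_ne_top ENNReal.ofReal_ne_top
    (ENNReal.add_ne_top.2 ⟨ENNReal.sum_ne_top.2 fun j _ => hL j, hL₀⟩)) hV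
  choose l hl hLl using fun j => ENNReal.exists_ofReal_of_ne_top (hL j)
  obtain ⟨l₀, hl₀, rfl⟩ := ENNReal.exists_ofReal_of_ne_top hL₀
  obtain ⟨n, hn, rfl⟩ := ENNReal.exists_ofReal_of_ne_top hNt
  obtain ⟨v, hv, rfl⟩ := ENNReal.exists_ofReal_of_ne_top hVt
  obtain ⟨S, hS0, rfl⟩ := ENNReal.exists_ofReal_of_ne_top hS
  obtain ⟨B, hB, rfl⟩ := ENNReal.exists_ofReal_of_ne_top hBd
  clear hS hBd
  simp only [hLl] at h1 hV ⊢
  have hsum : 0 ≤ ∑ j, l j := Finset.sum_nonneg fun j _ => hl j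
  have hs2 : 0 ≤ 1 / s ^ 2 := by positivity
  rw [← ENNReal.ofReal_sum_of_nonneg fun j _ => hl j] at hV ⊢
  rw [← ENNReal.ofReal_add hn hS0, ← ENNReal.ofReal_mul hK, ← ENNReal.ofReal_mul hC.le,
    ← ENNReal.ofReal_mul hC.le, ← ENNReal.ofReal_add (by positivity) (by positivity),
    ENNReal.ofReal_le_ofReal_iff (by positivity)] at h0
  rw [← ENNReal.ofReal_mul hs2, ENNReal.ofReal_le_ofReal_iff (by positivity)] at hN
  rw [← ENNReal.ofReal_add hsum hl₀, ← ENNReal.ofReal_mul hs2,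
    ENNReal.ofReal_le_ofReal_iff (by positivity)] at hV
  have h1' : ∀ j, l j ≤ C * (K * (v + S)) + C * B := fun j => by
    have := h1 j
    rwa [← ENNReal.ofReal_add hv hS0, ← ENNReal.ofReal_mul hK, ← ENNReal.ofReal_mul hC.le,
      ← ENNReal.ofReal_mul hC.le, ← ENNReal.ofReal_add (by positivity) (by positivity),
      ENNReal.ofReal_le_ofReal_iff (by positivity)] at this
  rw [← ENNReal.ofReal_add hsum hl₀, ← ENNReal.ofReal_mul hCg.le, ← ENNReal.ofReal_mul hCg.le,
    ← ENNReal.ofReal_add (by positivity) (by positivity)]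
  refine ENNReal.ofReal_le_ofReal ?_
  have h3 : ∑ j, l j ≤ 3 * (C * (K * (v + S)) + C * B) := by
    rw [Fin.sum_univ_three]; linarith [h1' 0, h1' 1, h1' 2]
  have hsq : C * K * (1 / s ^ 2) ≤ 1 / 6 := by
    rw [mul_one_div, div_le_iff₀ (by positivity)]
    nlinarith
  have h4 : C * K * n ≤ 1 / 6 * l₀ :=
    calc C * K * n ≤ C * K * (1 / s ^ 2 * l₀) := by gcongr
      _ = C * K * (1 / s ^ 2) * l₀ := by ring
      _ ≤ 1 / 6 * l₀ := by gcongr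
  have h5 : C * K * v ≤ 1 / 6 * (∑ j, l j + l₀) :=
    calc C * K * v ≤ C * K * (1 / s ^ 2 * (∑ j, l j + l₀)) := by gcongr
      _ = C * K * (1 / s ^ 2) * (∑ j, l j + l₀) := by ring
      _ ≤ 1 / 6 * (∑ j, l j + l₀) := by gcongr
  have h7 : 0 ≤ C * K * S := by positivity
  have h8 : 0 ≤ C * K * B := by positivity
  have h9 : 0 ≤ C * S := by positivity
  have h10 : 0 ≤ C * B := by positivity
  nlinarith

theorem lintegral_ofReal_le_mul_add {α : Type*} [MeasurableSpace α] {μ : Measure α}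
    {a b c : α → ℝ} {K : ℝ} (hK : 0 ≤ K) (hb : AEMeasurable b μ)
    (h : ∀ᵐ x ∂μ, a x ≤ K * (b x + c x)) :
    ∫⁻ x, ENNReal.ofReal (a x) ∂μ ≤
      ENNReal.ofReal K * ((∫⁻ x, ENNReal.ofReal (b x) ∂μ) + ∫⁻ x, ENNReal.ofReal (c x) ∂μ) := by
  rw [← lintegral_add_left' hb.ennreal_ofReal, ← lintegral_const_mul' _ _ ENNReal.ofReal_ne_top]
  refine lintegral_mono_ae (h.mono fun x hx => ?_)
  refine (ENNReal.ofReal_le_ofReal hx).trans ?_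
  rw [ENNReal.ofReal_mul hK]
  gcongr
  exact ENNReal.ofReal_add_le

theorem lintegral_ofReal_le_const_mul {α : Type*} [MeasurableSpace α] {μ : Measure α}
    {a b : α → ℝ} {K : ℝ} (hK : 0 ≤ K) (h : ∀ᵐ x ∂μ, a x ≤ K * b x) :
    ∫⁻ x, ENNReal.ofReal (a x) ∂μ ≤ ENNReal.ofReal K * ∫⁻ x, ENNReal.ofReal (b x) ∂μ := by
  rw [← lintegral_const_mul' _ _ ENNReal.ofReal_ne_top]
  refine lintegral_mono_ae (h.mono fun x hx => ?_)
  rw [← ENNReal.ofReal_mul hK]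
  exact ENNReal.ofReal_le_ofReal hx

theorem lintegral_sum_sq_add_le {α : Type*} [MeasurableSpace α] {μ : Measure α}
    {u : Fin 3 → α → ℝ} {b E : α → ℝ} (hu : ∀ j, AEMeasurable (u j) μ) (hE : AEMeasurable E μ)
    (hE0 : ∀ x, 0 ≤ E x) :
    ∫⁻ x, ENNReal.ofReal (((∑ j, u j x ^ 2) + b x) * E x) ∂μ ≤
      ∑ j, (∫⁻ x, ENNReal.ofReal (u j x ^ 2 * E x) ∂μ) +
        ∫⁻ x, ENNReal.ofReal (b x * E x) ∂μ := by
  have hm : ∀ j, AEMeasurable (fun x => ENNReal.ofReal (u j x ^ 2 * E x)) μ := fun j =>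
    (((hu j).pow_const 2).mul hE).ennreal_ofReal
  rw [← lintegral_finsetSum' _ fun j _ => hm j,
    ← lintegral_add_left' (Finset.aemeasurable_fun_sum _ fun j _ => hm j)]
  refine lintegral_mono fun x => ?_
  rw [add_mul, Finset.sum_mul,
    ← ENNReal.ofReal_sum_of_nonneg fun j _ => mul_nonneg (sq_nonneg _) (hE0 x)]
  exact ENNReal.ofReal_add_le

/-- Provides the finiteness without which terms cannot be absorbed into the left-hand side. -/
theorem lintegral_weight_sq_ne_top {O : Set E3} (hO : IsOpen O) (hb : Bornology.IsBounded O)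
    {a f : E3 → ℝ} (ha : ContinuousOn a (closure O)) (ha0 : ∀ x, 0 ≤ a x)
    (hf : MemLp f 2 (volume.restrict O)) :
    ∫⁻ x in O, ENNReal.ofReal (a x * f x ^ 2) ≠ ⊤ := by
  obtain ⟨B, hB⟩ := hb.isCompact_closure.exists_bound_of_continuousOn ha
  have h := lintegral_weight_sq_le (μ := volume.restrict O) (a := a) (u := f) (v := fun _ => 0)
    (B := B) (Eventually.of_forall ha0) (by
      filter_upwards [ae_restrict_mem hO.measurableSet] with x hx
      exact (le_abs_self _).trans (hB x (subset_closure hx))) (by simp)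
  simp only [sub_zero, ne_eq, OfNat.ofNat_ne_zero, not_false_eq_true, zero_pow, mul_zero,
    ENNReal.ofReal_zero, lintegral_zero, zero_add] at h
  exact ne_top_of_le_ne_top (ENNReal.mul_ne_top ENNReal.ofReal_ne_top
    (ENNReal.pow_ne_top hf.eLpNorm_ne_top)) h

/-! ### Pointwise algebra -/

theorem sq_sum_mul_le {w y : Fin 3 → ℝ} {M : ℝ} (hw : ∀ k, |w k| ≤ M) :
    (∑ k, w k * y k) ^ 2 ≤ 3 * M ^ 2 * ∑ k, y k ^ 2 := by
  have h1 := sq_sum_le_card_mul_sum_sq (s := (Finset.univ : Finset (Fin 3)))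
    (f := fun k => w k * y k)
  rw [Finset.card_univ, Fintype.card_fin] at h1
  push_cast at h1
  have h2 : ∑ k, (w k * y k) ^ 2 ≤ M ^ 2 * ∑ k, y k ^ 2 := by
    rw [Finset.mul_sum]
    refine Finset.sum_le_sum fun k _ => ?_
    rw [mul_pow]
    exact mul_le_mul_of_nonneg_right (sq_le_sq' (abs_le.1 (hw k)).1 (abs_le.1 (hw k)).2)
      (sq_nonneg _)
  linarith

theorem sq_sum_mul_sub_le {w Q e : Fin 3 → ℝ} {M R : ℝ} (hw : ∀ k, |w k| ≤ M)
    (he : ∀ k, e k ^ 2 ≤ R) :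
    (∑ k, w k * (Q k - e k)) ^ 2 ≤ 6 * M ^ 2 * ∑ k, Q k ^ 2 + 18 * M ^ 2 * R := by
  refine (sq_sum_mul_le hw).trans ?_
  have h : ∑ k, (Q k - e k) ^ 2 ≤ 2 * ∑ k, Q k ^ 2 + 6 * R := by
    simp only [Fin.sum_univ_three]
    nlinarith [he 0, he 1, he 2, sq_nonneg (Q 0 + e 0), sq_nonneg (Q 1 + e 1),
      sq_nonneg (Q 2 + e 2)]
  calc 3 * M ^ 2 * ∑ k, (Q k - e k) ^ 2 ≤ 3 * M ^ 2 * (2 * ∑ k, Q k ^ 2 + 6 * R) := by gcongr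
    _ = _ := by ring

/-- The hypothesis reads `A p = P - f r`, with `r` the row sums of `R`, and `A` is inverted. It will
be used with `p = ∇f`, `P = P f` and `r = div A`. -/
theorem sum_sq_le_of_mulVec {A : Matrix (Fin 3) (Fin 3) ℝ} (hA : A.det ≠ 0) {p P : Fin 3 → ℝ}
    {R : Fin 3 → Fin 3 → ℝ} {f α ρ : ℝ} (hP : ∀ k, P k = ∑ j, (p j * A k j + f * R k j))
    (hα : ∀ i k, |A⁻¹ i k| ≤ α) (hR : ∀ k j, |R k j| ≤ ρ) :
    ∑ i, p i ^ 2 ≤ (18 * α ^ 2 + 54 * α ^ 2 * (3 * ρ) ^ 2) * (f ^ 2 + ∑ k, P k ^ 2) := by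
  set r : Fin 3 → ℝ := fun k => ∑ j, R k j with hr
  have hρ : ∀ k, |r k| ≤ 3 * ρ := fun k => by
    refine (Finset.abs_sum_le_sum_abs _ _).trans ?_
    rw [Fin.sum_univ_three]
    linarith [hR k 0, hR k 1, hR k 2]
  have hmv : A.mulVec p = fun k => P k - f * r k := by
    ext k
    rw [hP k]
    simp only [hr, Matrix.mulVec, dotProduct, Fin.sum_univ_three]
    ring
  have hp : p = A⁻¹.mulVec (fun k => P k - f * r k) := by
    rw [← hmv, Matrix.mulVec_mulVec, Matrix.nonsing_inv_mul _ (isUnit_iff_ne_zero.2 hA),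
      Matrix.one_mulVec]
  have hi : ∀ i, p i ^ 2 ≤ 6 * α ^ 2 * ∑ k, P k ^ 2 + 18 * α ^ 2 * ((3 * ρ) ^ 2 * f ^ 2) := by
    intro i
    have e : p i = ∑ k, A⁻¹ i k * (P k - f * r k) := by
      conv_lhs => rw [hp]
      simp only [Matrix.mulVec, dotProduct]
    rw [e]
    refine sq_sum_mul_sub_le (hα i) fun k => ?_
    rw [mul_pow, mul_comm]
    exact mul_le_mul_of_nonneg_right (sq_le_sq' (abs_le.1 (hρ k)).1 (abs_le.1 (hρ k)).2)
      (sq_nonneg _)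
  have hsum : ∑ i, p i ^ 2 ≤ 18 * α ^ 2 * ∑ k, P k ^ 2 + 54 * α ^ 2 * ((3 * ρ) ^ 2 * f ^ 2) := by
    rw [Fin.sum_univ_three]
    linarith [hi 0, hi 1, hi 2]
  have h1 : 0 ≤ ∑ k, P k ^ 2 := Finset.sum_nonneg fun _ _ => sq_nonneg _
  have h2 : 0 ≤ α ^ 2 * (3 * ρ) ^ 2 * ∑ k, P k ^ 2 := by positivity
  have h3 : 0 ≤ α ^ 2 * f ^ 2 := by positivity
  nlinarith

/-- The matrix of the linear map `w ↦ v × w`. -/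
def crossMatrix (v : Fin 3 → ℝ) : Matrix (Fin 3) (Fin 3) ℝ :=
  !![0, -v 2, v 1; v 2, 0, -v 0; -v 1, v 0, 0]

/-- The scalar triple product `(v × w) · p = w · (p × v)`. For `v = b` and `p = ∇g` the right-hand
side is `w` against the principal part of `Q g`. -/
theorem sum_crossMatrix_mul (v w p : Fin 3 → ℝ) :
    ∑ l, (∑ m, crossMatrix v l m * w m) * p l =
      w 0 * (p 1 * v 2 - p 2 * v 1) + w 1 * (p 2 * v 0 - p 0 * v 2)
        + w 2 * (p 0 * v 1 - p 1 * v 0) := by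
  simp [crossMatrix, Fin.sum_univ_three]
  ring

/-- With `p = ∇d` and `v = b` this turns the hypothesis `∇d × b ≠ 0` into the transversality
condition of `exists_transversalField`. -/
theorem crossMatrix_transpose_mulVec (v p : Fin 3 → ℝ) :
    (fun m => ∑ l, crossMatrix v l m * p l) = crossProduct p v := by
  ext m
  fin_cases m <;> simp [crossMatrix, Fin.sum_univ_three, cross_apply] <;> ring


/-! ### The Carleman estimate for `div (f A)` -/

theorem exists_inverse_bound {Z : Set E3} (hZ : IsCompact Z)
    {A : E3 → Matrix (Fin 3) (Fin 3) ℝ} (hA : ContinuousOn A Z) (hdet : ∀ x ∈ Z, (A x).det ≠ 0) :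
    ∃ α : ℝ, 0 ≤ α ∧ ∀ x ∈ Z, ∀ i k, |(A x)⁻¹ i k| ≤ α := by
  have hc : ∀ p : Fin 3 × Fin 3, ContinuousOn (fun x => (A x)⁻¹ p.1 p.2) Z := by
    intro p
    have h1 : ContinuousOn (fun x => (A x).det) Z :=
      (continuous_id.matrix_det).comp_continuousOn hA
    have h2 : ContinuousOn (fun x => (A x).adjugate p.1 p.2) Z :=
      ((continuous_id.matrix_adjugate).matrix_elem p.1 p.2).comp_continuousOn hA
    refine ((h1.inv₀ hdet).mul h2).congr fun x hx => ?_
    simp [Matrix.inv_def, Ring.inverse_eq_inv']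
  obtain ⟨α, h0, hα⟩ := exists_common_bound_on_compact hZ hc
  exact ⟨α, h0, fun x hx i k => hα x hx (i, k)⟩

theorem opP_ae_eq {Ω : Set E3} (hΩ : IsSmoothBoundedDomain Ω) {S : Set E3} {f τ : E3 → ℝ}
    {A : E3 → Matrix (Fin 3) (Fin 3) ℝ} (hA : ∀ k j, MemSobolev Ω ⊤ 1 (fun x => A x k j))
    (hf : MemSobolev Ω 2 1 f) (ht : IsTrace Ω S f τ) :
    ∀ᵐ x ∂volume.restrict Ω, ∀ k, opP Ω A f x k =
      ∑ j, (weakPartial Ω j f x * A x k j + f x * weakPartial Ω j (fun y => A y k j) x) := by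
  have h : ∀ k j, weakPartial Ω j (fun y => f y * A y k j) =ᵐ[volume.restrict Ω]
      fun x => weakPartial Ω j f x * A x k j + f x * weakPartial Ω j (fun y => A y k j) x :=
    fun k j => (ht.hasWeakPartial_mul hΩ.isBounded hf (hA k j) j).weakPartial_ae_eq hΩ.isOpen
  filter_upwards [ae_all_iff.2 fun k => ae_all_iff.2 (h k)] with x hx k
  exact Finset.sum_congr rfl fun j _ => hx k j

theorem sq_le_scale (s : ℝ) {lam e : ℝ} (hlam : 1 ≤ lam) (he : 1 ≤ e) :
    s ^ 2 ≤ s ^ 2 * lam ^ 2 * e ^ 2 := by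
  have h1 : 1 ≤ lam ^ 2 := one_le_pow₀ hlam
  have h2 : 1 ≤ e ^ 2 := one_le_pow₀ he
  nlinarith [mul_le_mul h1 h2 zero_le_one (by positivity : (0 : ℝ) ≤ lam ^ 2), sq_nonneg s]

/-- Because `A` is invertible, `∇f` is bounded pointwise by `P f` and `f`. The weighted estimate is
therefore needed only for the zeroth-order term, and the remainder `f²` has the small factor `s⁻²`
relative to it. -/
theorem carleman_opP {Ω O : Set E3} (hΩ : IsSmoothBoundedDomain Ω) (hO : IsOpen O)
    (hOΩ : O ⊆ Ω) {d : E3 → ℝ} (hd : ContDiffOn ℝ 2 d (closure Ω)) (hpos : ∀ x ∈ Ω, 0 ≤ d x)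
    (hgrad : ∀ x ∈ closure Ω, gradBar Ω d x ≠ 0) {κ : ℝ} (hκ : 0 ≤ κ)
    {A : E3 → Matrix (Fin 3) (Fin 3) ℝ} (hA : ∀ k j, MemSobolev Ω ⊤ 1 (fun x => A x k j))
    (hAc : ContinuousOn A (closure Ω)) (hdet : ∀ x ∈ closure O, (A x).det ≠ 0) :
    ∃ C s₀ : ℝ, 0 < C ∧ 1 ≤ s₀ ∧ ∀ lam ≥ (1 : ℝ), ∀ s ≥ s₀, ∀ f : E3 → ℝ, MemSobolev Ω 2 1 f →
      ∀ τ : E3 → ℝ, IsTrace Ω (frontier O) f τ →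
      ∫⁻ x in O, ENNReal.ofReal (((∑ j, weakPartial Ω j f x ^ 2)
          + s ^ 2 * lam ^ 2 * Real.exp (lam * (d x + κ)) ^ 2 * f x ^ 2)
          * Real.exp (2 * s * Real.exp (lam * (d x + κ)))) ≤
        ENNReal.ofReal C * (∫⁻ x in O, ENNReal.ofReal
          ((∑ k, opP Ω A f x k ^ 2) * Real.exp (2 * s * Real.exp (lam * (d x + κ))))) +
        ENNReal.ofReal C * (∫⁻ x in frontier O, ENNReal.ofReal
          (s * lam * Real.exp (lam * (d x + κ)) * τ x ^ 2
            * Real.exp (2 * s * Real.exp (lam * (d x + κ)))) ∂surfaceMeasure) := by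
  have hcl : closure O ⊆ closure Ω := closure_mono hOΩ
  have hOb : Bornology.IsBounded O := hΩ.isBounded.subset hOΩ
  have hZ := hOb.isCompact_closure
  have hOm := hO.measurableSet
  have hμ : volume.restrict O ≤ volume.restrict Ω := Measure.restrict_mono hOΩ le_rfl
  have : IsFiniteMeasure (volume.restrict Ω) := ⟨by simpa using hΩ.isBounded.measure_lt_top⟩
  obtain ⟨w, D, M, c, hX, -⟩ := exists_transversalField hΩ hO hOΩ hd hpos hκ
    -- With the identity matrix the field is `w` itself, a smooth approximation of `∇d`.
    (B := fun l m _ => if l = m then 1 else 0) (B' := fun _ _ _ => 0)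
    (fun l m => hasWeakPartial_const Ω l _) (fun l m => memLp_top_const _)
    (fun l m => memLp_top_const _) (fun l m => continuousOn_const)
    (fun x hx => by simpa using hgrad x (hcl hx))
  obtain ⟨α, hα0, hα⟩ := exists_inverse_bound hZ (hAc.mono hcl) hdet
  obtain ⟨ρ, hρ0, hρ⟩ := exists_common_ae_bound (μ := volume.restrict Ω)
    (u := fun p : Fin 3 × Fin 3 => weakPartial Ω p.2 (fun y => A y p.1 p.2))
    (fun p => ((hA p.1 p.2).2 p.2).2)
  obtain ⟨C, s₀, hC, hs₀, hcarl⟩ := hX.carleman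
  set K₀ := 18 * α ^ 2 + 54 * α ^ 2 * (3 * ρ) ^ 2 with hK₀
  have hK₀' : 0 ≤ K₀ := by positivity
  set K := K₀ + 3 * M ^ 2 * K₀ with hK
  have hK' : 0 ≤ K := by positivity
  have hK1 : K₀ ≤ K := by rw [hK]; have : 0 ≤ 3 * M ^ 2 * K₀ := by positivity
                          linarith
  have hK2 : 3 * M ^ 2 * K₀ ≤ K := by rw [hK]; linarith
  -- `C + 1` replaces `C` so that the factor is at least `1`: the pointwise bound for the gradient,
  -- which carries no such factor, then also fits `absorb_lower_order`.
  refine ⟨10 * ((C + 1) * K + (C + 1)), max s₀ (6 * ((C + 1) * K)), by positivity,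
    hs₀.trans (le_max_left _ _), ?_⟩
  intro lam hlam s hs f hf τ ht
  have hss₀ : s₀ ≤ s := (le_max_left _ _).trans hs
  have hs1 : 1 ≤ s := hs₀.trans hss₀
  have hsK : 6 * ((C + 1) * K) ≤ s := (le_max_right _ _).trans hs
  set e : E3 → ℝ := fun x => Real.exp (lam * (d x + κ)) with he
  set E : E3 → ℝ := fun x => Real.exp (2 * s * e x) with hE
  have hec : ContinuousOn e (closure O) := by
    have := hX.contq
    fun_prop
  have hEc : ContinuousOn E (closure O) := by fun_prop
  have hE0 : ∀ x, 0 < E x := fun x => Real.exp_pos _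
  have he1 : ∀ x ∈ O, 1 ≤ e x := fun x hx =>
    Real.one_le_exp (mul_nonneg (by linarith) (hX.nonnegq x (subset_closure hx)))
  have hEm : AEMeasurable E (volume.restrict O) :=
    ((hEc.mono subset_closure).aestronglyMeasurable hOm).aemeasurable
  have hfO : MemLp f 2 (volume.restrict O) := hf.1.mono_measure hμ
  have hpO : ∀ j, MemLp (weakPartial Ω j f) 2 (volume.restrict O) := fun j =>
    (hf.2 j).2.mono_measure hμ
  have hest := (hcarl lam hlam s hss₀ hOΩ f τ (fun j => (hf.2 j).2.aestronglyMeasurable) ht).1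
  have hpt : ∀ᵐ x ∂volume.restrict O, ∑ i, weakPartial Ω i f x ^ 2 ≤
      K₀ * (f x ^ 2 + ∑ k, opP Ω A f x k ^ 2) := by
    filter_upwards [ae_mono hμ (opP_ae_eq hΩ hA hf ht), ae_mono hμ hρ, ae_restrict_mem hOm]
      with x h1 h2 hx
    exact sum_sq_le_of_mulVec (hdet x (subset_closure hx)) h1 (hα x (subset_closure hx))
      fun k j => h2 (k, j)
  have hSnn : ∀ x, 0 ≤ f x ^ 2 + ∑ k, opP Ω A f x k ^ 2 := fun x =>
    add_nonneg (sq_nonneg _) (Finset.sum_nonneg fun _ _ => sq_nonneg _)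
  have hNm : AEMeasurable (fun x => f x ^ 2 * E x) (volume.restrict O) :=
    (hfO.aestronglyMeasurable.aemeasurable.pow_const 2).mul hEm
  have hCC : ENNReal.ofReal C ≤ ENNReal.ofReal (C + 1) :=
    ENNReal.ofReal_le_ofReal (by linarith)
  refine (lintegral_sum_sq_add_le (u := fun j => weakPartial Ω j f)
    (b := fun x => s ^ 2 * lam ^ 2 * e x ^ 2 * f x ^ 2)
    (fun j => (hpO j).aestronglyMeasurable.aemeasurable) hEm fun x => (hE0 x).le).trans ?_
  have hN : ∫⁻ x in O, ENNReal.ofReal (f x ^ 2 * E x) ≤ ENNReal.ofReal (1 / s ^ 2) *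
      ∫⁻ x in O, ENNReal.ofReal (s ^ 2 * lam ^ 2 * e x ^ 2 * f x ^ 2 * E x) := by
    refine lintegral_ofReal_le_const_mul (by positivity) ?_
    filter_upwards [ae_restrict_mem hOm] with x hx
    have h1 := sq_le_scale s hlam (he1 x hx)
    rw [one_div, inv_mul_eq_div, le_div_iff₀ (by positivity)]
    have h2 : 0 ≤ f x ^ 2 * E x := mul_nonneg (sq_nonneg _) (hE0 x).le
    nlinarith
  refine absorb_lower_order (N := ∫⁻ x in O, ENNReal.ofReal (f x ^ 2 * E x))
    (V := ∫⁻ x in O, ENNReal.ofReal (f x ^ 2 * E x)) (C := C + 1) (K := K) (s := s)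
    (by linarith) hK' hs1 hsK ?_ ?_ ?_ hN ?_ ?_
  · have := lintegral_weight_sq_ne_top hO hOb
      (a := fun x => s ^ 2 * lam ^ 2 * e x ^ 2 * E x) (by fun_prop)
      (fun x => mul_nonneg (by positivity) (hE0 x).le) hfO
    refine ne_of_eq_of_ne (lintegral_congr fun x => ?_) this
    congr 1
    ring
  · intro j
    have := lintegral_weight_sq_ne_top hO hOb hEc (fun x => (hE0 x).le) (hpO j)
    refine ne_of_eq_of_ne (lintegral_congr fun x => ?_) this
    congr 1
    ring
  · refine hest.trans (add_le_add (mul_le_mul' hCC ?_) (mul_le_mul' hCC le_rfl))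
    refine lintegral_ofReal_le_mul_add hK' hNm ?_
    filter_upwards [hpt, ae_all_iff.2 hX.boundX] with x h1 h2
    have h3 := sq_sum_mul_le (y := fun j => weakPartial Ω j f x) h2
    rw [← add_mul, ← mul_assoc]
    refine mul_le_mul_of_nonneg_right ?_ (hE0 x).le
    calc _ ≤ 3 * M ^ 2 * ∑ j, weakPartial Ω j f x ^ 2 := h3
      _ ≤ 3 * M ^ 2 * (K₀ * (f x ^ 2 + ∑ k, opP Ω A f x k ^ 2)) := by gcongr
      _ = 3 * M ^ 2 * K₀ * (f x ^ 2 + ∑ k, opP Ω A f x k ^ 2) := by ring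
      _ ≤ _ := mul_le_mul_of_nonneg_right hK2 (hSnn x)
  · intro j
    refine le_trans ?_ (le_add_right le_rfl)
    have h1 : ∫⁻ x in O, ENNReal.ofReal (weakPartial Ω j f x ^ 2 * E x) ≤
        ENNReal.ofReal K * ((∫⁻ x in O, ENNReal.ofReal (f x ^ 2 * E x)) +
          ∫⁻ x in O, ENNReal.ofReal ((∑ k, opP Ω A f x k ^ 2) * E x)) := by
      refine lintegral_ofReal_le_mul_add hK' hNm ?_
      filter_upwards [hpt] with x h1
      rw [← add_mul, ← mul_assoc]
      refine mul_le_mul_of_nonneg_right ?_ (hE0 x).le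
      calc weakPartial Ω j f x ^ 2 ≤ ∑ i, weakPartial Ω i f x ^ 2 :=
            Finset.single_le_sum (f := fun i => weakPartial Ω i f x ^ 2)
              (fun i _ => sq_nonneg _) (Finset.mem_univ j)
        _ ≤ _ := h1
        _ ≤ _ := mul_le_mul_of_nonneg_right hK1 (hSnn x)
    refine h1.trans ?_
    calc _ = 1 * (ENNReal.ofReal K * ((∫⁻ x in O, ENNReal.ofReal (f x ^ 2 * E x)) +
          ∫⁻ x in O, ENNReal.ofReal ((∑ k, opP Ω A f x k ^ 2) * E x))) := (one_mul _).symm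
      _ ≤ _ := mul_le_mul' (ENNReal.one_le_ofReal.2 (by linarith)) le_rfl
  · exact hN.trans (mul_le_mul' le_rfl (le_add_left le_rfl))

/-! ### The Carleman estimate for `rot (g b)` -/

section Curl

variable {Ω : Set E3} {S : Set E3} {g τ : E3 → ℝ} {τ' : Fin 3 → E3 → ℝ} {b : E3 → Fin 3 → ℝ}

theorem MemSobolev.of_succ_one {p : ℝ≥0∞} {u : E3 → ℝ} (h : MemSobolev Ω p 2 u) :
    MemSobolev Ω p 1 u := ⟨h.1, fun j => ⟨(h.2 j).1, (h.2 j).2.1⟩⟩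

/-- The formal value of `∂_j ∂_a (g b_c)`. -/
def leibnizSecond (Ω : Set E3) (b : E3 → Fin 3 → ℝ) (g : E3 → ℝ) (j a c : Fin 3) (x : E3) : ℝ :=
  weakPartial Ω j (weakPartial Ω a g) x * b x c
    + weakPartial Ω a g x * weakPartial Ω j (fun y => b y c) x
    + (weakPartial Ω j g x * weakPartial Ω a (fun y => b y c) x
    + g x * weakPartial Ω j (weakPartial Ω a (fun y => b y c)) x)

theorem weakPartial_mul_ae_eq (hΩ : IsSmoothBoundedDomain Ω)
    (hb : ∀ i, MemSobolev Ω ⊤ 2 (fun x => b x i)) (hg : MemSobolev Ω 2 2 g)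
    (ht : IsTrace Ω S g τ) (a c : Fin 3) :
    weakPartial Ω a (fun y => g y * b y c) =ᵐ[volume.restrict Ω]
      fun x => weakPartial Ω a g x * b x c + g x * weakPartial Ω a (fun y => b y c) x :=
  (ht.hasWeakPartial_mul hΩ.isBounded hg.of_succ_one (hb c).of_succ_one a).weakPartial_ae_eq
    hΩ.isOpen

/-- The product rule is applied to `∂_a g · b_c` and to `g · ∂_a b_c`, so smooth approximations of
both `∂_a g` and `g` are needed; the two families of traces supply them. -/
theorem hasWeakPartial_weakPartial_mul (hΩ : IsSmoothBoundedDomain Ω)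
    (hb : ∀ i, MemSobolev Ω ⊤ 2 (fun x => b x i)) (hg : MemSobolev Ω 2 2 g)
    (ht : IsTrace Ω S g τ) (ht' : ∀ j, IsTrace Ω S (weakPartial Ω j g) (τ' j)) (j a c : Fin 3) :
    HasWeakPartial Ω j (weakPartial Ω a (fun y => g y * b y c)) (leibnizSecond Ω b g j a c) := by
  have h1 := (ht' a).hasWeakPartial_mul hΩ.isBounded (hg.2 a).2 (hb c).of_succ_one j
  have h2 := ht.hasWeakPartial_mul hΩ.isBounded hg.of_succ_one ((hb c).2 a).2 j
  exact (h1.add h2).congr_ae hΩ.isOpen (weakPartial_mul_ae_eq hΩ hb hg ht a c).symm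
    EventuallyEq.rfl

theorem weakPartial_opQ_ae_eq (hΩ : IsSmoothBoundedDomain Ω)
    (hb : ∀ i, MemSobolev Ω ⊤ 2 (fun x => b x i)) (hg : MemSobolev Ω 2 2 g)
    (ht : IsTrace Ω S g τ) (ht' : ∀ j, IsTrace Ω S (weakPartial Ω j g) (τ' j)) :
    ∀ᵐ x ∂volume.restrict Ω, ∀ j,
      weakPartial Ω j (fun y => opQ Ω b g y 0) x =
        leibnizSecond Ω b g j 1 2 x - leibnizSecond Ω b g j 2 1 x ∧
      weakPartial Ω j (fun y => opQ Ω b g y 1) x =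
        leibnizSecond Ω b g j 2 0 x - leibnizSecond Ω b g j 0 2 x ∧
      weakPartial Ω j (fun y => opQ Ω b g y 2) x =
        leibnizSecond Ω b g j 0 1 x - leibnizSecond Ω b g j 1 0 x := by
  have h := hasWeakPartial_weakPartial_mul hΩ hb hg ht ht'
  have h0 : ∀ j, _ := fun j => ((h j 1 2).sub (h j 2 1)).weakPartial_ae_eq hΩ.isOpen
  have h1 : ∀ j, _ := fun j => ((h j 2 0).sub (h j 0 2)).weakPartial_ae_eq hΩ.isOpen
  have h2 : ∀ j, _ := fun j => ((h j 0 1).sub (h j 1 0)).weakPartial_ae_eq hΩ.isOpen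
  filter_upwards [ae_all_iff.2 h0, ae_all_iff.2 h1, ae_all_iff.2 h2] with x e0 e1 e2 j
  exact ⟨e0 j, e1 j, e2 j⟩

end Curl


/-! ### Pointwise inequalities for the curl and the estimate for `Q`. -/

theorem sq_add_six_le (a₁ a₂ a₃ a₄ a₅ a₆ : ℝ) :
    (a₁ + a₂ + a₃ - (a₄ + a₅ + a₆)) ^ 2 ≤
      6 * (a₁ ^ 2 + a₂ ^ 2 + a₃ ^ 2 + a₄ ^ 2 + a₅ ^ 2 + a₆ ^ 2) := by
  nlinarith [sq_nonneg (a₁ - a₂), sq_nonneg (a₁ - a₃), sq_nonneg (a₁ + a₄), sq_nonneg (a₁ + a₅),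
    sq_nonneg (a₁ + a₆), sq_nonneg (a₂ - a₃), sq_nonneg (a₂ + a₄), sq_nonneg (a₂ + a₅),
    sq_nonneg (a₂ + a₆), sq_nonneg (a₃ + a₄), sq_nonneg (a₃ + a₅), sq_nonneg (a₃ + a₆),
    sq_nonneg (a₄ - a₅), sq_nonneg (a₄ - a₆), sq_nonneg (a₅ - a₆)]

theorem sq_mul_le_of_abs_le {y β M T : ℝ} (hβ : |β| ≤ M) (hy : y ^ 2 ≤ T) :
    (y * β) ^ 2 ≤ M ^ 2 * T := by
  rw [mul_pow, mul_comm]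
  exact mul_le_mul (sq_le_sq' (abs_le.1 hβ).1 (abs_le.1 hβ).2) hy (sq_nonneg _) (sq_nonneg _)

section PointwiseCurl

variable {w v p : Fin 3 → ℝ} {Q : Fin 3 → ℝ} {g M T : ℝ}

/-- Control of `(v × w) · p` by the components of a curl-like expression. -/
theorem sq_crossMatrix_dot_le (hw : ∀ k, |w k| ≤ M) {G : Fin 3 → Fin 3 → ℝ}
    {r : Fin 3 → Fin 3 → ℝ} (hG : ∀ a c, G a c = p a * v c + r a c)
    (h0 : Q 0 = G 1 2 - G 2 1) (h1 : Q 1 = G 2 0 - G 0 2) (h2 : Q 2 = G 0 1 - G 1 0)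
    (hr : ∀ a c a' c', (r a c - r a' c') ^ 2 ≤ T) :
    (∑ l, (∑ m, crossMatrix v l m * w m) * p l) ^ 2 ≤
      6 * M ^ 2 * ∑ k, Q k ^ 2 + 18 * M ^ 2 * T := by
  -- The triple product replaces `p × v` by `Q` minus the antisymmetrised remainder `r`.
  have e : ∑ l, (∑ m, crossMatrix v l m * w m) * p l =
      ∑ k, w k * (Q k - (![r 1 2 - r 2 1, r 2 0 - r 0 2, r 0 1 - r 1 0] : Fin 3 → ℝ) k) := by
    rw [sum_crossMatrix_mul, Fin.sum_univ_three, h0, h1, h2]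
    simp only [hG, Matrix.cons_val_zero, Matrix.cons_val_one, Matrix.cons_val]
    ring
  rw [e]
  refine sq_sum_mul_sub_le hw fun k => ?_
  fin_cases k
  · exact hr 1 2 2 1
  · exact hr 2 0 0 2
  · exact hr 0 1 1 0

end PointwiseCurl

/-- `Q g` does not determine `∇g` pointwise, so, in contrast to `P`, the derivatives need an
estimate of their own. It is obtained by differentiating `Q g` once and using the weaker weight,
which explains the term `|∇(Q g)|²` with its factor `(s λ φ)⁻²`. -/
theorem carleman_opQ {Ω O : Set E3} (hΩ : IsSmoothBoundedDomain Ω) (hO : IsOpen O)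
    (hOΩ : O ⊆ Ω) {d : E3 → ℝ} (hd : ContDiffOn ℝ 2 d (closure Ω)) (hpos : ∀ x ∈ Ω, 0 ≤ d x)
    {κ : ℝ} (hκ : 0 ≤ κ)
    {b : E3 → Fin 3 → ℝ} (hb : ∀ i, MemSobolev Ω ⊤ 2 (fun x => b x i))
    (hbc : ContinuousOn b (closure Ω))
    (hcross : ∀ x ∈ closure O, crossProduct (gradBar Ω d x) (b x) ≠ 0) :
    ∃ C s₀ : ℝ, 0 < C ∧ 1 ≤ s₀ ∧ ∀ lam ≥ (1 : ℝ), ∀ s ≥ s₀, ∀ g : E3 → ℝ, MemSobolev Ω 2 2 g →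
      ∀ (τ : E3 → ℝ) (τ' : Fin 3 → E3 → ℝ), IsTrace Ω (frontier O) g τ →
      (∀ j, IsTrace Ω (frontier O) (weakPartial Ω j g) (τ' j)) →
      ∫⁻ x in O, ENNReal.ofReal (((∑ j, weakPartial Ω j g x ^ 2)
          + s ^ 2 * lam ^ 2 * Real.exp (lam * (d x + κ)) ^ 2 * g x ^ 2)
          * Real.exp (2 * s * Real.exp (lam * (d x + κ)))) ≤
        ENNReal.ofReal C * (∫⁻ x in O, ENNReal.ofReal
          ((1 / (s ^ 2 * lam ^ 2 * Real.exp (lam * (d x + κ)) ^ 2)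
            * (∑ j, ∑ k, weakPartial Ω j (fun y => opQ Ω b g y k) x ^ 2)
            + (∑ k, opQ Ω b g x k ^ 2)) * Real.exp (2 * s * Real.exp (lam * (d x + κ))))) +
        ENNReal.ofReal C * (∫⁻ x in frontier O, ENNReal.ofReal
          ((1 / (s * lam * Real.exp (lam * (d x + κ))) * (∑ j, τ' j x ^ 2)
            + s * lam * Real.exp (lam * (d x + κ)) * τ x ^ 2)
            * Real.exp (2 * s * Real.exp (lam * (d x + κ)))) ∂surfaceMeasure) := by
  have hcl : closure O ⊆ closure Ω := closure_mono hOΩ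
  have hOb : Bornology.IsBounded O := hΩ.isBounded.subset hOΩ
  have hOm := hO.measurableSet
  have hμ : volume.restrict O ≤ volume.restrict Ω := Measure.restrict_mono hOΩ le_rfl
  have : IsFiniteMeasure (volume.restrict Ω) := ⟨by simpa using hΩ.isBounded.measure_lt_top⟩
  have hb1 : ∀ l i, HasWeakPartial Ω l (fun x => b x i) (weakPartial Ω l (fun x => b x i)) :=
    fun l i => hasWeakPartial_weakPartial ((hb i).2 l).1
  have hz : ∀ l, HasWeakPartial Ω l (fun _ => 0) (fun _ => 0) := fun l =>
    hasWeakPartial_const Ω l 0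
  have hb1L : ∀ l i, MemLp (weakPartial Ω l (fun x => b x i)) ⊤ (volume.restrict Ω) :=
    fun l i => ((hb i).2 l).2.1
  have hbc' : ∀ i, ContinuousOn (fun x => b x i) (closure O) := fun i =>
    (continuousOn_pi.1 hbc i).mono hcl
  -- The field is `X = b × w`, and `X · ∇d = w · (∇d × b)`.
  obtain ⟨w, D, M₀, c, hX, hwM₀⟩ := exists_transversalField hΩ hO hOΩ hd hpos hκ
    (B := fun l m x => crossMatrix (b x) l m)
    (B' := fun l m x => crossMatrix (fun i => weakPartial Ω l (fun y => b y i) x) l m)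
    (fun l m => by
      fin_cases l <;> fin_cases m
      exacts [hz 0, (hb1 0 2).neg, hb1 0 1, hb1 1 2, hz 1, (hb1 1 0).neg, (hb1 2 1).neg,
        hb1 2 0, hz 2])
    (fun l m => by
      have h0 : MemLp (fun _ : E3 => (0 : ℝ)) ⊤ (volume.restrict Ω) := memLp_top_const 0
      fin_cases l <;> fin_cases m
      exacts [h0, (hb 2).1.neg, (hb 1).1, (hb 2).1, h0, (hb 0).1.neg, (hb 1).1.neg, (hb 0).1, h0])
    (fun l m => by
      have h0 : MemLp (fun _ : E3 => (0 : ℝ)) ⊤ (volume.restrict Ω) := memLp_top_const 0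
      fin_cases l <;> fin_cases m
      exacts [h0, (hb1L 0 2).neg, hb1L 0 1, hb1L 1 2, h0, (hb1L 1 0).neg, (hb1L 2 1).neg,
        hb1L 2 0, h0])
    (fun l m => by
      have h0 : ContinuousOn (fun _ : E3 => (0 : ℝ)) (closure O) := continuousOn_const
      fin_cases l <;> fin_cases m
      exacts [h0, (hbc' 2).neg, hbc' 1, hbc' 2, h0, (hbc' 0).neg, (hbc' 1).neg, hbc' 0, h0])
    (fun x hx => by rw [crossMatrix_transpose_mulVec]; exact hcross x hx)
  obtain ⟨M₁, hM₁, hbM₁⟩ := exists_common_ae_bound (μ := volume.restrict Ω)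
    (u := fun p : Fin 3 × Fin 3 => weakPartial Ω p.1 (fun y => b y p.2))
    (fun p => hb1L p.1 p.2)
  obtain ⟨M₂, hM₂, hbM₂⟩ := exists_common_ae_bound (μ := volume.restrict Ω)
    (u := fun p : Fin 3 × Fin 3 × Fin 3 =>
      weakPartial Ω p.1 (weakPartial Ω p.2.1 (fun y => b y p.2.2)))
    (fun p => (((hb p.2.2).2 p.2.1).2.2 p.1).2)
  obtain ⟨C, s₀, hC, hs₀, hcarl⟩ := hX.carleman
  set M := M₀ + M₁ + M₂ with hM
  have hM₀ : 0 ≤ M₀ := hX.nonnegM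
  have hwM : ∀ x ∈ closure O, ∀ m, |w m x| ≤ M := fun x hx m =>
    (hwM₀ x hx m).trans (by rw [hM]; linarith)
  set K := 6 * M ^ 2 + 18 * M ^ 2 * (36 * M ^ 2) with hK
  have hK' : 0 ≤ K := by positivity
  have hKQ : 6 * M ^ 2 ≤ K := by rw [hK]; have : 0 ≤ 18 * M ^ 2 * (36 * M ^ 2) := by positivity
                                 linarith
  have hKT : 18 * M ^ 2 * (36 * M ^ 2) ≤ K := by rw [hK]; have : 0 ≤ 6 * M ^ 2 := by positivity
                                                 linarith
  refine ⟨10 * (C * K + C), max s₀ (6 * (C * K)), by positivity,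
    hs₀.trans (le_max_left _ _), ?_⟩
  intro lam hlam s hs g hg τ τ' ht ht'
  have hss₀ : s₀ ≤ s := (le_max_left _ _).trans hs
  have hs1 : 1 ≤ s := hs₀.trans hss₀
  have hsK : 6 * (C * K) ≤ s := (le_max_right _ _).trans hs
  set e : E3 → ℝ := fun x => Real.exp (lam * (d x + κ)) with he
  set E : E3 → ℝ := fun x => Real.exp (2 * s * e x) with hE
  have hec : ContinuousOn e (closure O) := by
    have := hX.contq
    fun_prop
  have hEc : ContinuousOn E (closure O) := by fun_prop
  have hE0 : ∀ x, 0 < E x := fun x => Real.exp_pos _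
  have hepos : ∀ x, 0 < e x := fun x => Real.exp_pos _
  have he1 : ∀ x ∈ O, 1 ≤ e x := fun x hx =>
    Real.one_le_exp (mul_nonneg (by linarith) (hX.nonnegq x (subset_closure hx)))
  have hEm : AEMeasurable E (volume.restrict O) :=
    ((hEc.mono subset_closure).aestronglyMeasurable hOm).aemeasurable
  have hem : AEMeasurable e (volume.restrict O) :=
    ((hec.mono subset_closure).aestronglyMeasurable hOm).aemeasurable
  have hgO : MemLp g 2 (volume.restrict O) := hg.1.mono_measure hμ
  have hpO : ∀ j, MemLp (weakPartial Ω j g) 2 (volume.restrict O) := fun j =>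
    (hg.2 j).2.1.mono_measure hμ
  have hgm := hgO.aestronglyMeasurable.aemeasurable
  have hpm : ∀ j, AEMeasurable (weakPartial Ω j g) (volume.restrict O) := fun j =>
    (hpO j).aestronglyMeasurable.aemeasurable
  have hs0 : 0 < s := by linarith
  have hl0 : 0 < lam := by linarith
  -- The strong form is used for `g` and the weak form for each `∂_j g`.
  have est0 := (hcarl lam hlam s hss₀ hOΩ g τ (fun j => (hg.2 j).2.1.aestronglyMeasurable) ht).1
  have est1 := fun j => (hcarl lam hlam s hss₀ hOΩ (weakPartial Ω j g) (τ' j)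
    (fun i => (((hg.2 j).2.2 i).2).aestronglyMeasurable) (ht' j)).2
  -- pointwise bounds
  have hcomm : ∀ j l, weakPartial Ω j (weakPartial Ω l g) =ᵐ[volume.restrict Ω]
      weakPartial Ω l (weakPartial Ω j g) := fun j l =>
    HasWeakPartial.comm hΩ.isOpen (hasWeakPartial_weakPartial (hg.2 l).1)
      (hasWeakPartial_weakPartial (hg.2 j).1) (hasWeakPartial_weakPartial ((hg.2 l).2.2 j).1)
      (hasWeakPartial_weakPartial ((hg.2 j).2.2 l).1)
  have hpt0 : ∀ᵐ x ∂volume.restrict O,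
      (∑ l, (∑ m, crossMatrix (b x) l m * w m x) * weakPartial Ω l g x) ^ 2 ≤
        K * (g x ^ 2 + ∑ k, opQ Ω b g x k ^ 2) := by
    filter_upwards [ae_mono hμ (ae_all_iff.2 fun a => ae_all_iff.2 fun c =>
      weakPartial_mul_ae_eq hΩ hb hg ht a c), ae_mono hμ hbM₁, ae_restrict_mem hOm]
      with x h1 h2 hx
    have hr : ∀ a c a' c', (g x * weakPartial Ω a (fun y => b y c) x
        - g x * weakPartial Ω a' (fun y => b y c') x) ^ 2 ≤ 36 * M ^ 2 * g x ^ 2 := by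
      intro a c a' c'
      have hM' : ∀ a c, |weakPartial Ω a (fun y => b y c) x| ≤ M := fun a c =>
        (h2 (a, c)).trans (by rw [hM]; linarith)
      have y1 := sq_mul_le_of_abs_le (hM' a c) (le_refl (g x ^ 2))
      have y2 := sq_mul_le_of_abs_le (hM' a' c') (le_refl (g x ^ 2))
      have y3 : 0 ≤ M ^ 2 * g x ^ 2 := by positivity
      nlinarith [sq_nonneg (g x * weakPartial Ω a (fun y => b y c) x
        + g x * weakPartial Ω a' (fun y => b y c') x)]
    have key := sq_crossMatrix_dot_le (Q := opQ Ω b g x) (w := fun m => w m x) (v := b x)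
      (p := fun l => weakPartial Ω l g x)
      (G := fun a c => weakPartial Ω a (fun y => g y * b y c) x)
      (hwM x (subset_closure hx)) h1 rfl rfl rfl hr
    refine key.trans ?_
    have n1 : 0 ≤ ∑ k, opQ Ω b g x k ^ 2 := Finset.sum_nonneg fun _ _ => sq_nonneg _
    have n2 := mul_le_mul_of_nonneg_right hKQ n1
    have n3 := mul_le_mul_of_nonneg_right hKT (sq_nonneg (g x))
    linarith
  have hpt1 : ∀ j, ∀ᵐ x ∂volume.restrict O,
      (∑ l, (∑ m, crossMatrix (b x) l m * w m x) *
        weakPartial Ω l (weakPartial Ω j g) x) ^ 2 ≤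
        K * (((∑ i, weakPartial Ω i g x ^ 2) + g x ^ 2)
          + ∑ k, weakPartial Ω j (fun y => opQ Ω b g y k) x ^ 2) := by
    intro j
    filter_upwards [ae_mono hμ (weakPartial_opQ_ae_eq hΩ hb hg ht ht'), ae_mono hμ hbM₁,
      ae_mono hμ hbM₂, ae_mono hμ (ae_all_iff.2 (hcomm j)), ae_restrict_mem hOm]
      with x h1 h2 h3 h4 hx
    set T := (∑ i, weakPartial Ω i g x ^ 2) + g x ^ 2 with hT
    have hTp : ∀ i, weakPartial Ω i g x ^ 2 ≤ T := fun i => by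
      have := Finset.single_le_sum (f := fun i => weakPartial Ω i g x ^ 2)
        (fun i _ => sq_nonneg _) (Finset.mem_univ i)
      have := sq_nonneg (g x)
      linarith
    have hTg : g x ^ 2 ≤ T := by
      have : 0 ≤ ∑ i, weakPartial Ω i g x ^ 2 := Finset.sum_nonneg fun _ _ => sq_nonneg _
      linarith
    have hT0 : 0 ≤ T := (sq_nonneg _).trans hTg
    have hMa : ∀ a c, |weakPartial Ω a (fun y => b y c) x| ≤ M := fun a c =>
      (h2 (a, c)).trans (by rw [hM]; linarith)
    have hMb : ∀ a c, |weakPartial Ω j (weakPartial Ω a (fun y => b y c)) x| ≤ M := fun a c =>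
      (h3 (j, a, c)).trans (by rw [hM]; linarith)
    have key := sq_crossMatrix_dot_le (T := 36 * M ^ 2 * T)
      (Q := fun k => weakPartial Ω j (fun y => opQ Ω b g y k) x) (w := fun m => w m x) (v := b x)
      (p := fun l => weakPartial Ω l (weakPartial Ω j g) x)
      (G := fun a c => leibnizSecond Ω b g j a c x)
      (r := fun a c => weakPartial Ω a g x * weakPartial Ω j (fun y => b y c) x
        + weakPartial Ω j g x * weakPartial Ω a (fun y => b y c) x
        + g x * weakPartial Ω j (weakPartial Ω a (fun y => b y c)) x)
      (hwM x (subset_closure hx)) (fun a c => by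
        rw [leibnizSecond, h4 a]; ring) (h1 j).1 (h1 j).2.1 (h1 j).2.2 (fun a c a' c' => by
        -- Six products, each with square at most `M² T`, and the factor `6` of the inequality make
        -- up `36 M² T`.
        refine (sq_add_six_le _ _ _ _ _ _).trans ?_
        have z1 := sq_mul_le_of_abs_le (hMa j c) (hTp a)
        have z2 := sq_mul_le_of_abs_le (hMa a c) (hTp j)
        have z3 := sq_mul_le_of_abs_le (hMb a c) hTg
        have z4 := sq_mul_le_of_abs_le (hMa j c') (hTp a')
        have z5 := sq_mul_le_of_abs_le (hMa a' c') (hTp j)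
        have z6 := sq_mul_le_of_abs_le (hMb a' c') hTg
        linarith)
    refine key.trans ?_
    have n1 : 0 ≤ ∑ k, weakPartial Ω j (fun y => opQ Ω b g y k) x ^ 2 :=
      Finset.sum_nonneg fun _ _ => sq_nonneg _
    have n2 := mul_le_mul_of_nonneg_right hKQ n1
    have n3 := mul_le_mul_of_nonneg_right hKT hT0
    linarith
  -- absorption
  set z : E3 → ℝ := fun x => 1 / (s ^ 2 * lam ^ 2 * e x ^ 2) with hz
  have hz0 : ∀ x, 0 ≤ z x := fun x => by simp only [hz]; positivity
  have hzm : AEMeasurable z (volume.restrict O) :=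
    ((hem.pow_const 2).const_mul _).const_div _
  have hQnn : ∀ x, 0 ≤ ∑ k, opQ Ω b g x k ^ 2 := fun x =>
    Finset.sum_nonneg fun _ _ => sq_nonneg _
  have hDQnn : ∀ j x, 0 ≤ ∑ k, weakPartial Ω j (fun y => opQ Ω b g y k) x ^ 2 := fun j x =>
    Finset.sum_nonneg fun _ _ => sq_nonneg _
  have hLadd := lintegral_sum_sq_add_le (u := fun j => weakPartial Ω j g)
    (b := fun x => s ^ 2 * lam ^ 2 * e x ^ 2 * g x ^ 2) hpm hEm fun x => (hE0 x).le
  refine hLadd.trans ?_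
  refine absorb_lower_order (N := ∫⁻ x in O, ENNReal.ofReal (g x ^ 2 * E x))
    (V := ∫⁻ x in O, ENNReal.ofReal (z x * ((∑ i, weakPartial Ω i g x ^ 2) + g x ^ 2) * E x))
    (C := C) (K := K) (s := s) hC hK' hs1 hsK ?_ ?_ ?_ ?_ ?_ ?_
  · have := lintegral_weight_sq_ne_top hO hOb
      (a := fun x => s ^ 2 * lam ^ 2 * e x ^ 2 * E x) (by fun_prop)
      (fun x => mul_nonneg (by positivity) (hE0 x).le) hgO
    refine ne_of_eq_of_ne (lintegral_congr fun x => ?_) this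
    congr 1
    ring
  · intro j
    have := lintegral_weight_sq_ne_top hO hOb hEc (fun x => (hE0 x).le) (hpO j)
    refine ne_of_eq_of_ne (lintegral_congr fun x => ?_) this
    congr 1
    ring
  · refine est0.trans (add_le_add (mul_le_mul' le_rfl ?_) (mul_le_mul' le_rfl ?_))
    · refine lintegral_ofReal_le_mul_add hK' ((hgm.pow_const 2).mul hEm) ?_
      filter_upwards [hpt0] with x h1
      rw [← add_mul, ← mul_assoc]
      refine mul_le_mul_of_nonneg_right (h1.trans ?_) (hE0 x).le
      refine mul_le_mul_of_nonneg_left ?_ hK'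
      have := mul_nonneg (hz0 x) (Finset.sum_nonneg fun j (_ : j ∈ Finset.univ) => hDQnn j x)
      simp only [hz] at this
      linarith
    · refine lintegral_mono fun x => ENNReal.ofReal_le_ofReal ?_
      refine mul_le_mul_of_nonneg_right ?_ (hE0 x).le
      have h1 : 0 ≤ 1 / (s * lam * e x) * ∑ j, τ' j x ^ 2 :=
        mul_nonneg (by have := hepos x; positivity) (Finset.sum_nonneg fun _ _ => sq_nonneg _)
      exact le_add_of_nonneg_left h1
  · refine lintegral_ofReal_le_const_mul (by positivity) ?_
    filter_upwards [ae_restrict_mem hOm] with x hx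
    have h1 := sq_le_scale s hlam (he1 x hx)
    rw [one_div, inv_mul_eq_div, le_div_iff₀ (by positivity)]
    have h2 : 0 ≤ g x ^ 2 * E x := mul_nonneg (sq_nonneg _) (hE0 x).le
    nlinarith
  · intro j
    refine (est1 j).trans (add_le_add (mul_le_mul' le_rfl ?_) (mul_le_mul' le_rfl ?_))
    · refine lintegral_ofReal_le_mul_add hK' ?_ ?_
      · exact (hzm.mul ((Finset.aemeasurable_fun_sum _ fun i _ => (hpm i).pow_const 2).add
          (hgm.pow_const 2))).mul hEm
      filter_upwards [hpt1 j] with x h1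
      rw [← add_mul, ← mul_assoc]
      refine mul_le_mul_of_nonneg_right ?_ (hE0 x).le
      refine (mul_le_mul_of_nonneg_left h1 (hz0 x)).trans ?_
      have h2 : ∑ k, weakPartial Ω j (fun y => opQ Ω b g y k) x ^ 2 ≤
          ∑ j, ∑ k, weakPartial Ω j (fun y => opQ Ω b g y k) x ^ 2 :=
        Finset.single_le_sum (f := fun j => ∑ k, weakPartial Ω j (fun y => opQ Ω b g y k) x ^ 2)
          (fun i _ => hDQnn i x) (Finset.mem_univ j)
      have h3 := mul_le_mul_of_nonneg_left h2 (hz0 x)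
      have h4 := hQnn x
      have h5 := mul_le_mul_of_nonneg_left (h3.trans (le_add_of_nonneg_right h4)) hK'
      calc z x * (K * (((∑ i, weakPartial Ω i g x ^ 2) + g x ^ 2)
          + ∑ k, weakPartial Ω j (fun y => opQ Ω b g y k) x ^ 2))
          = K * (z x * ((∑ i, weakPartial Ω i g x ^ 2) + g x ^ 2)) + K * (z x *
            ∑ k, weakPartial Ω j (fun y => opQ Ω b g y k) x ^ 2) := by ring
        _ ≤ _ := add_le_add le_rfl h5
        _ = _ := by rw [← mul_add]
    · refine lintegral_mono fun x => ENNReal.ofReal_le_ofReal ?_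
      refine mul_le_mul_of_nonneg_right ?_ (hE0 x).le
      have h0 : 0 ≤ 1 / (s * lam * e x) := by have := hepos x; positivity
      have h1 : 0 ≤ s * lam * e x * τ x ^ 2 := by have := hepos x; positivity
      have h2 := Finset.single_le_sum (f := fun j => τ' j x ^ 2) (fun i _ => sq_nonneg _)
        (Finset.mem_univ j)
      exact (mul_le_mul_of_nonneg_left h2 h0).trans (le_add_of_nonneg_right h1)
  -- The factor `z ≤ s⁻²` gives the gain, and `g²` is dominated by `s² λ² φ² g²`, so the remainder
  -- is measured by the full left-hand side.
  · refine le_trans ?_ (mul_le_mul' le_rfl hLadd)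
    refine lintegral_ofReal_le_const_mul (by positivity) ?_
    filter_upwards [ae_restrict_mem hOm] with x hx
    have h1 := sq_le_scale s hlam (he1 x hx)
    rw [← mul_assoc]
    refine mul_le_mul_of_nonneg_right ?_ (hE0 x).le
    have hp0 : 0 ≤ ∑ i, weakPartial Ω i g x ^ 2 := Finset.sum_nonneg fun _ _ => sq_nonneg _
    have hone : 1 ≤ s ^ 2 * lam ^ 2 * e x ^ 2 := (one_le_pow₀ hs1).trans h1
    refine mul_le_mul (one_div_le_one_div_of_le (by positivity) h1) ?_
      (add_nonneg hp0 (sq_nonneg _)) (by positivity)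
    have := mul_le_mul_of_nonneg_right hone (sq_nonneg (g x))
    linarith

/-! ### The weight at time `t₀` and the conclusion. -/

theorem phi_eq (d : E3 → ℝ) (β t₀ T lam : ℝ) (x : E3) :
    phi d β t₀ T lam x t₀ = Real.exp (lam * (d x + c0 β t₀ T)) := by
  simp [phi, psi]

end CarlemanReg

end
open CarlemanReg in
theorem theorem3p6
    (Ω : Set E3) (hΩ : IsSmoothBoundedDomain Ω)
    (Γ : Set E3) (hΓ_ne : Γ.Nonempty) (hΓ : ∃ U : Set E3, IsOpen U ∧ Γ = U ∩ frontier Ω)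
    (d : E3 → ℝ) (hd : IsWeightBase Ω Γ d)
    (T t₀ β : ℝ) (ht₀ : t₀ ∈ Set.Ioo 0 T) (hβ : 0 < β)
    (O : Set E3) (hO : IsOpen O) (hOΩ : O ⊆ Ω)
    (A : E3 → Matrix (Fin 3) (Fin 3) ℝ) (b : E3 → Fin 3 → ℝ)
    (hA : ∀ k j, MemSobolev Ω ∞ 1 (fun x => A x k j))
    (hb : ∀ i, MemSobolev Ω ∞ 2 (fun x => b x i))
    -- the continuous representatives of the coefficients
    (hA_cont : ContinuousOn A (closure Ω)) (hb_cont : ContinuousOn b (closure Ω))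
    (hdet : ∀ x ∈ closure O, (A x).det ≠ 0)
    (hcross : ∀ x ∈ closure O, crossProduct (gradBar Ω d x) (b x) ≠ 0) :
    ∃ lam₀ s₀ C : ℝ, 1 ≤ lam₀ ∧ 1 ≤ s₀ ∧ 0 < C ∧ ∀ lam ≥ lam₀, ∀ s ≥ s₀,
      (∀ f : E3 → ℝ, MemSobolev Ω 2 1 f →
        ∀ τ : E3 → ℝ, IsTrace Ω (frontier O) f τ →
        (∫⁻ x in O, ENNReal.ofReal
            (((∑ j, weakPartial Ω j f x ^ 2)
                + s ^ 2 * lam ^ 2 * phi d β t₀ T lam x t₀ ^ 2 * f x ^ 2)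
              * Real.exp (2 * s * phi d β t₀ T lam x t₀)))
          ≤ ENNReal.ofReal C * (∫⁻ x in O, ENNReal.ofReal
              ((∑ k, opP Ω A f x k ^ 2) * Real.exp (2 * s * phi d β t₀ T lam x t₀)))
            + ENNReal.ofReal C * (∫⁻ x in frontier O, ENNReal.ofReal
              (s * lam * phi d β t₀ T lam x t₀ * τ x ^ 2
                * Real.exp (2 * s * phi d β t₀ T lam x t₀)) ∂surfaceMeasure)) ∧
      (∀ g : E3 → ℝ, MemSobolev Ω 2 2 g →
        ∀ (τ : E3 → ℝ) (τ' : Fin 3 → E3 → ℝ), IsTrace Ω (frontier O) g τ →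
        (∀ j, IsTrace Ω (frontier O) (weakPartial Ω j g) (τ' j)) →
        (∫⁻ x in O, ENNReal.ofReal
            (((∑ j, weakPartial Ω j g x ^ 2)
                + s ^ 2 * lam ^ 2 * phi d β t₀ T lam x t₀ ^ 2 * g x ^ 2)
              * Real.exp (2 * s * phi d β t₀ T lam x t₀)))
          ≤ ENNReal.ofReal C * (∫⁻ x in O, ENNReal.ofReal
              ((1 / (s ^ 2 * lam ^ 2 * phi d β t₀ T lam x t₀ ^ 2)
                  * (∑ j, ∑ k, weakPartial Ω j (fun y => opQ Ω b g y k) x ^ 2)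
                + (∑ k, opQ Ω b g x k ^ 2))
                * Real.exp (2 * s * phi d β t₀ T lam x t₀)))
            + ENNReal.ofReal C * (∫⁻ x in frontier O, ENNReal.ofReal
              ((1 / (s * lam * phi d β t₀ T lam x t₀) * (∑ j, τ' j x ^ 2)
                  + s * lam * phi d β t₀ T lam x t₀ * τ x ^ 2)
                * Real.exp (2 * s * phi d β t₀ T lam x t₀)) ∂surfaceMeasure)) := by
  have hpos : ∀ x ∈ Ω, 0 ≤ d x := fun x hx => (hd.pos x hx).le
  -- Non-negativity of `c₀` keeps `q = d + c₀` non-negative, hence `φ ≥ 1` on the closure of `O`.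
  have hκ : 0 ≤ c0 β t₀ T := le_max_of_le_left (by positivity)
  obtain ⟨C₁, s₁, hC₁, hs₁, hP⟩ := carleman_opP hΩ hO hOΩ hd.contDiffOn hpos hd.grad_ne_zero hκ
    hA hA_cont hdet
  obtain ⟨C₂, s₂, hC₂, hs₂, hQ⟩ := carleman_opQ hΩ hO hOΩ hd.contDiffOn hpos hκ hb hb_cont hcross
  refine ⟨1, max s₁ s₂, max C₁ C₂, le_rfl, hs₁.trans (le_max_left _ _),
    hC₁.trans_le (le_max_left _ _), fun lam hlam s hs => ⟨fun f hf τ hτ => ?_,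
    fun g hg τ τ' hτ hτ' => ?_⟩⟩
  · simp only [phi_eq]
    have hC := ENNReal.ofReal_le_ofReal (le_max_left C₁ C₂)
    exact (hP lam hlam s ((le_max_left _ _).trans hs) f hf τ hτ).trans
      (add_le_add (mul_le_mul' hC le_rfl) (mul_le_mul' hC le_rfl))
  · simp only [phi_eq]
    have hC := ENNReal.ofReal_le_ofReal (le_max_right C₁ C₂)
    exact (hQ lam hlam s ((le_max_right _ _).trans hs) g hg τ τ' hτ hτ').trans
      (add_le_add (mul_le_mul' hC le_rfl) (mul_le_mul' hC le_rfl))
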